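/- Let $q>2$ be a prime power. Let $\mathcal W(5,q)$ be the symplectic polar space of $\mathrm{PG}(5,q)$ given by the alternating form with Gram matrix $\begin{pmatrix}0&I_3\\-I_3&0\end{pmatrix}$, with polarity $\perp$; its generators (totally isotropic subspaces of maximal dimension) are planes. Let $L(A)$ be the row space of $(I_3\mid A)$, $\Pi_2=L(0)$, and let $\Pi_1$ be the generator spanned by the last three unit vectors. Let $\mathcal S_{3,q}$ be the set of symmetric $3\times 3$ matrices over $\mathrm{GF}(q)$; a $2$-code is a subset of $\mathcal S_{3,q}$ in which the minimum of $\mathrm{rk}(A-B)$ over distinct elements $A,B$ is $2$. (1) The map $A\mapsto L(A)$ is a bijection from $\mathcal S_{3,q}$ onto the set of generators of $\mathcal W(5,q)$ disjoint from $\Pi_1$. (2) There is a set of $q^4+q^3+1$ planes that are generators of $\mathcal W(5,q)$, all disjoint from $\Pi_1$ and pairwise meeting in at most one point, and its preimage under $L$ is a $2$-code of $\mathcal S_{3,q}$ of size $q^4+q^3+1$. (3) Every $2$-code of $\mathcal S_{3,q}$ that is a subgroup of $(\mathcal S_{3,q},+)$ has fewer than $q^4+q^3+1$ elements. (4) Every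 maximum $2$-code of $\mathcal S_{3,q}$ has at least $q^4+q^3+1$ elements. (5) Let $\Pi_3$ be a generator disjoint from $\Pi_1$ and $\Pi_2$. There is a unique Segre variety $\Sigma_{1,2}$ whose family of $q+1$ pairwise disjoint planes, written $\Pi_1,\dots,\Pi_{q+1}$, contains $\Pi_1,\Pi_2,\Pi_3$. For a point $Q\in\Pi_2$ let $s_Q$ be the line through $Q$ meeting $\Pi_1$ and $\Pi_3$, and let $Q^{\rho_2}=s_Q^\perp\cap\Pi_2$. Call $Q$ exceptional if $Q\in Q^{\rho_2}$ or if $q$ is even and $Q^{\rho_2}$ is exactly the set of points $R\in\Pi_2$ with $R\in R^{\rho_2}$. For every point $P\in\Pi_2$ choose a $3$-space $\Sigma_P\subset P^\perp$ with $P\notin\Sigma_P$ and $P^\perp\cap\Pi_1\subset\Sigma_P$, and a set $\mathcal F_P$ of totally isotropic lines that partitions the points of $\Sigma_P$ and contains $\Sigma_P\cap\Pi_1$ and $\Sigma_P\cap\Pi_2$; if $P$ is not exceptional, require moreover that $\Sigma_P=\langle P^\perp\cap\Pi_1,P^{\rho_2}\rangle$, that $\mathcal F_P$ is a Desarguesian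 line-spread, and that the lines of $\mathcal F_P$ among $\Sigma_P\cap\Pi_i$, $1\le i\le q+1$, are exactly $\Sigma_P\cap\Pi_1$ and $\Sigma_P\cap\Pi_2$. Such choices exist. For all such choices, let $\bar{\mathcal X}$ consist of $\Pi_2,\dots,\Pi_{q+1}$ together with all generators that, for some point $P\in\Pi_2$, pass through $P$ and meet $\Sigma_P$ in a line of $\mathcal F_P$ other than $\Sigma_P\cap\Pi_1,\Sigma_P\cap\Pi_2$. Then $\bar{\mathcal X}$ consists of $q^4+q^3-1$ generators (planes) of $\mathcal W(5,q)$, disjoint from $\Pi_1$ and pairwise intersecting in at most one point. -/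

import Mathlib

open Module

/-- The vector space underlying `PG(2n-1, q)`; the coordinates `X_1, …, X_n` are the left ones,
`X_{n+1}, …, X_{2n}` the right ones. -/
abbrev AmbientSpace (F : Type*) (n : ℕ) : Type _ := (Fin n ⊕ Fin n) → F

/-- The alternating form with Gram matrix `(0 I; -I 0)`, defining `W(2n-1, q)`. -/
noncomputable def symplecticForm (F : Type*) [Field F] (n : ℕ) :
    LinearMap.BilinForm F (AmbientSpace F n) :=
  Matrix.toBilin' (Matrix.fromBlocks 0 1 (-1) 0)

/-- The subspace `U^⊥` with respect to the symplectic polarity. -/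
noncomputable def perp {F : Type*} [Field F] {n : ℕ} (U : Submodule F (AmbientSpace F n)) :
    Submodule F (AmbientSpace F n) :=
  (symplecticForm F n).orthogonal U

/-- `U` is a subspace of the polar space `W(2n-1, q)`. -/
def IsTotallyIsotropic {F : Type*} [Field F] {n : ℕ} (U : Submodule F (AmbientSpace F n)) : Prop :=
  ∀ u ∈ U, ∀ v ∈ U, symplecticForm F n u v = 0

/-- Generators: the subspaces of maximal dimension contained in the polar space `W(2n-1, q)`. -/
def IsGenerator {F : Type*} [Field F] {n : ℕ} (U : Submodule F (AmbientSpace F n)) : Prop :=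
  IsTotallyIsotropic U ∧
    ∀ U' : Submodule F (AmbientSpace F n), IsTotallyIsotropic U' → finrank F U' ≤ finrank F U

/-- The generator `Π₁`, spanned by `U_{n+1}, …, U_{2n}`. -/
def planeOne (F : Type*) [Field F] (n : ℕ) : Submodule F (AmbientSpace F n) :=
  Submodule.span F (Set.range fun i : Fin n => Pi.single (Sum.inr i) (1 : F))

/-- `L(M)`: the span of the rows of the `n × 2n` matrix `(I M)`. -/
def rowSpace {F : Type*} [Field F] {n : ℕ} (M : Matrix (Fin n) (Fin n) F) :
    Submodule F (AmbientSpace F n) :=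
  Submodule.span F (Set.range (Matrix.fromCols (1 : Matrix (Fin n) (Fin n) F) M).row)

/-- The generator `Π₂ = L(0)`. -/
def planeTwo (F : Type*) [Field F] (n : ℕ) : Submodule F (AmbientSpace F n) :=
  rowSpace (0 : Matrix (Fin n) (Fin n) F)

/-- A `d`-code of symmetric matrices: a set of symmetric matrices whose minimum rank distance
is `d`. -/
def IsSymmCode {F : Type*} [Field F] {n : ℕ} (d : ℕ) (C : Set (Matrix (Fin n) (Fin n) F)) : Prop :=
  (∀ A ∈ C, A.IsSymm) ∧ IsLeast {r : ℕ | ∃ A ∈ C, ∃ B ∈ C, A ≠ B ∧ (A - B).rank = r} d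

/-- A `d`-code of symmetric matrices of largest possible size (for a finite field). -/
def IsMaximumSymmCode {F : Type*} [Field F] {n : ℕ} (d : ℕ)
    (C : Set (Matrix (Fin n) (Fin n) F)) : Prop :=
  IsSymmCode d C ∧ ∀ D : Set (Matrix (Fin n) (Fin n) F), IsSymmCode d D → D.ncard ≤ C.ncard

/-- `𝓡` is the family of planes `{x} × PG(2, q)`, `x ∈ PG(1, q)`, of a Segre variety `Σ_{1,2}` of
`PG(5, q)`, that is, of the image of the Segre map `(x, y) ↦ (x_i y_j)` in some coordinates. -/
def IsSegrePlanes {F : Type*} [Field F] (𝓡 : Set (Submodule F (AmbientSpace F 3))) : Prop :=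
  ∃ e : Matrix (Fin 2) (Fin 3) F ≃ₗ[F] AmbientSpace F 3,
    𝓡 = {U | ∃ x : Fin 2 → F, x ≠ 0 ∧
      ∀ v, v ∈ U ↔ ∃ y : Fin 3 → F, e (Matrix.vecMulVec x y) = v}

/-- The projective points of a subspace. -/
def pointsOf {F : Type*} [Field F] {n : ℕ} (U : Submodule F (AmbientSpace F n)) :
    Set (Submodule F (AmbientSpace F n)) :=
  {P | finrank F P = 1 ∧ P ≤ U}

/-- For a point `Q` of `Π₂`: the line through `Q` meeting `Π₁` and the plane `E`. -/
def transversal {F : Type*} [Field F] (E Q : Submodule F (AmbientSpace F 3)) :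
    Submodule F (AmbientSpace F 3) :=
  Q ⊔ (planeOne F 3 ⊓ (Q ⊔ E))

/-- `Q ^ ρ₂`: the polar line of the point `Q` with respect to the polarity `ρ₂` induced on `Π₂`
by `Π₁` and `E`. -/
noncomputable def polarLine {F : Type*} [Field F] (E Q : Submodule F (AmbientSpace F 3)) :
    Submodule F (AmbientSpace F 3) :=
  planeTwo F 3 ⊓ perp (transversal E Q)

/-- The absolute points of `ρ₂`: the conic `α₂` for `q` odd, the points of the line `v₂` for `q`
even. -/
def absolutePoints {F : Type*} [Field F] (E : Submodule F (AmbientSpace F 3)) :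
    Set (Submodule F (AmbientSpace F 3)) :=
  {P | P ∈ pointsOf (planeTwo F 3) ∧ P ≤ polarLine E P}

/-- The exceptional points of `Π₂`: the absolute points of `ρ₂` and, for `q` even, also the point
`V₂` whose polar line is the line `v₂` of absolute points. -/
def exceptionalPoints {F : Type*} [Field F] [Fintype F] (E : Submodule F (AmbientSpace F 3)) :
    Set (Submodule F (AmbientSpace F 3)) :=
  absolutePoints E ∪
    {V | V ∈ pointsOf (planeTwo F 3) ∧ Even (Fintype.card F) ∧
      pointsOf (polarLine E V) = absolutePoints E}

/-- `𝓕` is a line-spread of the polar space that `W(5, q)` induces on `S`: a set of totally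
isotropic lines of `S` partitioning the points of `S`. -/
def IsLineSpread {F : Type*} [Field F] (S : Submodule F (AmbientSpace F 3))
    (𝓕 : Set (Submodule F (AmbientSpace F 3))) : Prop :=
  (∀ l ∈ 𝓕, l ≤ S ∧ finrank F l = 2 ∧ IsTotallyIsotropic l) ∧
    ∀ P ∈ pointsOf S, ∃! l, l ∈ 𝓕 ∧ P ≤ l

/-- `𝓕` is a Desarguesian line-spread of `S`: for some structure of vector space over the
quadratic extension `F(J)` on `S`, `𝓕` is the set of its one-dimensional subspaces. -/
def IsDesarguesian {F : Type*} [Field F] (S : Submodule F (AmbientSpace F 3))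
    (𝓕 : Set (Submodule F (AmbientSpace F 3))) : Prop :=
  ∃ (J : End F (AmbientSpace F 3)) (a b : F),
    (∀ t : F, t ^ 2 ≠ a * t + b) ∧
    (∀ v ∈ S, J v ∈ S ∧ J (J v) = a • J v + b • v) ∧
    𝓕 = {l | ∃ v ∈ S, v ≠ 0 ∧ l = Submodule.span F {v, J v}}

/-- The choices at a point `P` of `Π₂`: a 3-space `S` (vector dimension 4) of `P^⊥` not through
`P` and meeting `Π₁` in the line `r = P^⊥ ∩ Π₁`, and a line-spread `𝓕` of the polar space induced
on `S` that contains the lines `r = S ∩ Π₁` and `t = S ∩ Π₂`. -/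
def IsLocalChoice {F : Type*} [Field F] (P S : Submodule F (AmbientSpace F 3))
    (𝓕 : Set (Submodule F (AmbientSpace F 3))) : Prop :=
  finrank F S = 4 ∧ S ≤ perp P ∧ ¬ P ≤ S ∧ perp P ⊓ planeOne F 3 ≤ S ∧
    IsLineSpread S 𝓕 ∧ S ⊓ planeOne F 3 ∈ 𝓕 ∧ S ⊓ planeTwo F 3 ∈ 𝓕

/-- Admissible choices of `Σ_P` and `𝓕_P` for all points `P` of `Π₂`. At a point `Q` that is not
exceptional, `Σ_Q` is the span of `Q^⊥ ∩ Π₁` and `Q ^ ρ₂`, and `𝓕_Q` is Desarguesian and has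
exactly the lines `r_Q`, `t_Q` in common with the regulus `{Σ_Q ∩ Π_i}`. -/
def IsAdmissible {F : Type*} [Field F] [Fintype F] (E : Submodule F (AmbientSpace F 3))
    (𝓡 : Set (Submodule F (AmbientSpace F 3)))
    (S : Submodule F (AmbientSpace F 3) → Submodule F (AmbientSpace F 3))
    (𝓕 : Submodule F (AmbientSpace F 3) → Set (Submodule F (AmbientSpace F 3))) : Prop :=
  (∀ P ∈ pointsOf (planeTwo F 3), IsLocalChoice P (S P) (𝓕 P)) ∧
    ∀ Q ∈ pointsOf (planeTwo F 3), Q ∉ exceptionalPoints E →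
      S Q = (perp Q ⊓ planeOne F 3) ⊔ polarLine E Q ∧
      IsDesarguesian (S Q) (𝓕 Q) ∧
      𝓕 Q ∩ {l | ∃ U ∈ 𝓡, l = S Q ⊓ U} = {S Q ⊓ planeOne F 3, S Q ⊓ planeTwo F 3}

/-- The generators through `P` meeting `S` in a line of `𝓕` other than `S ∩ Π₁` and `S ∩ Π₂`. -/
def generatorsThrough {F : Type*} [Field F] (P S : Submodule F (AmbientSpace F 3))
    (𝓕 : Set (Submodule F (AmbientSpace F 3))) : Set (Submodule F (AmbientSpace F 3)) :=
  {U | IsGenerator U ∧ P ≤ U ∧ S ⊓ U ∈ 𝓕 \ {S ⊓ planeOne F 3, S ⊓ planeTwo F 3}}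

/-- The set `𝒳̄`: the generators coming from the spreads at the points of `Π₂`, and the planes
other than `Π₁` of the Segre variety. -/
def barX {F : Type*} [Field F] (𝓡 : Set (Submodule F (AmbientSpace F 3)))
    (S : Submodule F (AmbientSpace F 3) → Submodule F (AmbientSpace F 3))
    (𝓕 : Submodule F (AmbientSpace F 3) → Set (Submodule F (AmbientSpace F 3))) :
    Set (Submodule F (AmbientSpace F 3)) :=
  (⋃ P ∈ pointsOf (planeTwo F 3), generatorsThrough P (S P) (𝓕 P)) ∪ (𝓡 \ {planeOne F 3})

/-- `𝒳` consists of planes that are generators of `W(5, q)`, are disjoint from `Π₁`, and pairwise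
meet in at most one point. -/
def IsPlaneCode {F : Type*} [Field F] (𝒳 : Set (Submodule F (AmbientSpace F 3))) : Prop :=
  (∀ U ∈ 𝒳, IsGenerator U ∧ finrank F U = 3 ∧ Disjoint U (planeOne F 3)) ∧
    ∀ U ∈ 𝒳, ∀ U' ∈ 𝒳, U ≠ U' → finrank F ↥(U ⊓ U') ≤ 1

/-!
A generator disjoint from `Π₁` is the graph `L(A) = {(x, Ax)}` of a symmetric matrix, and
`dim (L(A) ∩ L(B)) = 3 - rk (A - B)`. So the planes can be treated as matrices, and "meeting in at
most a point" says that the difference is not of rank one.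

*Regulus.* If `Π₃ = L(A₀)`, then `A₀` is nonsingular, and the planes of the only Segre variety
through `Π₁`, `Π₂`, `Π₃` are `Π₁` and the `L(cA₀)` (`eq_regulus_of_isSegrePlanes`). The form `A₀`
describes the polarity `ρ₂` of `Π₂`.

*The set `barX`.* Through the point `P = ⟨(p, 0)⟩` there is one generator for each of the `q² - 1`
remaining lines of the spread (`ncard_generatorsThrough`), and it is `L(A)` with `ker A = ⟨p⟩`. Two
symmetric matrices of rank two with different kernels never differ by a matrix of rank one
(`not_rank_sub_le_one_of_kernels`), and two planes at the same point share only that point because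
spread lines are disjoint. If `A - cA₀` has rank one, where `Ap = 0`, then
`(pᵀA₀p) A = c ((pᵀA₀p) A₀ - (A₀p)(A₀p)ᵀ)` with `pᵀA₀p ≠ 0`, so `P` is not an absolute point. If
`P` is not exceptional, `L(A)` and `L(cA₀)` agree on `Σ_P`, against the choice of the spread; if it
is, then `q` is even and `A` is alternating, which no generator of a local spread allows
(`not_alternating_of_mem_generatorsThrough`).

*Existence of the spreads.* Given a frame `e, f, p` and an irreducible polynomial `t² - vt + w`, a
quadratic extension structure on `Σ_P` is written down explicitly (`FieldFrame`). Its lines avoid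
the planes `L(cB)` as soon as one linear condition in `(v, w)` holds (`Avoids`), and the irreducible
polynomials do not all lie on one line of the `(v, w)`-plane or, for `q > 3`, on two lines.

*Two more planes.* For `A₀ = 1` there is a nonsingular symmetric matrix `B` such that `d - cB` never
has rank one if `c ≠ 0` (`extraMatrix`). Choosing all spreads so that they avoid the multiples of
`B`, the planes `L(B)` and `L(μB)`, `μ ≠ 0, 1`, can be added to `barX`. For `q = 3` the five points
where two conditions on `(v, w)` occur are checked directly.

*Additive codes.* With respect to a trace form, the dual of an additive code of symmetric matrices
is a group `G` of quadratic forms. If the code has no element of rank one, each nonzero vector is a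
zero of exactly `|G| / q` of the forms. As every ternary quadratic form has a number of zeros
divisible by `q` (`dvd_card_quadratic_zeros`), counting zeros gives `q² ∣ |G|`, so that the code has
at most `q⁴` elements.
-/

open scoped Matrix

/-! ### Generators and symmetric matrices -/

section Generators

variable {F : Type*} [Field F] {n : ℕ}

theorem symplecticForm_apply (v w : AmbientSpace F n) :
    symplecticForm F n v w =
      (v ∘ Sum.inl) ⬝ᵥ (w ∘ Sum.inr) - (v ∘ Sum.inr) ⬝ᵥ (w ∘ Sum.inl) := by
  rw [symplecticForm, Matrix.toBilin'_apply', Matrix.fromBlocks_mulVec]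
  simp [Matrix.neg_mulVec, dotProduct, sub_eq_add_neg]

theorem symplecticForm_elim (x y x' y' : Fin n → F) :
    symplecticForm F n (Sum.elim x y) (Sum.elim x' y') = x ⬝ᵥ y' - y ⬝ᵥ x' := by
  simp [symplecticForm_apply]

theorem symplecticForm_isAlt : (symplecticForm F n).IsAlt := fun v => by
  rw [symplecticForm_apply, dotProduct_comm, sub_self]

theorem symplecticForm_isRefl : (symplecticForm F n).IsRefl := symplecticForm_isAlt.isRefl

theorem symplecticForm_nondegenerate : (symplecticForm F n).Nondegenerate := by
  refine (LinearMap.IsRefl.nondegenerate_iff_separatingLeft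
    (B := symplecticForm F n) symplecticForm_isRefl).2 ?_
  intro v hv
  have h1 : v ∘ Sum.inl = 0 := by
    refine dotProduct_eq_zero _ fun y => ?_
    simpa [symplecticForm_apply] using hv (Sum.elim 0 y)
  have h2 : v ∘ Sum.inr = 0 := by
    refine dotProduct_eq_zero _ fun y => ?_
    simpa [symplecticForm_apply] using hv (Sum.elim y 0)
  rw [← Sum.elim_comp_inl_inr v, h1, h2]
  ext (i | i) <;> rfl

theorem mem_perp {U : Submodule F (AmbientSpace F n)} {v : AmbientSpace F n} :
    v ∈ perp U ↔ ∀ u ∈ U, symplecticForm F n u v = 0 :=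
  LinearMap.BilinForm.mem_orthogonal_iff

theorem finrank_add_finrank_perp (U : Submodule F (AmbientSpace F n)) :
    finrank F U + finrank F (perp U) = 2 * n := by
  have h := LinearMap.BilinForm.finrank_orthogonal symplecticForm_nondegenerate U
  have h2 : finrank F (AmbientSpace F n) = 2 * n := by simp [two_mul]
  have h3 := Submodule.finrank_le U
  unfold perp
  lia

theorem IsTotallyIsotropic.le_perp {U : Submodule F (AmbientSpace F n)}
    (h : IsTotallyIsotropic U) : U ≤ perp U :=
  fun v hv => mem_perp.2 fun u hu => h u hu v hv

theorem IsTotallyIsotropic.finrank_le {U : Submodule F (AmbientSpace F n)}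
    (h : IsTotallyIsotropic U) : finrank F U ≤ n := by
  have h1 := Submodule.finrank_mono h.le_perp
  have h2 := finrank_add_finrank_perp U
  lia

theorem mem_planeOne {v : AmbientSpace F n} : v ∈ planeOne F n ↔ v ∘ Sum.inl = 0 := by
  constructor
  · intro h
    induction h using Submodule.span_induction with
    | mem x hx => obtain ⟨i, rfl⟩ := hx; ext j; simp
    | zero => rfl
    | add x y _ _ hx hy => ext j; simpa using congrArg₂ (· + ·) (congrFun hx j) (congrFun hy j)
    | smul a x _ hx => ext j; simpa using Or.inr (congrFun hx j)
  · intro h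
    have : v = ∑ i : Fin n, v (Sum.inr i) • Pi.single (Sum.inr i) (1 : F) := by
      ext (j | j)
      · simpa [Finset.sum_apply] using congrFun h j
      · simp [Finset.sum_apply, Pi.single_apply]
    rw [this]
    exact Submodule.sum_mem _ fun i _ => Submodule.smul_mem _ _ (Submodule.subset_span ⟨i, rfl⟩)

theorem mem_rowSpace {A : Matrix (Fin n) (Fin n) F} {v : AmbientSpace F n} :
    v ∈ rowSpace A ↔ v ∘ Sum.inr = (v ∘ Sum.inl) ᵥ* A := by
  rw [rowSpace, ← range_vecMulLinear]
  constructor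
  · rintro ⟨x, rfl⟩
    simp [Matrix.vecMul_fromCols]
  · intro h
    refine ⟨v ∘ Sum.inl, ?_⟩
    simp [Matrix.vecMul_fromCols, ← h]

theorem elim_mem_planeOne {x y : Fin n → F} :
    (Sum.elim x y : AmbientSpace F n) ∈ planeOne F n ↔ x = 0 := by
  simp [mem_planeOne]

theorem elim_mem_rowSpace {A : Matrix (Fin n) (Fin n) F} (hA : A.IsSymm) {x y : Fin n → F} :
    (Sum.elim x y : AmbientSpace F n) ∈ rowSpace A ↔ y = A *ᵥ x := by
  rw [mem_rowSpace, ← Matrix.mulVec_transpose, hA.eq]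
  simp

theorem elim_mem_planeTwo {x y : Fin n → F} :
    (Sum.elim x y : AmbientSpace F n) ∈ planeTwo F n ↔ y = 0 := by
  rw [planeTwo, elim_mem_rowSpace Matrix.isSymm_zero]
  simp

/-- The embedding `x ↦ (x, xA)` of `Fⁿ` with image `L(A)`. -/
def graphMap (A : Matrix (Fin n) (Fin n) F) : (Fin n → F) →ₗ[F] AmbientSpace F n :=
  (Matrix.fromCols (1 : Matrix (Fin n) (Fin n) F) A).vecMulLinear

theorem graphMap_apply (A : Matrix (Fin n) (Fin n) F) (x : Fin n → F) :
    graphMap A x = Sum.elim x (x ᵥ* A) := by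
  simp [graphMap, Matrix.vecMul_fromCols]

theorem graphMap_injective (A : Matrix (Fin n) (Fin n) F) : Function.Injective (graphMap A) := by
  intro x y h
  simp only [graphMap_apply] at h
  simpa using congrArg (· ∘ Sum.inl) h

theorem range_graphMap (A : Matrix (Fin n) (Fin n) F) :
    LinearMap.range (graphMap A) = rowSpace A :=
  range_vecMulLinear _

theorem finrank_rowSpace (A : Matrix (Fin n) (Fin n) F) : finrank F (rowSpace A) = n := by
  rw [← range_graphMap, LinearMap.finrank_range_of_inj (graphMap_injective A)]
  simp

theorem isTotallyIsotropic_rowSpace {A : Matrix (Fin n) (Fin n) F} (hA : A.IsSymm) :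
    IsTotallyIsotropic (rowSpace A) := by
  intro u hu v hv
  rw [mem_rowSpace, ← Matrix.mulVec_transpose, hA.eq] at hu hv
  rw [symplecticForm_apply, hu, hv, Matrix.dotProduct_mulVec, ← Matrix.mulVec_transpose, hA.eq,
    sub_self]

theorem isGenerator_iff {U : Submodule F (AmbientSpace F n)} :
    IsGenerator U ↔ IsTotallyIsotropic U ∧ finrank F U = n := by
  refine ⟨fun h => ⟨h.1, le_antisymm h.1.finrank_le ?_⟩, fun h => ⟨h.1, fun U' h' => ?_⟩⟩
  · refine (finrank_rowSpace (0 : Matrix (Fin n) (Fin n) F)).symm.trans_le ?_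
    exact h.2 _ (isTotallyIsotropic_rowSpace Matrix.isSymm_zero)
  · rw [h.2]
    exact h'.finrank_le

theorem isGenerator_rowSpace {A : Matrix (Fin n) (Fin n) F} (hA : A.IsSymm) :
    IsGenerator (rowSpace A) :=
  isGenerator_iff.2 ⟨isTotallyIsotropic_rowSpace hA, finrank_rowSpace A⟩

theorem disjoint_rowSpace_planeOne (A : Matrix (Fin n) (Fin n) F) :
    Disjoint (rowSpace A) (planeOne F n) := by
  rw [Submodule.disjoint_def]
  intro v h1 h2
  rw [mem_rowSpace] at h1
  rw [mem_planeOne] at h2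
  rw [h2, Matrix.zero_vecMul] at h1
  rw [← Sum.elim_comp_inl_inr v, h1, h2]
  ext (i | i) <;> rfl

theorem rowSpace_injective :
    Function.Injective (rowSpace : Matrix (Fin n) (Fin n) F → Submodule F (AmbientSpace F n)) := by
  intro A B h
  refine Matrix.ext_of_single_vecMul fun i => ?_
  have h1 : graphMap A (Pi.single i 1) ∈ rowSpace B := by
    rw [← h, ← range_graphMap]
    exact ⟨_, rfl⟩
  rw [graphMap_apply, mem_rowSpace] at h1
  simpa using h1

/-- A generator disjoint from `Π₁` projects isomorphically onto the left coordinates, so it is the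
graph of a linear map, and isotropy makes the matrix of that map symmetric. -/
theorem exists_rowSpace_eq {U : Submodule F (AmbientSpace F n)} (hU : IsGenerator U)
    (hd : Disjoint U (planeOne F n)) :
    ∃ A : Matrix (Fin n) (Fin n) F, A.IsSymm ∧ rowSpace A = U := by
  obtain ⟨hti, hdim⟩ := isGenerator_iff.1 hU
  let π : U →ₗ[F] (Fin n → F) := (LinearMap.funLeft F F Sum.inl).comp U.subtype
  have hπ : Function.Injective π := by
    rw [← LinearMap.ker_eq_bot, LinearMap.ker_eq_bot']
    intro u hu
    have h1 : (u : AmbientSpace F n) ∈ planeOne F n := mem_planeOne.2 hu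
    exact Subtype.ext ((Submodule.disjoint_def.1 hd) u u.2 h1)
  let e : U ≃ₗ[F] (Fin n → F) := LinearEquiv.ofInjectiveOfFinrankEq π hπ (by simp [hdim])
  have he : ∀ u : U, e u = (u : AmbientSpace F n) ∘ Sum.inl := fun u => rfl
  let f : (Fin n → F) →ₗ[F] (Fin n → F) :=
    ((LinearMap.funLeft F F Sum.inr).comp U.subtype).comp e.symm.toLinearMap
  have hf : ∀ u : U, f ((u : AmbientSpace F n) ∘ Sum.inl) = (u : AmbientSpace F n) ∘ Sum.inr := by
    intro u
    rw [← he]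
    change ((e.symm (e u) : U) : AmbientSpace F n) ∘ Sum.inr = _
    rw [e.symm_apply_apply]
  have hmem : ∀ x, (Sum.elim x (f x) : AmbientSpace F n) ∈ U := by
    intro x
    obtain ⟨u, rfl⟩ := e.surjective x
    rw [he, hf, Sum.elim_comp_inl_inr]
    exact u.2
  have hA : (LinearMap.toMatrix' f).IsSymm := by
    ext i j
    have h := hti _ (hmem (Pi.single i 1)) _ (hmem (Pi.single j 1))
    rw [symplecticForm_elim] at h
    simp only [single_one_dotProduct, dotProduct_single_one] at h
    rw [Matrix.transpose_apply, LinearMap.toMatrix'_apply, LinearMap.toMatrix'_apply]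
    exact (sub_eq_zero.1 h).symm
  refine ⟨LinearMap.toMatrix' f, hA, ?_⟩
  symm
  refine Submodule.eq_of_le_of_finrank_eq (fun u hu => ?_) (by rw [hdim, finrank_rowSpace])
  rw [← Sum.elim_comp_inl_inr u, elim_mem_rowSpace hA, LinearMap.toMatrix'_mulVec]
  exact (hf ⟨u, hu⟩).symm

theorem bijOn_rowSpace :
    Set.BijOn (rowSpace : Matrix (Fin n) (Fin n) F → Submodule F (AmbientSpace F n))
      {A | A.IsSymm} {U | IsGenerator U ∧ Disjoint U (planeOne F n)} :=
  ⟨fun _ hA => ⟨isGenerator_rowSpace hA, disjoint_rowSpace_planeOne _⟩,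
    rowSpace_injective.injOn, fun _ hU => exists_rowSpace_eq hU.1 hU.2⟩

theorem finrank_rowSpace_inf_add_rank (A B : Matrix (Fin n) (Fin n) F) :
    finrank F ↥(rowSpace A ⊓ rowSpace B) + (A - B).rank = n := by
  have h : rowSpace A ⊓ rowSpace B =
      Submodule.map (graphMap A) (LinearMap.ker (A - B).vecMulLinear) := by
    ext v
    simp only [Submodule.mem_inf, mem_rowSpace, Submodule.mem_map, LinearMap.mem_ker,
      Matrix.vecMulLinear_apply, Matrix.vecMul_sub, sub_eq_zero, graphMap_apply]
    constructor
    · rintro ⟨h1, h2⟩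
      exact ⟨v ∘ Sum.inl, h1.symm.trans h2, by rw [← h1, Sum.elim_comp_inl_inr]⟩
    · rintro ⟨x, h1, rfl⟩
      simp [h1]
  have h2 := LinearMap.finrank_range_add_finrank_ker (A - B).vecMulLinear
  rw [h, ← (Submodule.equivMapOfInjective (graphMap A) (graphMap_injective A) _).finrank_eq]
  rw [range_vecMulLinear, ← Matrix.rank_eq_finrank_span_row] at h2
  simp at h2
  lia

/-- A matrix of rank at most one is an outer product, which gives the exchange identity. -/
theorem Matrix.dotProduct_mulVec_exchange {M : Matrix (Fin n) (Fin n) F} (h : M.rank ≤ 1)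
    (x y z w : Fin n → F) :
    (x ⬝ᵥ M *ᵥ y) * (z ⬝ᵥ M *ᵥ w) = (x ⬝ᵥ M *ᵥ w) * (z ⬝ᵥ M *ᵥ y) := by
  obtain ⟨v, hv⟩ := finrank_le_one_iff.1 h
  obtain ⟨a, ha⟩ := hv ⟨M *ᵥ y, ⟨y, rfl⟩⟩
  obtain ⟨b, hb⟩ := hv ⟨M *ᵥ w, ⟨w, rfl⟩⟩
  have ha' : M *ᵥ y = a • (v : Fin n → F) := (congrArg Subtype.val ha).symm
  have hb' : M *ᵥ w = b • (v : Fin n → F) := (congrArg Subtype.val hb).symm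
  simp only [ha', hb', dotProduct_smul, smul_eq_mul]
  ring

theorem Matrix.IsSymm.dotProduct_mulVec_comm {A : Matrix (Fin n) (Fin n) F} (hA : A.IsSymm)
    (x y : Fin n → F) : x ⬝ᵥ A *ᵥ y = y ⬝ᵥ A *ᵥ x := by
  rw [Matrix.dotProduct_mulVec, ← Matrix.mulVec_transpose, hA.eq, dotProduct_comm]

end Generators

/-! ### Partitions of the points of a subspace -/

section Partition

variable {F : Type*} [Field F]

variable [Fintype F] {V : Type*} [AddCommGroup V] [Module F V] [Finite V]

theorem ncard_nonzero_of_finrank (U : Submodule F V) :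
    {v : V | v ∈ U ∧ v ≠ 0}.ncard = Fintype.card F ^ finrank F U - 1 := by
  classical
  have := Fintype.ofFinite V
  have h : {v : V | v ∈ U ∧ v ≠ 0} = (U : Set V) \ {0} := by ext; simp
  rw [h, Set.ncard_sdiff_singleton_of_mem U.zero_mem, ← Nat.card_coe_set_eq]
  congr 1
  simpa [Nat.card_eq_fintype_card] using Module.card_eq_pow_finrank (K := F) (V := U)

/-- Subspaces of dimension `k` that partition the nonzero vectors of `S`: double counting. -/
theorem ncard_mul_of_partition {S : Submodule F V} {𝓕 : Set (Submodule F V)} {k : ℕ}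
    (hle : ∀ l ∈ 𝓕, l ≤ S ∧ finrank F l = k)
    (hex : ∀ v ∈ S, v ≠ 0 → ∃! l, l ∈ 𝓕 ∧ v ∈ l) :
    𝓕.ncard * (Fintype.card F ^ k - 1) = Fintype.card F ^ finrank F S - 1 := by
  classical
  have := Fintype.ofFinite V
  have hfin : 𝓕.Finite := Set.toFinite _
  have h := Finset.card_mul_eq_card_mul (s := hfin.toFinset)
    (t := Finset.univ.filter fun v : V => v ∈ S ∧ v ≠ 0) (fun l v => v ∈ l)
    (m := Fintype.card F ^ k - 1) (n := 1) ?_ ?_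
  · rw [Set.ncard_eq_toFinset_card _ hfin, h, mul_one, ← ncard_nonzero_of_finrank S]
    rw [Set.ncard_eq_toFinset_card']
    congr 1
    ext; simp
  · intro l hl
    have hl' := hle l (by simpa using hl)
    rw [← hl'.2, ← ncard_nonzero_of_finrank l, Set.ncard_eq_toFinset_card']
    congr 1
    ext v
    simp only [Finset.bipartiteAbove, Finset.mem_filter, Finset.mem_univ, true_and,
      Set.mem_toFinset, Set.mem_ofPred_eq]
    exact ⟨fun h => ⟨h.2, h.1.2⟩, fun h => ⟨⟨hl'.1 h.1, h.2⟩, h.1⟩⟩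
  · intro v hv
    simp only [Finset.mem_filter, Finset.mem_univ, true_and] at hv
    obtain ⟨l, hl, huniq⟩ := hex v hv.1 hv.2
    rw [Finset.card_eq_one]
    refine ⟨l, ?_⟩
    ext l'
    simp only [Finset.bipartiteBelow, Finset.mem_filter, Set.Finite.mem_toFinset,
      Finset.mem_singleton]
    exact ⟨fun h => huniq l' h, fun h => h ▸ hl⟩

end Partition

section Points

variable {F : Type*} [Field F]

theorem exists_eq_span_of_mem_pointsOf {n : ℕ} {U P : Submodule F (AmbientSpace F n)}
    (h : P ∈ pointsOf U) : ∃ v ∈ U, v ≠ 0 ∧ P = F ∙ v := by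
  have hne : P ≠ ⊥ := by
    rintro rfl
    exact zero_ne_one ((finrank_bot F (AmbientSpace F n)).symm.trans h.1)
  obtain ⟨v, hv, h0⟩ := Submodule.exists_mem_ne_zero_of_ne_bot hne
  refine ⟨v, h.2 hv, h0, (Submodule.eq_of_le_of_finrank_eq
    ((Submodule.span_singleton_le_iff_mem _ _).2 hv) ?_).symm⟩
  rw [h.1, finrank_span_singleton h0]

theorem span_mem_pointsOf {n : ℕ} {U : Submodule F (AmbientSpace F n)} {v : AmbientSpace F n}
    (hv : v ∈ U) (h0 : v ≠ 0) : (F ∙ v) ∈ pointsOf U :=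
  ⟨finrank_span_singleton h0, (Submodule.span_singleton_le_iff_mem _ _).2 hv⟩

theorem ncard_pointsOf_mul [Fintype F] {n : ℕ} (U : Submodule F (AmbientSpace F n)) :
    (pointsOf U).ncard * (Fintype.card F - 1) = Fintype.card F ^ finrank F U - 1 := by
  have h := ncard_mul_of_partition (S := U) (𝓕 := pointsOf U) (k := 1)
    (fun l hl => ⟨hl.2, hl.1⟩) (fun v hv h0 => ?_)
  · simpa using h
  · refine ⟨F ∙ v, ⟨span_mem_pointsOf hv h0, Submodule.mem_span_singleton_self v⟩, ?_⟩
    rintro P ⟨hP, hvP⟩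
    symm
    refine Submodule.eq_of_le_of_finrank_eq ((Submodule.span_singleton_le_iff_mem _ _).2 hvP) ?_
    rw [hP.1, finrank_span_singleton h0]

theorem IsLineSpread.existsUnique {S : Submodule F (AmbientSpace F 3)}
    {𝓕 : Set (Submodule F (AmbientSpace F 3))} (h : IsLineSpread S 𝓕) {v : AmbientSpace F 3}
    (hv : v ∈ S) (h0 : v ≠ 0) : ∃! l, l ∈ 𝓕 ∧ v ∈ l := by
  simpa [Submodule.span_singleton_le_iff_mem] using h.2 _ (span_mem_pointsOf hv h0)

theorem IsLineSpread.eq_of_mem {S : Submodule F (AmbientSpace F 3)}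
    {𝓕 : Set (Submodule F (AmbientSpace F 3))} (h : IsLineSpread S 𝓕) {v : AmbientSpace F 3}
    (h0 : v ≠ 0) {l l' : Submodule F (AmbientSpace F 3)} (hl : l ∈ 𝓕) (hl' : l' ∈ 𝓕)
    (hv : v ∈ l) (hv' : v ∈ l') : l = l' :=
  (h.existsUnique ((h.1 l hl).1 hv) h0).unique ⟨hl, hv⟩ ⟨hl', hv'⟩

theorem IsLineSpread.ncard [Fintype F] {S : Submodule F (AmbientSpace F 3)}
    {𝓕 : Set (Submodule F (AmbientSpace F 3))} (h : IsLineSpread S 𝓕) (hS : finrank F S = 4) :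
    𝓕.ncard = Fintype.card F ^ 2 + 1 := by
  have h1 := ncard_mul_of_partition (k := 2) (fun l hl => ⟨(h.1 l hl).1, (h.1 l hl).2.1⟩)
    (fun v hv h0 => h.existsUnique hv h0)
  rw [hS] at h1
  have hq : 1 < Fintype.card F := Fintype.one_lt_card
  have hq2 : 1 < Fintype.card F ^ 2 := Nat.one_lt_pow two_ne_zero hq
  have h3 : Fintype.card F ^ 4 - 1 = (Fintype.card F ^ 2 + 1) * (Fintype.card F ^ 2 - 1) := by
    zify [hq2.le, Nat.one_le_pow 4 _ (zero_lt_one.trans hq)]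
    ring
  exact Nat.eq_of_mul_eq_mul_right (by lia) (h1.trans h3)

end Points

/-! ### The generators through a point of `Π₂` -/

section LocalGeometry

variable {F : Type*} [Field F]

/-- The point `⟨(p, 0)⟩` of `Π₂`. -/
def leftPoint (p : Fin 3 → F) : Submodule F (AmbientSpace F 3) :=
  F ∙ (Sum.elim p 0 : AmbientSpace F 3)

theorem elim_ne_zero_left {p : Fin 3 → F} (hp : p ≠ 0) (y : Fin 3 → F) :
    (Sum.elim p y : AmbientSpace F 3) ≠ 0 := by
  intro h
  apply hp
  simpa using congrArg (· ∘ Sum.inl) h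

theorem mem_leftPoint_self (p : Fin 3 → F) :
    (Sum.elim p 0 : AmbientSpace F 3) ∈ leftPoint p :=
  Submodule.mem_span_singleton_self _

theorem leftPoint_le_iff {p : Fin 3 → F} {U : Submodule F (AmbientSpace F 3)} :
    leftPoint p ≤ U ↔ (Sum.elim p 0 : AmbientSpace F 3) ∈ U :=
  Submodule.span_singleton_le_iff_mem _ _

theorem finrank_leftPoint {p : Fin 3 → F} (hp : p ≠ 0) : finrank F (leftPoint p) = 1 :=
  finrank_span_singleton (elim_ne_zero_left hp 0)

theorem mem_pointsOf_planeTwo {P : Submodule F (AmbientSpace F 3)} :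
    P ∈ pointsOf (planeTwo F 3) ↔ ∃ p : Fin 3 → F, p ≠ 0 ∧ P = leftPoint p := by
  constructor
  · intro h
    obtain ⟨v, hv, h0, rfl⟩ := exists_eq_span_of_mem_pointsOf h
    rw [← Sum.elim_comp_inl_inr v, elim_mem_planeTwo] at hv
    refine ⟨v ∘ Sum.inl, fun h1 => h0 ?_, ?_⟩
    · rw [← Sum.elim_comp_inl_inr v, hv, h1]
      ext (i | i) <;> rfl
    · rw [leftPoint, ← hv, Sum.elim_comp_inl_inr]
  · rintro ⟨p, hp, rfl⟩
    exact span_mem_pointsOf (elim_mem_planeTwo.2 rfl) (elim_ne_zero_left hp 0)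

theorem mem_perp_leftPoint {p : Fin 3 → F} {v : AmbientSpace F 3} :
    v ∈ perp (leftPoint p) ↔ p ⬝ᵥ (v ∘ Sum.inr) = 0 := by
  rw [mem_perp]
  constructor
  · intro h
    simpa [symplecticForm_apply] using h _ (mem_leftPoint_self p)
  · intro h u hu
    obtain ⟨c, rfl⟩ := Submodule.mem_span_singleton.1 hu
    rw [map_smul, LinearMap.smul_apply, symplecticForm_apply]
    simp [h]

theorem finrank_perp_leftPoint {p : Fin 3 → F} (hp : p ≠ 0) :
    finrank F (perp (leftPoint p)) = 5 := by
  have h := finrank_add_finrank_perp (leftPoint p)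
  rw [finrank_leftPoint hp] at h
  lia

theorem IsTotallyIsotropic.le_perp_of_le {n : ℕ} {U P : Submodule F (AmbientSpace F n)}
    (h : IsTotallyIsotropic U) (hP : P ≤ U) : U ≤ perp P :=
  fun v hv => mem_perp.2 fun u hu => h u (hP hu) v hv

variable {p : Fin 3 → F} {S : Submodule F (AmbientSpace F 3)}
  {𝓕 : Set (Submodule F (AmbientSpace F 3))}

/-- `S` is a hyperplane of `P^⊥`. -/
theorem IsLocalChoice.finrank_le (hp : p ≠ 0) (h : IsLocalChoice (leftPoint p) S 𝓕)
    {X : Submodule F (AmbientSpace F 3)} (hX : X ≤ perp (leftPoint p)) :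
    finrank F X ≤ finrank F ↥(S ⊓ X) + 1 := by
  have h1 := Submodule.finrank_sup_add_finrank_inf_eq S X
  have h2 : finrank F ↥(S ⊔ X) ≤ 5 := by
    rw [← finrank_perp_leftPoint hp]
    exact Submodule.finrank_mono (sup_le h.2.1 hX)
  rw [h.1] at h1
  lia

theorem IsLocalChoice.exists_ne_zero (hp : p ≠ 0) (h : IsLocalChoice (leftPoint p) S 𝓕)
    {X : Submodule F (AmbientSpace F 3)} (hX : X ≤ perp (leftPoint p)) (h2 : 2 ≤ finrank F X) :
    ∃ v ∈ S ⊓ X, v ≠ 0 := by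
  have h3 := h.finrank_le hp hX
  refine Submodule.exists_mem_ne_zero_of_ne_bot fun hb => ?_
  rw [hb, finrank_bot] at h3
  lia

variable {U U' : Submodule F (AmbientSpace F 3)}

theorem inf_mem_of_mem_generatorsThrough (hU : U ∈ generatorsThrough (leftPoint p) S 𝓕) :
    S ⊓ U ∈ 𝓕 ∧ S ⊓ U ≠ S ⊓ planeOne F 3 ∧ S ⊓ U ≠ S ⊓ planeTwo F 3 := by
  have := hU.2.2
  simpa [not_or] using this

theorem sup_inf_eq_of_mem_generatorsThrough (hp : p ≠ 0) (h : IsLocalChoice (leftPoint p) S 𝓕)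
    (hU : U ∈ generatorsThrough (leftPoint p) S 𝓕) : leftPoint p ⊔ (S ⊓ U) = U := by
  refine Submodule.eq_of_le_of_finrank_le (sup_le hU.2.1 inf_le_right) ?_
  have h1 := Submodule.finrank_sup_add_finrank_inf_eq (leftPoint p) (S ⊓ U)
  have h2 : leftPoint p ⊓ (S ⊓ U) = ⊥ := by
    rw [eq_bot_iff]
    rintro v ⟨hv, hvS, -⟩
    by_contra h0
    refine h.2.2.1 ?_
    obtain ⟨c, rfl⟩ := Submodule.mem_span_singleton.1 hv
    have hc : c ≠ 0 := by rintro rfl; simp at h0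
    exact leftPoint_le_iff.2 ((Submodule.smul_mem_iff _ hc).1 hvS)
  rw [h2, finrank_bot, finrank_leftPoint hp,
    (h.2.2.2.2.1.1 _ (inf_mem_of_mem_generatorsThrough hU).1).2.1] at h1
  rw [(isGenerator_iff.1 hU.1).2]
  lia

theorem disjoint_planeOne_of_mem_generatorsThrough (h : IsLocalChoice (leftPoint p) S 𝓕)
    (hU : U ∈ generatorsThrough (leftPoint p) S 𝓕) : Disjoint U (planeOne F 3) := by
  rw [Submodule.disjoint_def]
  intro v hv hv1
  by_contra h0
  obtain ⟨h2, h3, -⟩ := inf_mem_of_mem_generatorsThrough hU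
  have hvS : v ∈ S := h.2.2.2.1 ⟨hU.1.1.le_perp_of_le hU.2.1 hv, hv1⟩
  exact h3 (h.2.2.2.2.1.eq_of_mem h0 h2 h.2.2.2.2.2.1 ⟨hvS, hv⟩ ⟨hvS, hv1⟩)

theorem inf_planeTwo_of_mem_generatorsThrough (hp : p ≠ 0)
    (h : IsLocalChoice (leftPoint p) S 𝓕) (hU : U ∈ generatorsThrough (leftPoint p) S 𝓕) :
    U ⊓ planeTwo F 3 = leftPoint p := by
  have hle : leftPoint p ≤ U ⊓ planeTwo F 3 := le_inf hU.2.1 (leftPoint_le_iff.2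
    (elim_mem_planeTwo.2 rfl))
  symm
  refine Submodule.eq_of_le_of_finrank_le hle ?_
  rw [finrank_leftPoint hp]
  by_contra! h2
  obtain ⟨v, ⟨hvS, hvU, hv2⟩, h0⟩ := h.exists_ne_zero hp
    (inf_le_left.trans (hU.1.1.le_perp_of_le hU.2.1)) h2
  obtain ⟨h3, -, h4⟩ := inf_mem_of_mem_generatorsThrough hU
  exact h4 (h.2.2.2.2.1.eq_of_mem h0 h3 h.2.2.2.2.2.2 ⟨hvS, hvU⟩ ⟨hvS, hv2⟩)

/-- In matrix terms, the generators through `P = ⟨(p, 0)⟩` are `L(A)` with `ker A = ⟨p⟩`. -/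
theorem exists_matrix_of_mem_generatorsThrough (hp : p ≠ 0)
    (h : IsLocalChoice (leftPoint p) S 𝓕) (hU : U ∈ generatorsThrough (leftPoint p) S 𝓕) :
    ∃ A : Matrix (Fin 3) (Fin 3) F, A.IsSymm ∧ rowSpace A = U ∧ A *ᵥ p = 0 ∧
      ∀ x, A *ᵥ x = 0 → x ∈ F ∙ p := by
  obtain ⟨A, hA, rfl⟩ :=
    exists_rowSpace_eq hU.1 (disjoint_planeOne_of_mem_generatorsThrough h hU)
  refine ⟨A, hA, rfl, ?_, fun x hx => ?_⟩
  · exact ((elim_mem_rowSpace hA).1 (leftPoint_le_iff.1 hU.2.1)).symm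
  · have h1 : (Sum.elim x 0 : AmbientSpace F 3) ∈ leftPoint p := by
      rw [← inf_planeTwo_of_mem_generatorsThrough hp h hU]
      exact ⟨(elim_mem_rowSpace hA).2 hx.symm, elim_mem_planeTwo.2 rfl⟩
    obtain ⟨c, hc⟩ := Submodule.mem_span_singleton.1 h1
    refine Submodule.mem_span_singleton.2 ⟨c, ?_⟩
    ext i
    simpa using congrFun hc (Sum.inl i)

theorem finrank_inf_le_of_mem_generatorsThrough (hp : p ≠ 0)
    (h : IsLocalChoice (leftPoint p) S 𝓕) (hU : U ∈ generatorsThrough (leftPoint p) S 𝓕)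
    (hU' : U' ∈ generatorsThrough (leftPoint p) S 𝓕) (hne : U ≠ U') :
    finrank F ↥(U ⊓ U') ≤ 1 := by
  by_contra! h2
  obtain ⟨v, ⟨hvS, hvU, hvU'⟩, h0⟩ := h.exists_ne_zero hp
    (inf_le_left.trans (hU.1.1.le_perp_of_le hU.2.1)) h2
  apply hne
  rw [← sup_inf_eq_of_mem_generatorsThrough hp h hU,
    ← sup_inf_eq_of_mem_generatorsThrough hp h hU',
    h.2.2.2.2.1.eq_of_mem h0 (inf_mem_of_mem_generatorsThrough hU).1
      (inf_mem_of_mem_generatorsThrough hU').1 ⟨hvS, hvU⟩ ⟨hvS, hvU'⟩]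

/-- Joining the point `P` to a line of the spread gives a generator that cuts out this line. -/
theorem isGenerator_sup (hp : p ≠ 0) (h : IsLocalChoice (leftPoint p) S 𝓕)
    {l : Submodule F (AmbientSpace F 3)} (hl : l ∈ 𝓕) :
    IsGenerator (leftPoint p ⊔ l) ∧ S ⊓ (leftPoint p ⊔ l) = l := by
  obtain ⟨hlS, hl2, hli⟩ := h.2.2.2.2.1.1 l hl
  have hbot : S ⊓ leftPoint p = ⊥ := by
    rw [eq_bot_iff]
    rintro v ⟨hvS, hv⟩
    by_contra h0
    refine h.2.2.1 ?_
    obtain ⟨c, rfl⟩ := Submodule.mem_span_singleton.1 hv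
    have hc : c ≠ 0 := by rintro rfl; simp at h0
    exact leftPoint_le_iff.2 ((Submodule.smul_mem_iff _ hc).1 hvS)
  have hinf : S ⊓ (leftPoint p ⊔ l) = l := by
    rw [inf_comm, sup_comm, sup_inf_assoc_of_le _ hlS, inf_comm, hbot, sup_bot_eq]
  refine ⟨isGenerator_iff.2 ⟨?_, ?_⟩, hinf⟩
  · have hlp : ∀ u ∈ leftPoint p, ∀ v ∈ l, symplecticForm F 3 u v = 0 :=
      fun u hu v hv => mem_perp.1 (h.2.1 (hlS hv)) u hu
    have hpp : ∀ u ∈ leftPoint p, ∀ v ∈ leftPoint p, symplecticForm F 3 u v = 0 := by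
      intro u hu v hv
      obtain ⟨c, rfl⟩ := Submodule.mem_span_singleton.1 hu
      obtain ⟨d, rfl⟩ := Submodule.mem_span_singleton.1 hv
      simp [symplecticForm_apply]
    intro u hu v hv
    obtain ⟨a, ha, b, hb, rfl⟩ := Submodule.mem_sup.1 hu
    obtain ⟨c, hc, d, hd, rfl⟩ := Submodule.mem_sup.1 hv
    have h1 : symplecticForm F 3 b c = 0 := symplecticForm_isRefl _ _ (hlp c hc b hb)
    simp only [map_add, LinearMap.add_apply, hpp a ha c hc, hlp a ha d hd, h1, hli b hb d hd,
      add_zero]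
  · have h1 := Submodule.finrank_sup_add_finrank_inf_eq (leftPoint p) l
    have h2 : leftPoint p ⊓ l = ⊥ := by
      rw [eq_bot_iff, ← hbot, inf_comm]
      exact inf_le_inf_right _ hlS
    rw [h2, finrank_bot, finrank_leftPoint hp, hl2] at h1
    exact h1

theorem IsLocalChoice.inf_planeOne_ne (h : IsLocalChoice (leftPoint p) S 𝓕) :
    S ⊓ planeOne F 3 ≠ S ⊓ planeTwo F 3 := by
  intro he
  have h2 := (h.2.2.2.2.1.1 _ h.2.2.2.2.2.1).2.1
  have h3 : S ⊓ planeOne F 3 = ⊥ := by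
    rw [eq_bot_iff]
    intro v hv
    have hv2 : v ∈ planeTwo F 3 := (he ▸ hv : v ∈ S ⊓ planeTwo F 3).2
    exact (Submodule.disjoint_def.1 (disjoint_rowSpace_planeOne 0)) v hv2 hv.2
  rw [h3, finrank_bot] at h2
  lia

theorem ncard_generatorsThrough [Fintype F] (hp : p ≠ 0)
    (h : IsLocalChoice (leftPoint p) S 𝓕) :
    (generatorsThrough (leftPoint p) S 𝓕).ncard = Fintype.card F ^ 2 - 1 := by
  have h1 : (𝓕 \ {S ⊓ planeOne F 3, S ⊓ planeTwo F 3}).ncard = Fintype.card F ^ 2 - 1 := by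
    rw [Set.ncard_sdiff (by
      rintro x (rfl | rfl)
      exacts [h.2.2.2.2.2.1, h.2.2.2.2.2.2]), h.2.2.2.2.1.ncard h.1,
      Set.ncard_pair (h.inf_planeOne_ne)]
    rfl
  rw [← h1]
  refine Set.ncard_congr (fun U _ => S ⊓ U) (fun U hU => hU.2.2) ?_ ?_
  · intro U U' hU hU' he
    rw [← sup_inf_eq_of_mem_generatorsThrough hp h hU,
      ← sup_inf_eq_of_mem_generatorsThrough hp h hU', he]
  · intro l hl
    obtain ⟨h2, h3⟩ := isGenerator_sup hp h hl.1
    exact ⟨leftPoint p ⊔ l, ⟨h2, le_sup_left, by rwa [h3]⟩, h3⟩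

end LocalGeometry

/-! ### Sets of binary forms in even characteristic -/

section EvenCharacteristic

variable {F : Type*} [Field F] [Fintype F] [DecidableEq F]

theorem card_filter_line {a b : F} (h : a ≠ 0 ∨ b ≠ 0) (k : F) :
    (Finset.univ.filter fun x : F × F => a * x.1 + b * x.2 = k).card = Fintype.card F := by
  rcases h with h | h
  · refine (Finset.card_nbij' (s := Finset.univ) (fun v : F => ((k - b * v) / a, v))
      (fun x => x.2) ?_ ?_ ?_ ?_).symm
    · intro v _
      simp only [Finset.coe_filter, Finset.mem_univ, true_and, Set.mem_ofPred_eq]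
      field_simp
      ring
    · intro x _; simp
    · intro v _; rfl
    · rintro ⟨u, v⟩ hx
      simp only [Finset.coe_filter, Finset.mem_univ, true_and, Set.mem_ofPred_eq] at hx
      ext
      · simp only
        rw [← hx]
        field_simp
        ring
      · rfl
  · refine (Finset.card_nbij' (s := Finset.univ) (fun u : F => (u, (k - a * u) / b))
      (fun x => x.1) ?_ ?_ ?_ ?_).symm
    · intro v _
      simp only [Finset.coe_filter, Finset.mem_univ, true_and, Set.mem_ofPred_eq]
      field_simp
      ring
    · intro x _; simp
    · intro v _; rfl
    · rintro ⟨u, v⟩ hx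
      simp only [Finset.coe_filter, Finset.mem_univ, true_and, Set.mem_ofPred_eq] at hx
      ext
      · rfl
      · simp only
        rw [← hx]
        field_simp
        ring

/-- A set of `q²` points of `AG(3, q)` with no two joined by a line whose point at infinity is on
the conic `ac = b²` has exactly `q` points in the plane `t²a - s²c = k`, which meets the conic. -/
theorem card_filter_tangent_plane {T : Finset (F × F × F)} (hT : T.card = Fintype.card F ^ 2)
    (hd : ∀ x ∈ T, ∀ y ∈ T, x ≠ y → (x.1 - y.1) * (x.2.2 - y.2.2) ≠ (x.2.1 - y.2.1) ^ 2)
    {s t : F} (h : t ≠ 0 ∨ s ≠ 0) (k : F) :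
    (T.filter fun x => t ^ 2 * x.1 - s ^ 2 * x.2.2 = k).card = Fintype.card F := by
  -- Projection along the direction `(s², st, t²)` of the conic.
  let ψ : F × F × F → F × F := fun x => (t * x.1 - s * x.2.1, t * x.2.1 - s * x.2.2)
  have hinj : Set.InjOn ψ T := by
    intro x hx y hy hxy
    by_contra hne
    refine hd x hx y hy hne ?_
    have h1 : t * x.1 - s * x.2.1 = t * y.1 - s * y.2.1 := congrArg Prod.fst hxy
    have h2 : t * x.2.1 - s * x.2.2 = t * y.2.1 - s * y.2.2 := congrArg Prod.snd hxy
    have ht : t ^ 2 * ((x.1 - y.1) * (x.2.2 - y.2.2) - (x.2.1 - y.2.1) ^ 2) = 0 := by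
      linear_combination t * (x.2.2 - y.2.2) * h1 - t * (x.2.1 - y.2.1) * h2
    have hs : s ^ 2 * ((x.1 - y.1) * (x.2.2 - y.2.2) - (x.2.1 - y.2.1) ^ 2) = 0 := by
      linear_combination s * (x.2.1 - y.2.1) * h1 - s * (x.1 - y.1) * h2
    rcases h with h | h
    · exact sub_eq_zero.1 ((mul_eq_zero.1 ht).resolve_left (pow_ne_zero 2 h))
    · exact sub_eq_zero.1 ((mul_eq_zero.1 hs).resolve_left (pow_ne_zero 2 h))
  have himg : T.image ψ = Finset.univ := by
    rw [← Finset.card_eq_iff_eq_univ, Finset.card_image_of_injOn hinj, hT, Fintype.card_prod, sq]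
  rw [← card_filter_line h k, ← himg, Finset.filter_image,
    Finset.card_image_of_injOn (hinj.mono (Finset.coe_subset.2 (Finset.filter_subset _ _)))]
  congr 1
  refine Finset.filter_congr fun x _ => ?_
  simp only [ψ]
  constructor <;> intro h' <;> rw [← h'] <;> ring

/-- For `q` even the tangents of a conic all pass through its nucleus, so counting in all the
tangent planes through a point shows that a line through the nucleus meets `T` at most once. -/
theorem eq_of_same_diagonal {T : Finset (F × F × F)} (hT : T.card = Fintype.card F ^ 2)
    (hd : ∀ x ∈ T, ∀ y ∈ T, x ≠ y → (x.1 - y.1) * (x.2.2 - y.2.2) ≠ (x.2.1 - y.2.1) ^ 2)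
    (h2 : CharP F 2) {x y : F × F × F} (hx : x ∈ T) (hy : y ∈ T) (h1 : y.1 = x.1)
    (h3 : y.2.2 = x.2.2) : y = x := by
  set q := Fintype.card F with hq
  have hq1 : 1 < q := Fintype.one_lt_card
  let Z : Finset (F × F) := Finset.univ.erase (0, 0)
  have hZ : Z.card = q ^ 2 - 1 := by
    rw [Finset.card_erase_of_mem (Finset.mem_univ _), Finset.card_univ, Fintype.card_prod, sq]
  let r : F × F → F × F × F → Prop := fun u z => u.1 ^ 2 * (z.1 - x.1) = u.2 ^ 2 * (z.2.2 - x.2.2)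
  have key := Finset.sum_card_bipartiteAbove_eq_sum_card_bipartiteBelow (s := Z) (t := T) r
  have hL : ∑ u ∈ Z, (T.bipartiteAbove r u).card = (q ^ 2 - 1) * q := by
    rw [Finset.sum_const_nat (m := q), hZ]
    rintro ⟨t, s⟩ hu
    have hts : t ≠ 0 ∨ s ≠ 0 := by
      by_contra! h
      simp [Z, h.1, h.2] at hu
    refine Eq.trans ?_ (card_filter_tangent_plane hT hd hts (t ^ 2 * x.1 - s ^ 2 * x.2.2))
    congr 1
    refine Finset.filter_congr fun z _ => ?_
    simp only [r]
    constructor <;> intro h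
    · linear_combination h
    · linear_combination h
  let W := T.filter fun z => z.1 = x.1 ∧ z.2.2 = x.2.2
  have hR1 : ∀ z ∈ T, z ∈ W → (Z.bipartiteBelow r z).card = q ^ 2 - 1 := by
    intro z _ hz
    rw [← hZ]
    congr 1
    refine Finset.filter_true_of_mem fun u _ => ?_
    have := (Finset.mem_filter.1 hz).2
    simp [r, this.1, this.2]
  have hR2 : ∀ z ∈ T, z ∉ W → (Z.bipartiteBelow r z).card = q - 1 := by
    intro z hz hzW
    have := h2
    obtain ⟨α, hα⟩ := FiniteField.isSquare_of_char_two (ringChar.eq F 2) (z.1 - x.1)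
    obtain ⟨γ, hγ⟩ := FiniteField.isSquare_of_char_two (ringChar.eq F 2) (z.2.2 - x.2.2)
    have hne : α ≠ 0 ∨ -γ ≠ 0 := by
      by_contra! h
      refine hzW (Finset.mem_filter.2 ⟨hz, sub_eq_zero.1 ?_, sub_eq_zero.1 ?_⟩)
      · rw [hα, h.1, zero_mul]
      · rw [hγ, neg_eq_zero.1 h.2, zero_mul]
    have : Z.bipartiteBelow r z =
        (Finset.univ.filter fun u : F × F => α * u.1 + -γ * u.2 = 0).erase (0, 0) := by
      ext u
      simp only [Finset.bipartiteBelow, Z, Finset.mem_filter, Finset.mem_erase, Finset.mem_univ,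
        and_true, true_and, r, and_congr_right_iff]
      intro _
      rw [hα, hγ]
      constructor
      · intro h
        have h' : (α * u.1 + -γ * u.2) ^ 2 = 0 := by
          rw [CharTwo.add_sq]
          have h4 : (2 : F) = 0 := CharTwo.two_eq_zero
          linear_combination h + γ ^ 2 * u.2 ^ 2 * h4
        exact pow_eq_zero_iff two_ne_zero |>.1 h'
      · intro h
        linear_combination (α * u.1 + γ * u.2) * h
    rw [this, Finset.card_erase_of_mem (by simp), card_filter_line hne]
  have hR : ∑ z ∈ T, (Z.bipartiteBelow r z).card
      = W.card * (q ^ 2 - 1) + (T.card - W.card) * (q - 1) := by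
    have hWT : W ⊆ T := Finset.filter_subset _ _
    rw [← Finset.sum_sdiff hWT, add_comm,
      Finset.sum_const_nat (m := q ^ 2 - 1) fun z hz => hR1 z (hWT hz) hz,
      Finset.sum_const_nat (m := q - 1) fun z hz => hR2 z (Finset.mem_sdiff.1 hz).1
        (Finset.mem_sdiff.1 hz).2, Finset.card_sdiff_of_subset hWT]
  have hW : W.card = 1 := by
    rw [hL, hR, hT] at key
    have hWle : W.card ≤ q ^ 2 := hT ▸ Finset.card_le_card (Finset.filter_subset _ _)
    zify [hWle, Nat.one_le_pow 2 q (by lia), hq1.le] at key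
    have h5 : ((q : ℤ) ^ 2 - q) * (W.card - 1) = 0 := by linear_combination -key
    have h6 : (q : ℤ) ^ 2 - q ≠ 0 := by
      have : (1 : ℤ) < q := by exact_mod_cast hq1
      nlinarith
    have := (mul_eq_zero.1 h5).resolve_left h6
    lia
  exact Finset.card_le_one.1 hW.le _ (Finset.mem_filter.2 ⟨hy, h1, h3⟩) _
    (Finset.mem_filter.2 ⟨hx, rfl, rfl⟩)

end EvenCharacteristic

/-! ### The symmetric matrices of a local line-spread -/

section Frames

variable {F : Type*} [Field F]

theorem linearIndependent_triple_iff {V : Type*} [AddCommGroup V] [Module F V] {e f p : V} :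
    LinearIndependent F ![e, f, p] ↔
      ∀ a b c : F, a • e + b • f + c • p = 0 → a = 0 ∧ b = 0 ∧ c = 0 := by
  rw [Fintype.linearIndependent_iff]
  constructor
  · intro h a b c habc
    have := h ![a, b, c] (by simpa [Fin.sum_univ_three] using habc)
    exact ⟨this 0, this 1, this 2⟩
  · intro h g hg
    obtain ⟨h0, h1, h2⟩ := h (g 0) (g 1) (g 2) (by simpa [Fin.sum_univ_three] using hg)
    intro i
    fin_cases i <;> assumption

theorem exists_frame {p : Fin 3 → F} (hp : p ≠ 0) :
    ∃ e f : Fin 3 → F, LinearIndependent F ![e, f, p] := by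
  have h1 : LinearIndependent F ![p] := by simpa using hp
  obtain ⟨f, hf⟩ := exists_linearIndependent_cons_of_lt_finrank h1 (by simp)
  obtain ⟨e, he⟩ := exists_linearIndependent_cons_of_lt_finrank hf (by simp)
  exact ⟨e, f, he⟩

theorem exists_coords_of_frame {e f p : Fin 3 → F} (h : LinearIndependent F ![e, f, p])
    (x : Fin 3 → F) : ∃ a b c : F, x = a • e + b • f + c • p := by
  have h1 := h.span_eq_top_of_card_eq_finrank' (by simp)
  have h2 : x ∈ Submodule.span F (Set.range ![e, f, p]) := h1 ▸ Submodule.mem_top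
  obtain ⟨c, hc⟩ := (Submodule.mem_span_range_iff_exists_fun F).1 h2
  exact ⟨c 0, c 1, c 2, by rw [← hc]; simp [Fin.sum_univ_three]⟩

/-- A vector orthogonal to a frame vanishes. -/
theorem eq_zero_of_frame {e f p : Fin 3 → F} (h : LinearIndependent F ![e, f, p])
    {y : Fin 3 → F} (he : e ⬝ᵥ y = 0) (hf : f ⬝ᵥ y = 0) (hp : p ⬝ᵥ y = 0) : y = 0 := by
  refine dotProduct_eq_zero _ fun x => ?_
  obtain ⟨a, b, c, rfl⟩ := exists_coords_of_frame h x
  rw [dotProduct_comm]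
  simp [he, hf, hp]

theorem notMem_span_of_frame {e f p : Fin 3 → F} (h : LinearIndependent F ![e, f, p])
    {a b : F} (hab : a ≠ 0 ∨ b ≠ 0) : a • e + b • f ∉ F ∙ p := by
  intro hm
  obtain ⟨c, hc⟩ := Submodule.mem_span_singleton.1 hm
  obtain ⟨ha, hb, -⟩ := linearIndependent_triple_iff.1 h a b (-c) (by rw [← hc]; simp)
  exact hab.elim (· ha) (· hb)

end Frames

section SpreadMatrices

variable {F : Type*} [Field F] {p : Fin 3 → F} {S : Submodule F (AmbientSpace F 3)}
  {𝓕 : Set (Submodule F (AmbientSpace F 3))}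

/-- The symmetric matrices `B` with `Bp = 0` for which `L(B)` meets `S` in a line of `𝓕`. -/
def spreadMatrices (p : Fin 3 → F) (S : Submodule F (AmbientSpace F 3))
    (𝓕 : Set (Submodule F (AmbientSpace F 3))) : Set (Matrix (Fin 3) (Fin 3) F) :=
  {B | B.IsSymm ∧ B *ᵥ p = 0 ∧ S ⊓ rowSpace B ∈ 𝓕}

theorem leftPoint_le_rowSpace_iff {B : Matrix (Fin 3) (Fin 3) F} (hB : B.IsSymm) :
    leftPoint p ≤ rowSpace B ↔ B *ᵥ p = 0 := by
  rw [leftPoint_le_iff, elim_mem_rowSpace hB, eq_comm]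

theorem planeTwo_notMem_generatorsThrough :
    planeTwo F 3 ∉ generatorsThrough (leftPoint p) S 𝓕 :=
  fun h => (inf_mem_of_mem_generatorsThrough h).2.2 rfl

theorem image_spreadMatrices (hp : p ≠ 0) (h : IsLocalChoice (leftPoint p) S 𝓕) :
    rowSpace '' spreadMatrices p S 𝓕 =
      insert (planeTwo F 3) (generatorsThrough (leftPoint p) S 𝓕) := by
  ext U
  constructor
  · rintro ⟨B, ⟨hB, hBp, hl⟩, rfl⟩
    by_cases h0 : rowSpace B = planeTwo F 3
    · exact Or.inl h0
    refine Or.inr ⟨isGenerator_rowSpace hB, (leftPoint_le_rowSpace_iff hB).2 hBp, hl, ?_⟩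
    rintro (h1 | h1)
    · have h2 := (h.2.2.2.2.1.1 _ hl).2.1
      have h3 : S ⊓ rowSpace B = ⊥ := by
        rw [eq_bot_iff]
        intro v hv
        have hv2 : v ∈ planeOne F 3 := (h1 ▸ hv : v ∈ S ⊓ planeOne F 3).2
        exact (Submodule.disjoint_def.1 (disjoint_rowSpace_planeOne B)) v hv.2 hv2
      rw [h3, finrank_bot] at h2
      lia
    · have h1 : S ⊓ rowSpace B = S ⊓ planeTwo F 3 := h1
      have h2 := (isGenerator_iff.1 (isGenerator_sup hp h hl).1).2
      have h3 : leftPoint p ⊔ (S ⊓ rowSpace B) = rowSpace B :=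
        Submodule.eq_of_le_of_finrank_eq
          (sup_le ((leftPoint_le_rowSpace_iff hB).2 hBp) inf_le_right)
          (by rw [h2, finrank_rowSpace])
      have h4 : leftPoint p ⊔ (S ⊓ rowSpace B) = planeTwo F 3 :=
        Submodule.eq_of_le_of_finrank_eq
          (sup_le (leftPoint_le_iff.2 (elim_mem_planeTwo.2 rfl)) (h1 ▸ inf_le_right))
          (by rw [h2, planeTwo, finrank_rowSpace])
      exact h0 (h3.symm.trans h4)
  · rintro (rfl | hU)
    · exact ⟨0, ⟨Matrix.isSymm_zero, Matrix.zero_mulVec _, h.2.2.2.2.2.2⟩, rfl⟩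
    · obtain ⟨A, hA, rfl, hAp, -⟩ := exists_matrix_of_mem_generatorsThrough hp h hU
      exact ⟨A, ⟨hA, hAp, (inf_mem_of_mem_generatorsThrough hU).1⟩, rfl⟩

theorem ncard_spreadMatrices [Fintype F] (hp : p ≠ 0) (h : IsLocalChoice (leftPoint p) S 𝓕) :
    (spreadMatrices p S 𝓕).ncard = Fintype.card F ^ 2 := by
  rw [← Set.ncard_image_of_injective _ rowSpace_injective, image_spreadMatrices hp h,
    Set.ncard_insert_of_notMem planeTwo_notMem_generatorsThrough, ncard_generatorsThrough hp h]
  exact Nat.sub_add_cancel (Nat.one_le_pow _ _ Fintype.card_pos)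

theorem rowSpace_inf_of_mem_spreadMatrices (hp : p ≠ 0) (h : IsLocalChoice (leftPoint p) S 𝓕)
    {B B' : Matrix (Fin 3) (Fin 3) F} (hB : B ∈ spreadMatrices p S 𝓕)
    (hB' : B' ∈ spreadMatrices p S 𝓕) (hne : B ≠ B') :
    rowSpace B ⊓ rowSpace B' = leftPoint p := by
  have hne' : rowSpace B ≠ rowSpace B' := fun he => hne (rowSpace_injective he)
  have hle : leftPoint p ≤ rowSpace B ⊓ rowSpace B' :=
    le_inf ((leftPoint_le_rowSpace_iff hB.1).2 hB.2.1)
      ((leftPoint_le_rowSpace_iff hB'.1).2 hB'.2.1)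
  have h1 : rowSpace B ∈ insert (planeTwo F 3) (generatorsThrough (leftPoint p) S 𝓕) := by
    rw [← image_spreadMatrices hp h]
    exact ⟨B, hB, rfl⟩
  have h2 : rowSpace B' ∈ insert (planeTwo F 3) (generatorsThrough (leftPoint p) S 𝓕) := by
    rw [← image_spreadMatrices hp h]
    exact ⟨B', hB', rfl⟩
  rcases h1 with h1 | h1 <;> rcases h2 with h2 | h2
  · exact absurd (h1.trans h2.symm) hne'
  · rw [h1, inf_comm, inf_planeTwo_of_mem_generatorsThrough hp h h2]
  · rw [h2, inf_planeTwo_of_mem_generatorsThrough hp h h1]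
  · refine (Submodule.eq_of_le_of_finrank_le hle ?_).symm
    rw [finrank_leftPoint hp]
    exact finrank_inf_le_of_mem_generatorsThrough hp h h1 h2 hne'

theorem mem_span_of_mulVec_eq (hp : p ≠ 0) (h : IsLocalChoice (leftPoint p) S 𝓕)
    {B B' : Matrix (Fin 3) (Fin 3) F} (hB : B ∈ spreadMatrices p S 𝓕)
    (hB' : B' ∈ spreadMatrices p S 𝓕) (hne : B ≠ B') {g : Fin 3 → F} (hg : B *ᵥ g = B' *ᵥ g) :
    g ∈ F ∙ p := by
  have h1 : (Sum.elim g (B *ᵥ g) : AmbientSpace F 3) ∈ leftPoint p := by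
    rw [← rowSpace_inf_of_mem_spreadMatrices hp h hB hB' hne]
    exact ⟨(elim_mem_rowSpace hB.1).2 rfl, (elim_mem_rowSpace hB'.1).2 hg⟩
  obtain ⟨c, hc⟩ := Submodule.mem_span_singleton.1 h1
  refine Submodule.mem_span_singleton.2 ⟨c, ?_⟩
  ext i
  simpa using congrFun hc (Sum.inl i)

/-- For `q` even no generator of a local line-spread comes from an alternating matrix: the `q²`
binary forms of the spread have pairwise nonsingular differences, hence distinct diagonals. -/
theorem not_alternating_of_mem_generatorsThrough [Fintype F] (h2 : CharP F 2) (hp : p ≠ 0)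
    (h : IsLocalChoice (leftPoint p) S 𝓕) {A : Matrix (Fin 3) (Fin 3) F} (hA : A.IsSymm)
    (hU : rowSpace A ∈ generatorsThrough (leftPoint p) S 𝓕) : ¬ ∀ x, x ⬝ᵥ A *ᵥ x = 0 := by
  classical
  intro halt
  obtain ⟨e, f, hefp⟩ := exists_frame hp
  let φ : Matrix (Fin 3) (Fin 3) F → F × F × F :=
    fun B => (e ⬝ᵥ B *ᵥ e, e ⬝ᵥ B *ᵥ f, f ⬝ᵥ B *ᵥ f)
  have hkill : ∀ B ∈ spreadMatrices p S 𝓕, ∀ x, p ⬝ᵥ B *ᵥ x = 0 := fun B hB x => by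
    rw [hB.1.dotProduct_mulVec_comm, hB.2.1, dotProduct_zero]
  have hd : ∀ B ∈ spreadMatrices p S 𝓕, ∀ B' ∈ spreadMatrices p S 𝓕, B ≠ B' →
      ((φ B).1 - (φ B').1) * ((φ B).2.2 - (φ B').2.2) ≠ ((φ B).2.1 - (φ B').2.1) ^ 2 := by
    intro B hB B' hB' hne hdet
    set m₁ := (φ B).1 - (φ B').1 with hm₁
    set m₂ := (φ B).2.1 - (φ B').2.1 with hm₂
    set m₃ := (φ B).2.2 - (φ B').2.2 with hm₃
    have hdet' : m₁ * m₃ = m₂ ^ 2 := hdet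
    obtain ⟨a, b, hab, h1, h3⟩ : ∃ a b : F, (a ≠ 0 ∨ b ≠ 0) ∧ a * m₁ + b * m₂ = 0 ∧
        a * m₂ + b * m₃ = 0 := by
      by_cases hm : m₂ = 0 ∧ m₁ = 0
      · exact ⟨1, 0, Or.inl one_ne_zero, by simp [hm.2], by simp [hm.1]⟩
      · refine ⟨m₂, -m₁, ?_, by ring, by linear_combination -hdet'⟩
        rw [neg_ne_zero]
        exact not_and_or.1 hm
    refine notMem_span_of_frame hefp hab (mem_span_of_mulVec_eq hp h hB hB' hne ?_)
    rw [← sub_eq_zero]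
    have hfe := hB.1.dotProduct_mulVec_comm f e
    have hfe' := hB'.1.dotProduct_mulVec_comm f e
    refine eq_zero_of_frame hefp ?_ ?_ ?_
    · simp only [Matrix.mulVec_add, Matrix.mulVec_smul, dotProduct_sub, dotProduct_add,
        dotProduct_smul, smul_eq_mul]
      linear_combination h1
    · simp only [Matrix.mulVec_add, Matrix.mulVec_smul, dotProduct_sub, dotProduct_add,
        dotProduct_smul, smul_eq_mul, hfe, hfe']
      linear_combination h3
    · rw [dotProduct_sub, hkill B hB, hkill B' hB', sub_zero]
  have hinj : Set.InjOn φ (spreadMatrices p S 𝓕) := by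
    intro B hB B' hB' he
    by_contra hne
    exact hd B hB B' hB' hne (by simp [he])
  have hfin : (spreadMatrices p S 𝓕).Finite := Set.toFinite _
  have hmemT : ∀ B, B ∈ hfin.toFinset ↔ B ∈ spreadMatrices p S 𝓕 := fun B => hfin.mem_toFinset
  have hT : (hfin.toFinset.image φ).card = Fintype.card F ^ 2 := by
    rw [Finset.card_image_of_injOn (by rwa [hfin.coe_toFinset]),
      ← Set.ncard_eq_toFinset_card _ hfin, ncard_spreadMatrices hp h]
  have hAm : A ∈ spreadMatrices p S 𝓕 :=
    ⟨hA, (leftPoint_le_rowSpace_iff hA).1 hU.2.1, (inf_mem_of_mem_generatorsThrough hU).1⟩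
  have h0m : (0 : Matrix (Fin 3) (Fin 3) F) ∈ spreadMatrices p S 𝓕 :=
    ⟨Matrix.isSymm_zero, Matrix.zero_mulVec _, h.2.2.2.2.2.2⟩
  have heq := eq_of_same_diagonal hT (x := φ 0) (y := φ A) ?_ h2
    (Finset.mem_image_of_mem _ ((hmemT 0).2 h0m)) (Finset.mem_image_of_mem _ ((hmemT A).2 hAm))
    (by simp [φ, halt]) (by simp [φ, halt])
  · have hA0 := hinj hAm h0m heq
    rw [hA0] at hU
    exact planeTwo_notMem_generatorsThrough hU
  · intro x hx y hy hne
    obtain ⟨B, hB, rfl⟩ := Finset.mem_image.1 hx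
    obtain ⟨B', hB', rfl⟩ := Finset.mem_image.1 hy
    exact hd B ((hmemT B).1 hB) B' ((hmemT B').1 hB') (fun he => hne (by rw [he]))

end SpreadMatrices

/-! ### The regulus of planes of the Segre variety -/

section Regulus

variable {F : Type*} [Field F] {A₀ : Matrix (Fin 3) (Fin 3) F}

/-- The plane `Π₁` together with the planes `L(cA₀)`, `c ∈ F`. -/
def regulus (A₀ : Matrix (Fin 3) (Fin 3) F) : Set (Submodule F (AmbientSpace F 3)) :=
  insert (planeOne F 3) (Set.range fun c : F => rowSpace (c • A₀))

theorem mulVec_eq_zero_of_disjoint (hA : A₀.IsSymm) (h : Disjoint (rowSpace A₀) (planeTwo F 3))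
    {x : Fin 3 → F} (hx : A₀ *ᵥ x = 0) : x = 0 := by
  have h1 := (Submodule.disjoint_def.1 h) (Sum.elim x 0) ((elim_mem_rowSpace hA).2 hx.symm)
    (elim_mem_planeTwo.2 rfl)
  simpa using congrArg (· ∘ Sum.inl) h1

/-- `A₀` as a linear automorphism. -/
noncomputable def mulVecEquiv (hinj : ∀ x, A₀ *ᵥ x = 0 → x = 0) :
    (Fin 3 → F) ≃ₗ[F] (Fin 3 → F) :=
  LinearEquiv.ofInjectiveEndo A₀.mulVecLin (by
    rw [← LinearMap.ker_eq_bot, LinearMap.ker_eq_bot']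
    exact hinj)

theorem mulVecEquiv_apply (hinj : ∀ x, A₀ *ᵥ x = 0 → x = 0) (x : Fin 3 → F) :
    mulVecEquiv hinj x = A₀ *ᵥ x := rfl

theorem isSegrePlanes_regulus (hA : A₀.IsSymm) (hinj : ∀ x, A₀ *ᵥ x = 0 → x = 0) :
    IsSegrePlanes (regulus A₀) := by
  let e : Matrix (Fin 2) (Fin 3) F ≃ₗ[F] AmbientSpace F 3 :=
    { toFun := fun X => Sum.elim (X 0) (mulVecEquiv hinj (X 1))
      invFun := fun v => Matrix.of ![v ∘ Sum.inl, (mulVecEquiv hinj).symm (v ∘ Sum.inr)]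
      left_inv := fun X => by
        ext i j
        fin_cases i <;> simp
      right_inv := fun v => by
        change Sum.elim (v ∘ Sum.inl) (mulVecEquiv hinj ((mulVecEquiv hinj).symm _)) = v
        rw [LinearEquiv.apply_symm_apply, Sum.elim_comp_inl_inr]
      map_add' := fun X Y => by
        have h0 : (X + Y) 0 = X 0 + Y 0 := rfl
        have h1 : (X + Y) 1 = X 1 + Y 1 := rfl
        rw [h0, h1, map_add]
        ext (i | i) <;> rfl
      map_smul' := fun c X => by
        have h0 : (c • X) 0 = c • X 0 := rfl
        have h1 : (c • X) 1 = c • X 1 := rfl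
        rw [h0, h1, map_smul]
        ext (i | i) <;> rfl }
  have he : ∀ (x : Fin 2 → F) (y : Fin 3 → F),
      e (Matrix.vecMulVec x y) = Sum.elim (x 0 • y) (x 1 • (A₀ *ᵥ y)) := by
    intro x y
    change Sum.elim (x 0 • y) (mulVecEquiv hinj (x 1 • y)) = _
    rw [map_smul, mulVecEquiv_apply]
  have hsm : ∀ c : F, (c • A₀).IsSymm := fun c => hA.smul c
  refine ⟨e, ?_⟩
  ext U
  constructor
  · rintro (rfl | ⟨c, rfl⟩)
    · refine ⟨![0, 1], fun h => one_ne_zero (congrFun h 1), fun v => ?_⟩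
      rw [← Sum.elim_comp_inl_inr v, elim_mem_planeOne]
      simp only [he]
      constructor
      · intro h
        refine ⟨(mulVecEquiv hinj).symm (v ∘ Sum.inr), ?_⟩
        rw [← mulVecEquiv_apply hinj, LinearEquiv.apply_symm_apply, h]
        simp
      · rintro ⟨y, hy⟩
        simpa using (congrArg (· ∘ Sum.inl) hy).symm
    · refine ⟨![1, c], fun h => one_ne_zero (congrFun h 0), fun v => ?_⟩
      rw [← Sum.elim_comp_inl_inr v, elim_mem_rowSpace (hsm c)]
      simp only [he]
      constructor
      · intro h
        refine ⟨v ∘ Sum.inl, ?_⟩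
        simp [h, Matrix.smul_mulVec]
      · rintro ⟨y, hy⟩
        have h1 : y = v ∘ Sum.inl := by simpa using congrArg (· ∘ Sum.inl) hy
        have h2 : c • A₀ *ᵥ y = v ∘ Sum.inr := by simpa using congrArg (· ∘ Sum.inr) hy
        rw [← h1, ← h2, Matrix.smul_mulVec]
  · rintro ⟨x, hx, hU⟩
    by_cases h0 : x 0 = 0
    · have h1 : x 1 ≠ 0 := fun h1 => hx (by ext i; fin_cases i <;> assumption)
      left
      ext v
      rw [hU, ← Sum.elim_comp_inl_inr v, elim_mem_planeOne]
      simp only [he, h0, zero_smul]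
      constructor
      · rintro ⟨y, hy⟩
        simpa using (congrArg (· ∘ Sum.inl) hy).symm
      · intro h
        refine ⟨(x 1)⁻¹ • (mulVecEquiv hinj).symm (v ∘ Sum.inr), ?_⟩
        rw [← mulVecEquiv_apply hinj, map_smul, LinearEquiv.apply_symm_apply, h, smul_smul,
          mul_inv_cancel₀ h1, one_smul]
    · right
      refine ⟨x 1 * (x 0)⁻¹, ?_⟩
      ext v
      rw [hU, ← Sum.elim_comp_inl_inr v]
      simp only [he]
      rw [elim_mem_rowSpace (hsm _)]
      constructor
      · intro h
        refine ⟨(x 0)⁻¹ • (v ∘ Sum.inl), ?_⟩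
        rw [h, smul_smul, mul_inv_cancel₀ h0, one_smul, Matrix.mulVec_smul, smul_smul,
          Matrix.smul_mulVec]
      · rintro ⟨y, hy⟩
        have h1 : x 0 • y = v ∘ Sum.inl := by simpa using congrArg (· ∘ Sum.inl) hy
        have h2 : x 1 • A₀ *ᵥ y = v ∘ Sum.inr := by simpa using congrArg (· ∘ Sum.inr) hy
        rw [← h1, ← h2, Matrix.smul_mulVec, Matrix.mulVec_smul, smul_smul, mul_assoc,
          inv_mul_cancel₀ h0, mul_one]

/-- Three planes of a Segre variety determine the family: writing the parameter of the third as a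
combination of the first two normalizes the Segre map. -/
theorem eq_regulus_of_isSegrePlanes (hA : A₀.IsSymm) (hinj : ∀ x, A₀ *ᵥ x = 0 → x = 0)
    {𝓡 : Set (Submodule F (AmbientSpace F 3))} (h : IsSegrePlanes 𝓡) (h1 : planeOne F 3 ∈ 𝓡)
    (h2 : planeTwo F 3 ∈ 𝓡) (h3 : rowSpace A₀ ∈ 𝓡) : 𝓡 = regulus A₀ := by
  obtain ⟨e, rfl⟩ := h
  obtain ⟨x₁, hx₁, hm₁⟩ := h1
  obtain ⟨x₂, hx₂, hm₂⟩ := h2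
  obtain ⟨x₃, hx₃, hm₃⟩ := h3
  have hsm : ∀ c : F, (c • A₀).IsSymm := fun c => hA.smul c
  have hlin : ∀ (a b : F) (x x' : Fin 2 → F) (y : Fin 3 → F),
      e (Matrix.vecMulVec (a • x + b • x') y) =
        a • e (Matrix.vecMulVec x y) + b • e (Matrix.vecMulVec x' y) := by
    intro a b x x' y
    rw [Matrix.add_vecMulVec, Matrix.smul_vecMulVec, Matrix.smul_vecMulVec, map_add, map_smul,
      map_smul]
  have hone : ∀ y, (e (Matrix.vecMulVec x₁ y)) ∘ Sum.inl = 0 := fun y =>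
    mem_planeOne.1 ((hm₁ _).2 ⟨y, rfl⟩)
  have htwo : ∀ y, (e (Matrix.vecMulVec x₂ y)) ∘ Sum.inr = 0 := fun y => by
    have := (hm₂ _).2 ⟨y, rfl⟩
    rwa [← Sum.elim_comp_inl_inr (e (Matrix.vecMulVec x₂ y)), elim_mem_planeTwo] at this
  have hsurj1 : ∀ z : Fin 3 → F, ∃ y, e (Matrix.vecMulVec x₁ y) = Sum.elim (0 : Fin 3 → F) z :=
    fun z => (hm₁ _).1 (elim_mem_planeOne.2 rfl)
  have hsurj2 : ∀ z : Fin 3 → F, ∃ y, e (Matrix.vecMulVec x₂ y) = Sum.elim z 0 := fun z =>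
    (hm₂ _).1 (elim_mem_planeTwo.2 rfl)
  have hv0 : ∃ z : Fin 3 → F, z ≠ 0 := ⟨1, one_ne_zero⟩
  have hind : LinearIndependent F ![x₁, x₂] := by
    rw [LinearIndependent.pair_iff' hx₁]
    intro a ha
    obtain ⟨z, hz⟩ := hv0
    obtain ⟨y, hy⟩ := hsurj2 z
    rw [← ha, Matrix.smul_vecMulVec, map_smul] at hy
    apply hz
    have h5 := congrArg (· ∘ Sum.inl) hy
    simp only [Sum.elim_comp_inl] at h5
    rw [← h5]
    ext i
    simpa using Or.inr (congrFun (hone y) i)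
  have hspan : ∀ x : Fin 2 → F, ∃ a b : F, x = a • x₁ + b • x₂ := by
    intro x
    have h6 := hind.span_eq_top_of_card_eq_finrank' (by simp)
    have h7 : x ∈ Submodule.span F (Set.range ![x₁, x₂]) := h6 ▸ Submodule.mem_top
    obtain ⟨c, hc⟩ := (Submodule.mem_span_range_iff_exists_fun F).1 h7
    exact ⟨c 0, c 1, by rw [← hc]; simp [Fin.sum_univ_two]⟩
  have hind' := LinearIndependent.pair_iff.1 hind
  -- `e (x₁ ⊗ y) = (0, g₁ y)` and `e (x₂ ⊗ y) = (g₂ y, 0)`.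
  let g₁ : (Fin 3 → F) → (Fin 3 → F) := fun y => e (Matrix.vecMulVec x₁ y) ∘ Sum.inr
  let g₂ : (Fin 3 → F) → (Fin 3 → F) := fun y => e (Matrix.vecMulVec x₂ y) ∘ Sum.inl
  have heab : ∀ (a b : F) y, e (Matrix.vecMulVec (a • x₁ + b • x₂) y) =
      Sum.elim (b • g₂ y) (a • g₁ y) := by
    intro a b y
    rw [hlin, ← Sum.elim_comp_inl_inr (e (Matrix.vecMulVec x₁ y)),
      ← Sum.elim_comp_inl_inr (e (Matrix.vecMulVec x₂ y)), hone, htwo]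
    ext (i | i) <;> simp [g₁, g₂]
  have hg₁ : ∀ z, ∃ y, g₁ y = z := fun z => by
    obtain ⟨y, hy⟩ := hsurj1 z
    exact ⟨y, by simp only [g₁, hy, Sum.elim_comp_inr]⟩
  have hg₂ : ∀ z, ∃ y, g₂ y = z := fun z => by
    obtain ⟨y, hy⟩ := hsurj2 z
    exact ⟨y, by simp only [g₂, hy, Sum.elim_comp_inl]⟩
  obtain ⟨a, b, hab⟩ := hspan x₃
  have hrel : ∀ y, a • g₁ y = A₀ *ᵥ (b • g₂ y) := by
    intro y
    have := (hm₃ _).2 ⟨y, rfl⟩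
    rwa [hab, heab, elim_mem_rowSpace hA] at this
  have hb : b ≠ 0 := by
    rintro rfl
    have ha : a ≠ 0 := by rintro rfl; exact hx₃ (by rw [hab]; simp)
    obtain ⟨z, hz⟩ := hv0
    obtain ⟨y, rfl⟩ := hg₁ z
    exact hz ((smul_eq_zero.1 ((hrel y).trans (by simp))).resolve_left ha)
  have ha : a ≠ 0 := by
    rintro rfl
    obtain ⟨z, hz⟩ := hv0
    obtain ⟨y, rfl⟩ := hg₂ z
    refine hz ((smul_eq_zero.1 (hinj (b • g₂ y) ?_)).resolve_left hb)
    rw [← hrel, zero_smul]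
  have hg : ∀ y, g₁ y = (a⁻¹ * b) • A₀ *ᵥ g₂ y := by
    intro y
    rw [mul_smul, ← Matrix.mulVec_smul, ← hrel, smul_smul, inv_mul_cancel₀ ha, one_smul]
  -- The plane of the parameter `c x₁ + d x₂`, for `d ≠ 0`.
  have hplane : ∀ (c d : F), d ≠ 0 → ∀ v : AmbientSpace F 3,
      v ∈ rowSpace ((c * d⁻¹ * (a⁻¹ * b)) • A₀) ↔
        ∃ y, e (Matrix.vecMulVec (c • x₁ + d • x₂) y) = v := by
    intro c d hd v
    simp only [heab]
    rw [← Sum.elim_comp_inl_inr v, elim_mem_rowSpace (hsm _)]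
    constructor
    · intro hv
      obtain ⟨y, hy⟩ := hg₂ (d⁻¹ • (v ∘ Sum.inl))
      refine ⟨y, ?_⟩
      rw [hv, hg, hy, smul_smul, mul_inv_cancel₀ hd, one_smul, Matrix.mulVec_smul, smul_smul,
        smul_smul, Matrix.smul_mulVec]
      congr 2
      ring
    · rintro ⟨y, hy⟩
      have h5 : d • g₂ y = v ∘ Sum.inl := by simpa using congrArg (· ∘ Sum.inl) hy
      have h6 : c • g₁ y = v ∘ Sum.inr := by simpa using congrArg (· ∘ Sum.inr) hy
      rw [← h5, ← h6, hg, Matrix.smul_mulVec, Matrix.mulVec_smul, smul_smul, smul_smul]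
      congr 1
      field_simp
  ext U
  constructor
  · rintro ⟨x, hx, hU⟩
    obtain ⟨c, d, rfl⟩ := hspan x
    by_cases hd : d = 0
    · left
      subst hd
      have hc : c ≠ 0 := by rintro rfl; exact hx (by simp)
      ext v
      rw [hU]
      simp only [heab]
      simp only [zero_smul]
      rw [← Sum.elim_comp_inl_inr v, elim_mem_planeOne]
      constructor
      · rintro ⟨y, hy⟩
        simpa using (congrArg (· ∘ Sum.inl) hy).symm
      · intro hv
        obtain ⟨y, hy⟩ := hg₁ (c⁻¹ • (v ∘ Sum.inr))
        exact ⟨y, by rw [hy, hv, smul_smul, mul_inv_cancel₀ hc, one_smul]⟩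
    · right
      refine ⟨c * d⁻¹ * (a⁻¹ * b), ?_⟩
      ext v
      rw [hU]
      exact hplane c d hd v
  · rintro (rfl | ⟨c, rfl⟩)
    · exact ⟨x₁, hx₁, hm₁⟩
    · refine ⟨(c * (a⁻¹ * b)⁻¹) • x₁ + (1 : F) • x₂, fun h0 => ?_, fun v => ?_⟩
      · exact one_ne_zero (hind' _ _ h0).2
      · rw [← hplane _ _ one_ne_zero]
        have : c * (a⁻¹ * b)⁻¹ * 1⁻¹ * (a⁻¹ * b) = c := by field_simp
        rw [this]

end Regulus

/-! ### The induced polarity of `Π₂` -/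

section Polarity

variable {F : Type*} [Field F] {A₀ : Matrix (Fin 3) (Fin 3) F} {p : Fin 3 → F}

theorem elim_mem_perp_leftPoint {x y : Fin 3 → F} :
    (Sum.elim x y : AmbientSpace F 3) ∈ perp (leftPoint p) ↔ p ⬝ᵥ y = 0 := by
  rw [mem_perp_leftPoint, Sum.elim_comp_inr]

theorem planeOne_inf_sup (hA : A₀.IsSymm) :
    planeOne F 3 ⊓ (leftPoint p ⊔ rowSpace A₀) = F ∙ (Sum.elim 0 (A₀ *ᵥ p) : AmbientSpace F 3) := by
  ext v
  rw [Submodule.mem_span_singleton]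
  constructor
  · rintro ⟨h1, h2⟩
    obtain ⟨u, hu, w, hw, rfl⟩ := Submodule.mem_sup.1 h2
    obtain ⟨c, rfl⟩ := Submodule.mem_span_singleton.1 hu
    rw [← Sum.elim_comp_inl_inr w, elim_mem_rowSpace hA] at hw
    refine ⟨-c, ?_⟩
    have h3 : w ∘ Sum.inl = -c • p := by
      have h4 : c • p + w ∘ Sum.inl = 0 := by
        have := mem_planeOne.1 h1
        ext i
        simpa using congrFun this i
      rw [neg_smul, eq_neg_iff_add_eq_zero, add_comm, h4]
    rw [← Sum.elim_comp_inl_inr w, hw, h3, Matrix.mulVec_smul]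
    ext (i | i) <;> simp
  · rintro ⟨c, rfl⟩
    refine Submodule.smul_mem _ _ ⟨elim_mem_planeOne.2 rfl, ?_⟩
    have h1 : (Sum.elim 0 (A₀ *ᵥ p) : AmbientSpace F 3) =
        -Sum.elim p 0 + Sum.elim p (A₀ *ᵥ p) := by
      ext (i | i) <;> simp
    rw [h1]
    exact Submodule.add_mem_sup (Submodule.neg_mem _ (mem_leftPoint_self p))
      ((elim_mem_rowSpace hA).2 rfl)

theorem elim_mem_polarLine (hA : A₀.IsSymm) {x y : Fin 3 → F} :
    (Sum.elim x y : AmbientSpace F 3) ∈ polarLine (rowSpace A₀) (leftPoint p) ↔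
      y = 0 ∧ x ⬝ᵥ A₀ *ᵥ p = 0 := by
  rw [polarLine, transversal, planeOne_inf_sup hA, Submodule.mem_inf, elim_mem_planeTwo,
    and_congr_right_iff]
  rintro rfl
  rw [mem_perp]
  constructor
  · intro h
    have := h _ (Submodule.mem_sup_right (Submodule.mem_span_singleton_self _))
    rw [symplecticForm_elim] at this
    simpa [dotProduct_comm] using this
  · intro h u hu
    obtain ⟨a, ha, b, hb, rfl⟩ := Submodule.mem_sup.1 hu
    obtain ⟨c, rfl⟩ := Submodule.mem_span_singleton.1 ha
    obtain ⟨d, rfl⟩ := Submodule.mem_span_singleton.1 hb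
    rw [map_add, LinearMap.add_apply, map_smul, map_smul, LinearMap.smul_apply,
      LinearMap.smul_apply, symplecticForm_elim, symplecticForm_elim,
        dotProduct_comm (A₀ *ᵥ p) x, h]
    simp

theorem leftPoint_mem_absolutePoints (hA : A₀.IsSymm) (hp : p ≠ 0) :
    leftPoint p ∈ absolutePoints (rowSpace A₀) ↔ p ⬝ᵥ A₀ *ᵥ p = 0 := by
  have h1 : leftPoint p ∈ pointsOf (planeTwo F 3) := mem_pointsOf_planeTwo.2 ⟨p, hp, rfl⟩
  rw [absolutePoints, Set.mem_ofPred_eq, leftPoint_le_iff, elim_mem_polarLine hA]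
  simp [h1]

theorem mem_localSpace (hA : A₀.IsSymm) {x y : Fin 3 → F} :
    (Sum.elim x y : AmbientSpace F 3) ∈
        (perp (leftPoint p) ⊓ planeOne F 3) ⊔ polarLine (rowSpace A₀) (leftPoint p) ↔
      x ⬝ᵥ A₀ *ᵥ p = 0 ∧ p ⬝ᵥ y = 0 := by
  constructor
  · intro h
    obtain ⟨u, hu, w, hw, h1⟩ := Submodule.mem_sup.1 h
    rw [← Sum.elim_comp_inl_inr w, elim_mem_polarLine hA] at hw
    rw [← Sum.elim_comp_inl_inr u, Submodule.mem_inf, elim_mem_perp_leftPoint,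
      elim_mem_planeOne] at hu
    have hx : u ∘ Sum.inl + w ∘ Sum.inl = x :=
      (congrArg (· ∘ Sum.inl) h1).trans (Sum.elim_comp_inl _ _)
    have hy : u ∘ Sum.inr + w ∘ Sum.inr = y :=
      (congrArg (· ∘ Sum.inr) h1).trans (Sum.elim_comp_inr _ _)
    rw [← hx, ← hy, hu.2, hw.1, zero_add, add_zero]
    exact ⟨hw.2, hu.1⟩
  · rintro ⟨hx, hy⟩
    have h1 : (Sum.elim x y : AmbientSpace F 3) =
        Sum.elim (0 : Fin 3 → F) y + Sum.elim x (0 : Fin 3 → F) := by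
      ext (i | i) <;> simp
    rw [h1]
    exact Submodule.add_mem_sup ⟨elim_mem_perp_leftPoint.2 hy, elim_mem_planeOne.2 rfl⟩
      ((elim_mem_polarLine hA).2 ⟨rfl, hx⟩)

end Polarity

/-! ### Distances between the planes -/

section Distances

variable {F : Type*} [Field F] {A B : Matrix (Fin 3) (Fin 3) F} {p p' : Fin 3 → F}

theorem mulVec_eq_zero_of_isotropic {M : Matrix (Fin 3) (Fin 3) F} (hM : M.IsSymm)
    (hr : M.rank ≤ 1) (h : p ⬝ᵥ M *ᵥ p = 0) : M *ᵥ p = 0 := by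
  refine dotProduct_eq_zero _ fun w => ?_
  rw [dotProduct_comm]
  have h1 := Matrix.dotProduct_mulVec_exchange hr p p w w
  rw [h, zero_mul, hM.dotProduct_mulVec_comm p w] at h1
  exact mul_self_eq_zero.1 h1.symm

/-- Two symmetric matrices with different kernels `⟨p⟩`, `⟨p'⟩` do not differ by a matrix `M` of
rank one: `M` vanishes on `(p, p')`, so one of `p`, `p'` is isotropic for `M`, hence in its kernel
and in both kernels. -/
theorem not_rank_sub_le_one_of_kernels (hA : A.IsSymm) (hB : B.IsSymm) (hAp : A *ᵥ p = 0)
    (hBp : B *ᵥ p' = 0) (hAp' : A *ᵥ p' ≠ 0) (hBp' : B *ᵥ p ≠ 0) : ¬ (A - B).rank ≤ 1 := by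
  intro hr
  have hM : (A - B).IsSymm := hA.sub hB
  have h1 : p ⬝ᵥ (A - B) *ᵥ p' = 0 := by
    rw [Matrix.sub_mulVec, dotProduct_sub, hBp, dotProduct_zero, hA.dotProduct_mulVec_comm, hAp,
      dotProduct_zero, sub_zero]
  have h2 := Matrix.dotProduct_mulVec_exchange hr p p p' p'
  rw [h1, zero_mul] at h2
  rcases mul_eq_zero.1 h2 with h3 | h3
  · have h4 := mulVec_eq_zero_of_isotropic hM hr h3
    rw [Matrix.sub_mulVec, hAp, zero_sub, neg_eq_zero] at h4
    exact hBp' h4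
  · have h4 := mulVec_eq_zero_of_isotropic hM hr h3
    rw [Matrix.sub_mulVec, hBp, sub_zero] at h4
    exact hAp' h4

theorem dotProduct_self_ne_zero_of_rank_le_one (hA : A.IsSymm) (hB : B.IsSymm)
    (hinj : ∀ x, B *ᵥ x = 0 → x = 0) (hp : p ≠ 0) (hAp : A *ᵥ p = 0) {c : F} (hc : c ≠ 0)
    (hr : (A - c • B).rank ≤ 1) : p ⬝ᵥ B *ᵥ p ≠ 0 := by
  intro h
  have h1 := mulVec_eq_zero_of_isotropic (p := p) (hA.sub (hB.smul c)) hr (by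
    rw [Matrix.sub_mulVec, hAp, Matrix.smul_mulVec, dotProduct_sub, dotProduct_smul, h]
    simp)
  rw [Matrix.sub_mulVec, hAp, zero_sub, neg_eq_zero, Matrix.smul_mulVec] at h1
  exact hp (hinj p ((smul_eq_zero.1 h1).resolve_left hc))

/-- If `A` is singular at `p` and within rank one of `cB`, then `A` is `c` times the restriction of
`B` to the `B`-orthogonal complement of `p`, extended by zero. -/
theorem mul_dotProduct_of_rank_le_one (hA : A.IsSymm) (hAp : A *ᵥ p = 0) {c : F}
    (hc : c ≠ 0) (hr : (A - c • B).rank ≤ 1) (x y : Fin 3 → F) :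
    (p ⬝ᵥ B *ᵥ p) * (x ⬝ᵥ A *ᵥ y) =
      c * ((p ⬝ᵥ B *ᵥ p) * (x ⬝ᵥ B *ᵥ y) - (x ⬝ᵥ B *ᵥ p) * (p ⬝ᵥ B *ᵥ y)) := by
  have h := Matrix.dotProduct_mulVec_exchange hr p p x y
  have hAy : p ⬝ᵥ A *ᵥ y = 0 := by rw [hA.dotProduct_mulVec_comm, hAp, dotProduct_zero]
  simp only [Matrix.sub_mulVec, Matrix.smul_mulVec, dotProduct_sub, dotProduct_smul, hAp, hAy,
    dotProduct_neg, zero_sub, smul_eq_mul] at h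
  apply mul_left_cancel₀ hc
  linear_combination -h

theorem finrank_rowSpace_inf_le_one (h : ¬ (A - B).rank ≤ 1) :
    finrank F ↥(rowSpace A ⊓ rowSpace B) ≤ 1 := by
  have := finrank_rowSpace_inf_add_rank A B
  lia

theorem rank_eq_three_of_injective (hinj : ∀ x, B *ᵥ x = 0 → x = 0) : B.rank = 3 := by
  have h1 := LinearMap.finrank_range_of_inj (f := B.mulVecLin) (by
    rw [← LinearMap.ker_eq_bot, LinearMap.ker_eq_bot']
    exact hinj)
  rw [Matrix.rank, h1]
  simp

end Distances

/-! ### The planes of `barX` -/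

section BarX

variable {F : Type*} [Field F] [Fintype F] {A₀ : Matrix (Fin 3) (Fin 3) F}
  {S : Submodule F (AmbientSpace F 3) → Submodule F (AmbientSpace F 3)}
  {𝓕 : Submodule F (AmbientSpace F 3) → Set (Submodule F (AmbientSpace F 3))}

omit [Fintype F] in
/-- At a point of `Π₂` whose polar line consists of the absolute points, the restriction of `A₀` to
the complement of the point is alternating. -/
theorem mul_dotProduct_self_of_polarLine (hA : A₀.IsSymm) {p : Fin 3 → F}
    (ha : p ⬝ᵥ A₀ *ᵥ p ≠ 0)
    (h : pointsOf (polarLine (rowSpace A₀) (leftPoint p)) = absolutePoints (rowSpace A₀))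
    (x : Fin 3 → F) :
    (p ⬝ᵥ A₀ *ᵥ p) * (x ⬝ᵥ A₀ *ᵥ x) = (x ⬝ᵥ A₀ *ᵥ p) * (p ⬝ᵥ A₀ *ᵥ x) := by
  obtain ⟨c, hc⟩ : ∃ c, x ⬝ᵥ A₀ *ᵥ p = c * (p ⬝ᵥ A₀ *ᵥ p) :=
    ⟨(x ⬝ᵥ A₀ *ᵥ p) / (p ⬝ᵥ A₀ *ᵥ p), by field_simp⟩
  set z := x - c • p with hz
  have hzp : z ⬝ᵥ A₀ *ᵥ p = 0 := by
    rw [hz, sub_dotProduct, smul_dotProduct, hc, smul_eq_mul, sub_self]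
  have hzz : z ⬝ᵥ A₀ *ᵥ z = 0 := by
    by_cases h0 : z = 0
    · simp [h0]
    · have h1 : leftPoint z ∈ pointsOf (polarLine (rowSpace A₀) (leftPoint p)) :=
        span_mem_pointsOf ((elim_mem_polarLine hA).2 ⟨rfl, hzp⟩) (elim_ne_zero_left h0 0)
      rw [h] at h1
      exact (leftPoint_mem_absolutePoints hA h0).1 h1
  have hx : x = z + c • p := by simp [hz]
  have hpz : p ⬝ᵥ A₀ *ᵥ z = 0 := by rw [hA.dotProduct_mulVec_comm, hzp]
  rw [hx]
  simp only [Matrix.mulVec_add, Matrix.mulVec_smul, dotProduct_add, add_dotProduct,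
    smul_dotProduct, dotProduct_smul, smul_eq_mul, hzp, hzz, hpz]
  ring

variable (hA : A₀.IsSymm) (hinj : ∀ x, A₀ *ᵥ x = 0 → x = 0)
  (hadm : IsAdmissible (rowSpace A₀) (regulus A₀) S 𝓕)
include hA hinj hadm

/-- A generator through a point of `Π₂` meets the planes of the regulus in at most a point. -/
theorem not_rank_sub_smul_le_one {p : Fin 3 → F} (hp : p ≠ 0) {A : Matrix (Fin 3) (Fin 3) F}
    (hAs : A.IsSymm)
    (hU : rowSpace A ∈ generatorsThrough (leftPoint p) (S (leftPoint p)) (𝓕 (leftPoint p)))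
    {c : F} (hc : c ≠ 0) : ¬ (A - c • A₀).rank ≤ 1 := by
  intro hr
  have hP : leftPoint p ∈ pointsOf (planeTwo F 3) := mem_pointsOf_planeTwo.2 ⟨p, hp, rfl⟩
  have hloc := hadm.1 _ hP
  have hAp : A *ᵥ p = 0 := (leftPoint_le_rowSpace_iff hAs).1 hU.2.1
  have ha := dotProduct_self_ne_zero_of_rank_le_one hAs hA hinj hp hAp hc hr
  have hrel := mul_dotProduct_of_rank_le_one hAs hAp hc hr
  by_cases hex : leftPoint p ∈ exceptionalPoints (rowSpace A₀)
  · rcases hex with hex | ⟨-, heven, hex⟩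
    · exact ha ((leftPoint_mem_absolutePoints hA hp).1 hex)
    · have hchar : CharP F 2 := by
        have h1 := FiniteField.even_card_iff_char_two.2 (Nat.even_iff.1 heven)
        exact h1 ▸ ringChar.charP F
      refine not_alternating_of_mem_generatorsThrough hchar hp hloc hAs hU fun x => ?_
      have h1 := hrel x x
      rw [mul_dotProduct_self_of_polarLine hA ha hex x, sub_self, mul_zero] at h1
      exact (mul_eq_zero.1 h1).resolve_left ha
  · obtain ⟨hS, -, h𝓕⟩ := hadm.2 _ hP hex
    have heq : S (leftPoint p) ⊓ rowSpace A = S (leftPoint p) ⊓ rowSpace (c • A₀) := by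
      ext v
      rw [Submodule.mem_inf, Submodule.mem_inf, and_congr_right_iff]
      intro hv
      rw [← Sum.elim_comp_inl_inr v] at hv ⊢
      rw [hS, mem_localSpace hA] at hv
      rw [elim_mem_rowSpace hAs, elim_mem_rowSpace (hA.smul c)]
      have h1 : A *ᵥ (v ∘ Sum.inl) = (c • A₀) *ᵥ (v ∘ Sum.inl) := by
        refine dotProduct_eq _ _ fun x => ?_
        rw [dotProduct_comm _ x, dotProduct_comm _ x]
        apply mul_left_cancel₀ ha
        rw [hrel, hA.dotProduct_mulVec_comm p (v ∘ Sum.inl), hv.1, Matrix.smul_mulVec,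
          dotProduct_smul, smul_eq_mul]
        ring
      rw [h1]
    obtain ⟨h1, h2, h3⟩ := inf_mem_of_mem_generatorsThrough hU
    have h4 : S (leftPoint p) ⊓ rowSpace A ∈ 𝓕 (leftPoint p) ∩
        {l | ∃ U ∈ regulus A₀, l = S (leftPoint p) ⊓ U} :=
      ⟨h1, _, Or.inr ⟨c, rfl⟩, heq⟩
    rw [h𝓕] at h4
    exact h4.elim h2 h3

omit hinj in
/-- The planes of `barX` in matrix form. -/
theorem exists_matrix_of_mem_barX {U : Submodule F (AmbientSpace F 3)}
    (hU : U ∈ barX (regulus A₀) S 𝓕) :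
    ∃ A : Matrix (Fin 3) (Fin 3) F, A.IsSymm ∧ U = rowSpace A ∧
      ((∃ p : Fin 3 → F, p ≠ 0 ∧ A *ᵥ p = 0 ∧ (∀ x, A *ᵥ x = 0 → x ∈ F ∙ p) ∧
        rowSpace A ∈ generatorsThrough (leftPoint p) (S (leftPoint p)) (𝓕 (leftPoint p))) ∨
      ∃ c : F, A = c • A₀) := by
  rcases hU with hU | ⟨rfl | ⟨c, rfl⟩, hU⟩
  · simp only [Set.mem_iUnion] at hU
    obtain ⟨P, hP, hU⟩ := hU
    obtain ⟨p, hp, rfl⟩ := mem_pointsOf_planeTwo.1 hP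
    obtain ⟨A, hA, rfl, hAp, hker⟩ := exists_matrix_of_mem_generatorsThrough hp (hadm.1 _ hP) hU
    exact ⟨A, hA, rfl, Or.inl ⟨p, hp, hAp, hker, hU⟩⟩
  · exact absurd rfl hU
  · exact ⟨c • A₀, hA.smul c, rfl, Or.inr ⟨c, rfl⟩⟩

theorem isPlaneCode_barX : IsPlaneCode (barX (regulus A₀) S 𝓕) := by
  refine ⟨fun U hU => ?_, fun U hU U' hU' hne => ?_⟩
  · obtain ⟨A, hAs, rfl, -⟩ := exists_matrix_of_mem_barX hA hadm hU
    exact ⟨isGenerator_rowSpace hAs, finrank_rowSpace A, disjoint_rowSpace_planeOne A⟩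
  have hmix : ∀ {A : Matrix (Fin 3) (Fin 3) F} {p : Fin 3 → F} (c : F), A.IsSymm → p ≠ 0 →
      rowSpace A ∈ generatorsThrough (leftPoint p) (S (leftPoint p)) (𝓕 (leftPoint p)) →
      finrank F ↥(rowSpace A ⊓ rowSpace (c • A₀)) ≤ 1 := by
    intro A p c hAs hp hg
    by_cases hc : c = 0
    · have hP : leftPoint p ∈ pointsOf (planeTwo F 3) := mem_pointsOf_planeTwo.2 ⟨p, hp, rfl⟩
      have h1 := inf_planeTwo_of_mem_generatorsThrough hp (hadm.1 _ hP) hg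
      rw [hc, zero_smul]
      change finrank F ↥(rowSpace A ⊓ planeTwo F 3) ≤ 1
      rw [h1, finrank_leftPoint hp]
    · exact finrank_rowSpace_inf_le_one (not_rank_sub_smul_le_one hA hinj hadm hp hAs hg hc)
  obtain ⟨A, hAs, rfl, ⟨p, hp, hAp, hkA, hgA⟩ | ⟨c, rfl⟩⟩ :=
    exists_matrix_of_mem_barX hA hadm hU <;>
  obtain ⟨B, hBs, rfl, ⟨p', hp', hBp, hkB, hgB⟩ | ⟨d, rfl⟩⟩ :=
    exists_matrix_of_mem_barX hA hadm hU'
  · have hP : leftPoint p ∈ pointsOf (planeTwo F 3) := mem_pointsOf_planeTwo.2 ⟨p, hp, rfl⟩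
    by_cases hpp : leftPoint p = leftPoint p'
    · rw [← hpp] at hgB
      exact finrank_inf_le_of_mem_generatorsThrough hp (hadm.1 _ hP) hgA hgB hne
    · -- Points spanned by proportional vectors coincide.
      have hspan : ∀ {a b : Fin 3 → F}, a ≠ 0 → b ≠ 0 → a ∈ F ∙ b → leftPoint a = leftPoint b := by
        intro a b ha hb hab
        obtain ⟨t, rfl⟩ := Submodule.mem_span_singleton.1 hab
        refine Submodule.eq_of_le_of_finrank_eq (leftPoint_le_iff.2 ?_)
          (by rw [finrank_leftPoint ha, finrank_leftPoint hb])
        exact Submodule.mem_span_singleton.2 ⟨t, by ext (i | i) <;> simp⟩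
      refine finrank_rowSpace_inf_le_one (not_rank_sub_le_one_of_kernels hAs hBs hAp hBp ?_ ?_)
      · exact fun h0 => hpp (hspan hp' hp (hkA _ h0)).symm
      · exact fun h0 => hpp (hspan hp hp' (hkB _ h0))
  · exact hmix d hAs hp hgA
  · rw [inf_comm]
    exact hmix c hBs hp' hgB
  · refine finrank_rowSpace_inf_le_one ?_
    have hcd : c - d ≠ 0 := fun h0 => hne (by rw [sub_eq_zero.1 h0])
    rw [← sub_smul, rank_eq_three_of_injective]
    · lia
    · intro x hx
      rw [Matrix.smul_mulVec] at hx
      exact hinj x ((smul_eq_zero.1 hx).resolve_left hcd)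

theorem ncard_barX :
    (barX (regulus A₀) S 𝓕).ncard = Fintype.card F ^ 4 + Fintype.card F ^ 3 - 1 := by
  classical
  set q := Fintype.card F with hq
  have hq1 : 1 < q := Fintype.one_lt_card
  have hA0 : A₀ ≠ 0 := by
    rintro rfl
    exact one_ne_zero (hinj (1 : Fin 3 → F) (Matrix.zero_mulVec _))
  have hreg : (regulus A₀ \ {planeOne F 3}).ncard = q := by
    have h1 : regulus A₀ \ {planeOne F 3} = Set.range fun c : F => rowSpace (c • A₀) := by
      rw [regulus, Set.insert_sdiff_of_mem _ (Set.mem_singleton _), sdiff_eq_left,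
        Set.disjoint_singleton_right]
      rintro ⟨c, hc⟩
      have h2 := disjoint_rowSpace_planeOne (c • A₀)
      rw [show rowSpace (c • A₀) = planeOne F 3 from hc, disjoint_self] at h2
      have h3 := finrank_rowSpace (c • A₀)
      rw [show rowSpace (c • A₀) = planeOne F 3 from hc, h2, finrank_bot] at h3
      lia
    rw [h1, ← Set.image_univ, Set.ncard_image_of_injective, Set.ncard_univ,
      Nat.card_eq_fintype_card]
    intro c d hcd
    exact smul_left_injective F hA0 (rowSpace_injective hcd)
  have hpts : (pointsOf (planeTwo F 3)).ncard = q ^ 2 + q + 1 := by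
    have h1 := ncard_pointsOf_mul (planeTwo F 3)
    rw [planeTwo, finrank_rowSpace] at h1
    refine Nat.eq_of_mul_eq_mul_right (show 0 < q - 1 by lia) (h1.trans ?_)
    rw [← hq]
    zify [hq1.le, Nat.one_le_pow 3 q (by lia)]
    ring
  have hpfin : (pointsOf (planeTwo F 3)).Finite := Set.toFinite _
  have hgens : (⋃ P ∈ pointsOf (planeTwo F 3), generatorsThrough P (S P) (𝓕 P)).ncard =
      (q ^ 2 + q + 1) * (q ^ 2 - 1) := by
    have hpair : (pointsOf (planeTwo F 3)).PairwiseDisjoint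
        fun P => generatorsThrough P (S P) (𝓕 P) := by
      intro P hP P' hP' hne
      refine Set.disjoint_left.2 fun U hU hU' => hne ?_
      have hloc := hadm.1 _ hP
      have hloc' := hadm.1 _ hP'
      obtain ⟨p, hp, rfl⟩ := mem_pointsOf_planeTwo.1 hP
      obtain ⟨p', hp', rfl⟩ := mem_pointsOf_planeTwo.1 hP'
      rw [← inf_planeTwo_of_mem_generatorsThrough hp hloc hU,
        inf_planeTwo_of_mem_generatorsThrough hp' hloc' hU']
    have h1 : (⋃ P ∈ pointsOf (planeTwo F 3), generatorsThrough P (S P) (𝓕 P)) =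
        ↑(hpfin.toFinset.biUnion fun P => (generatorsThrough P (S P) (𝓕 P)).toFinite.toFinset) := by
      ext U
      simp
    rw [h1, Set.ncard_coe_finset, Finset.card_biUnion, Finset.sum_const_nat (m := q ^ 2 - 1),
      ← Set.ncard_eq_toFinset_card _ hpfin, hpts]
    · intro P hP
      have hP' : P ∈ pointsOf (planeTwo F 3) := by simpa using hP
      have hloc := hadm.1 _ hP'
      obtain ⟨p, hp, rfl⟩ := mem_pointsOf_planeTwo.1 hP'
      rw [← Set.ncard_eq_toFinset_card, ncard_generatorsThrough hp hloc]
    · intro P hP P' hP' hne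
      rw [Function.onFun, Set.Finite.disjoint_toFinset]
      exact hpair (by simpa using hP) (by simpa using hP') hne
  rw [barX, Set.ncard_union_eq, hgens, hreg]
  · have h1 : 1 ≤ q ^ 4 + q ^ 3 := (Nat.one_le_pow 3 q (by lia)).trans (Nat.le_add_left _ _)
    zify [h1, Nat.one_le_pow 2 q (by lia)]
    ring
  · -- A generator through a point of `Π₂` meets `Π₂` exactly there; `L(cA₀)` does not.
    refine Set.disjoint_left.2 fun U hU hU' => ?_
    simp only [Set.mem_iUnion] at hU
    obtain ⟨P, hP, hU⟩ := hU
    have hloc := hadm.1 _ hP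
    obtain ⟨p, hp, rfl⟩ := mem_pointsOf_planeTwo.1 hP
    obtain ⟨rfl | ⟨c, rfl⟩, hU'⟩ := hU'
    · exact hU' rfl
    · have h1 := (leftPoint_le_rowSpace_iff (hA.smul c)).1 hU.2.1
      rw [Matrix.smul_mulVec] at h1
      rcases smul_eq_zero.1 h1 with rfl | h2
      · simp only [zero_smul] at hU
        exact planeTwo_notMem_generatorsThrough hU
      · exact hp (hinj p h2)

end BarX

/-! ### Desarguesian line-spreads from quadratic extensions -/

/-- A frame `e, f, p` of `F³` together with a matrix `K` killing `p` and acting on `⟨e, f⟩` as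
multiplication by an element of the quadratic extension with minimal polynomial `t² - vt + w`. -/
structure FieldFrame (F : Type*) [Field F] (p : Fin 3 → F) where
  /-- The first vector of the complement of `p`. -/
  e : Fin 3 → F
  /-- The second vector of the complement of `p`. -/
  f : Fin 3 → F
  /-- The trace of the generator of the quadratic extension. -/
  v : F
  /-- The norm of the generator of the quadratic extension. -/
  w : F
  /-- The matrix of the multiplication. -/
  K : Matrix (Fin 3) (Fin 3) F
  linearIndependent : LinearIndependent F ![e, f, p]
  irreducible : ∀ t : F, t ^ 2 ≠ v * t + -w
  K_e : K *ᵥ e = v • e + w • f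
  K_f : K *ᵥ f = -e
  K_p : K *ᵥ p = 0

theorem exists_fieldFrame {F : Type*} [Field F] {p e f : Fin 3 → F}
    (h : LinearIndependent F ![e, f, p]) {v w : F} (hvw : ∀ t : F, t ^ 2 ≠ v * t + -w) :
    ∃ D : FieldFrame F p, D.e = e ∧ D.f = f ∧ D.v = v ∧ D.w = w := by
  let b := basisOfLinearIndependentOfCardEqFinrank h (by simp)
  have hb : ⇑b = ![e, f, p] := coe_basisOfLinearIndependentOfCardEqFinrank h (by simp)
  let T : (Fin 3 → F) →ₗ[F] (Fin 3 → F) := b.constr F ![v • e + w • f, -e, 0]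
  have h0 : T e = v • e + w • f := by
    have := b.constr_basis F ![v • e + w • f, -e, 0] 0
    rwa [hb] at this
  have h1 : T f = -e := by
    have := b.constr_basis F ![v • e + w • f, -e, 0] 1
    rwa [hb] at this
  have h2 : T p = 0 := by
    have := b.constr_basis F ![v • e + w • f, -e, 0] 2
    rwa [hb] at this
  exact ⟨⟨e, f, v, w, LinearMap.toMatrix' T, h, hvw, by rw [LinearMap.toMatrix'_mulVec, h0],
    by rw [LinearMap.toMatrix'_mulVec, h1], by rw [LinearMap.toMatrix'_mulVec, h2]⟩,
    rfl, rfl, rfl, rfl⟩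

namespace FieldFrame

variable {F : Type*} [Field F] {p : Fin 3 → F} (D : FieldFrame F p)

theorem point_ne_zero (D : FieldFrame F p) : p ≠ 0 := D.linearIndependent.ne_zero 2

/-- The multiplication `(x, y) ↦ (Kx, Kᵀy)`; the transpose makes `v` and its image orthogonal. -/
noncomputable def J : End F (AmbientSpace F 3) :=
  (Matrix.fromBlocks D.K 0 0 D.Kᵀ).mulVecLin

theorem J_elim (x y : Fin 3 → F) : D.J (Sum.elim x y) = Sum.elim (D.K *ᵥ x) (D.Kᵀ *ᵥ y) := by
  simp [J, Matrix.fromBlocks_mulVec]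

/-- The 3-space of the pairs `(x, y)` with `x ∈ ⟨e, f⟩` and `y` orthogonal to `p`. -/
noncomputable def space : Submodule F (AmbientSpace F 3) :=
  (Submodule.span F {D.e, D.f}).comap (LinearMap.funLeft F F Sum.inl) ⊓ perp (leftPoint p)

/-- The lines of `space` that are one-dimensional over the quadratic extension. -/
def lines : Set (Submodule F (AmbientSpace F 3)) :=
  {l | ∃ u ∈ D.space, u ≠ 0 ∧ l = Submodule.span F {u, D.J u}}

theorem elim_mem_space {x y : Fin 3 → F} :
    (Sum.elim x y : AmbientSpace F 3) ∈ D.space ↔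
      (∃ a b : F, a • D.e + b • D.f = x) ∧ p ⬝ᵥ y = 0 := by
  rw [space, Submodule.mem_inf, elim_mem_perp_leftPoint, Submodule.mem_comap,
    Submodule.mem_span_pair]
  rfl

theorem dotProduct_transpose_mulVec (x y : Fin 3 → F) :
    x ⬝ᵥ D.Kᵀ *ᵥ y = (D.K *ᵥ x) ⬝ᵥ y := by
  rw [Matrix.mulVec_transpose, dotProduct_comm, ← Matrix.dotProduct_mulVec, dotProduct_comm]

theorem J_mem_space {u : AmbientSpace F 3} (hu : u ∈ D.space) :
    D.J u ∈ D.space ∧ D.J (D.J u) = D.v • D.J u + -D.w • u := by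
  rw [← Sum.elim_comp_inl_inr u] at hu ⊢
  obtain ⟨⟨a, b, hab⟩, hy⟩ := D.elim_mem_space.1 hu
  have hK : D.K *ᵥ (u ∘ Sum.inl) = (a * D.v - b) • D.e + (a * D.w) • D.f := by
    rw [← hab, Matrix.mulVec_add, Matrix.mulVec_smul, Matrix.mulVec_smul, D.K_e, D.K_f]
    module
  have hKK : D.K *ᵥ (D.K *ᵥ (u ∘ Sum.inl)) =
      D.v • D.K *ᵥ (u ∘ Sum.inl) + -D.w • (u ∘ Sum.inl) := by
    rw [hK, ← hab, Matrix.mulVec_add, Matrix.mulVec_smul, Matrix.mulVec_smul, D.K_e, D.K_f]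
    module
  have hTT : D.Kᵀ *ᵥ (D.Kᵀ *ᵥ (u ∘ Sum.inr)) =
      D.v • D.Kᵀ *ᵥ (u ∘ Sum.inr) + -D.w • (u ∘ Sum.inr) := by
    rw [← sub_eq_zero]
    refine eq_zero_of_frame D.linearIndependent ?_ ?_ ?_ <;>
    simp only [dotProduct_sub, dotProduct_add, dotProduct_smul, dotProduct_transpose_mulVec,
      D.K_e, D.K_f, D.K_p, add_dotProduct, smul_dotProduct, neg_dotProduct, zero_dotProduct,
      smul_eq_mul, hy] <;>
    ring
  simp only [J_elim]
  refine ⟨D.elim_mem_space.2 ⟨⟨_, _, hK.symm⟩, ?_⟩, ?_⟩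
  · rw [dotProduct_transpose_mulVec, D.K_p, zero_dotProduct]
  · rw [hKK, hTT]
    ext (i | i) <;> simp

theorem symplecticForm_J (u : AmbientSpace F 3) : symplecticForm F 3 u (D.J u) = 0 := by
  rw [← Sum.elim_comp_inl_inr u, J_elim, symplecticForm_elim, dotProduct_transpose_mulVec,
    dotProduct_comm, sub_self]

theorem isTotallyIsotropic_span_J (u : AmbientSpace F 3) :
    IsTotallyIsotropic (Submodule.span F {u, D.J u}) := by
  intro x hx y hy
  obtain ⟨a, b, rfl⟩ := Submodule.mem_span_pair.1 hx
  obtain ⟨c, d, rfl⟩ := Submodule.mem_span_pair.1 hy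
  have h1 := D.symplecticForm_J u
  have h2 : symplecticForm F 3 (D.J u) u = 0 := symplecticForm_isRefl _ _ h1
  have h3 : ∀ z, symplecticForm F 3 z z = 0 := fun z => symplecticForm_isAlt z
  simp [h1, h2, h3]

theorem finrank_span_J {u : AmbientSpace F 3} (hu : u ∈ D.space) (h0 : u ≠ 0) :
    finrank F (Submodule.span F {u, D.J u}) = 2 := by
  have hli : LinearIndependent F ![u, D.J u] := by
    rw [LinearIndependent.pair_iff' h0]
    intro t ht
    have h1 := (D.J_mem_space hu).2
    rw [← ht, map_smul, ← ht] at h1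
    have h2 : (t ^ 2 - (D.v * t + -D.w)) • u = 0 := by
      rw [sub_smul, sub_eq_zero, sq, mul_smul, h1, add_smul, mul_smul]
    exact D.irreducible t (sub_eq_zero.1 ((smul_eq_zero.1 h2).resolve_right h0))
  rw [← Matrix.range_cons_cons_empty u (D.J u) ![], finrank_span_eq_card hli]
  rfl

theorem span_J_le {u z : AmbientSpace F 3} (hu : u ∈ D.space)
    (hz : z ∈ Submodule.span F {u, D.J u}) :
    Submodule.span F {z, D.J z} ≤ Submodule.span F {u, D.J u} := by
  rw [Submodule.span_le]
  rintro x (rfl | rfl)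
  · exact hz
  · obtain ⟨a, b, rfl⟩ := Submodule.mem_span_pair.1 hz
    rw [map_add, map_smul, map_smul, (D.J_mem_space hu).2]
    refine Submodule.mem_span_pair.2 ⟨-b * D.w, a + b * D.v, ?_⟩
    module

theorem span_J_le_space {u : AmbientSpace F 3} (hu : u ∈ D.space) :
    Submodule.span F {u, D.J u} ≤ D.space := by
  rw [Submodule.span_le]
  rintro x (rfl | rfl)
  exacts [hu, (D.J_mem_space hu).1]

theorem isLineSpread : IsLineSpread D.space D.lines := by
  refine ⟨?_, fun P hP => ?_⟩
  · rintro l ⟨u, hu, h0, rfl⟩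
    exact ⟨D.span_J_le_space hu, D.finrank_span_J hu h0, D.isTotallyIsotropic_span_J u⟩
  · obtain ⟨z, hz, h0, rfl⟩ := exists_eq_span_of_mem_pointsOf hP
    simp only [Submodule.span_singleton_le_iff_mem]
    refine ⟨_, ⟨⟨z, hz, h0, rfl⟩, Submodule.mem_span_pair.2 ⟨1, 0, by simp⟩⟩, ?_⟩
    rintro l ⟨⟨u, hu, hu0, rfl⟩, hl⟩
    symm
    exact Submodule.eq_of_le_of_finrank_eq (D.span_J_le hu hl)
      (by rw [D.finrank_span_J hu hu0, D.finrank_span_J hz h0])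

theorem isDesarguesian : IsDesarguesian D.space D.lines :=
  ⟨D.J, D.v, -D.w, D.irreducible, fun _ hu => D.J_mem_space hu, rfl⟩

theorem J_mem_of_mem_lines {l : Submodule F (AmbientSpace F 3)} (hl : l ∈ D.lines)
    {z : AmbientSpace F 3} (hz : z ∈ l) : D.J z ∈ l := by
  obtain ⟨u, hu, -, rfl⟩ := hl
  exact D.span_J_le hu hz (Submodule.subset_span (by simp))

theorem leftPoint_not_le : ¬ leftPoint p ≤ D.space := by
  rw [leftPoint_le_iff, elim_mem_space]
  rintro ⟨⟨a, b, hab⟩, -⟩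
  have := linearIndependent_triple_iff.1 D.linearIndependent a b (-1) (by rw [hab]; simp)
  exact one_ne_zero (neg_eq_zero.1 this.2.2)

theorem finrank_space : finrank F D.space = 4 := by
  have h1 := Submodule.finrank_sup_add_finrank_inf_eq (leftPoint p) D.space
  have h2 : leftPoint p ⊓ D.space = ⊥ := by
    rw [eq_bot_iff]
    rintro x ⟨hx, hxS⟩
    by_contra h0
    refine D.leftPoint_not_le ?_
    obtain ⟨c, rfl⟩ := Submodule.mem_span_singleton.1 hx
    have hc : c ≠ 0 := by rintro rfl; simp at h0
    exact leftPoint_le_iff.2 ((Submodule.smul_mem_iff _ hc).1 hxS)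
  have h3 : leftPoint p ⊔ D.space = perp (leftPoint p) := by
    apply le_antisymm
    · refine sup_le (leftPoint_le_iff.2 ?_) inf_le_right
      rw [elim_mem_perp_leftPoint, dotProduct_zero]
    · intro x hx
      rw [← Sum.elim_comp_inl_inr x] at hx ⊢
      obtain ⟨a, b, c, habc⟩ := exists_coords_of_frame D.linearIndependent (x ∘ Sum.inl)
      have h4 : (Sum.elim (x ∘ Sum.inl) (x ∘ Sum.inr) : AmbientSpace F 3) =
          c • (Sum.elim p 0 : AmbientSpace F 3) +
            Sum.elim (a • D.e + b • D.f) (x ∘ Sum.inr) := by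
        rw [habc]
        ext (i | i)
        · simp; ring
        · simp
      rw [h4]
      exact Submodule.add_mem_sup (Submodule.smul_mem _ _ (mem_leftPoint_self p))
        (D.elim_mem_space.2 ⟨⟨a, b, rfl⟩, elim_mem_perp_leftPoint.1 hx⟩)
  rw [h2, h3, finrank_bot, finrank_leftPoint D.point_ne_zero,
    finrank_perp_leftPoint D.point_ne_zero] at h1
  lia

theorem space_inf_planeTwo_mem : D.space ⊓ planeTwo F 3 ∈ D.lines := by
  have hf : (Sum.elim D.f 0 : AmbientSpace F 3) ∈ D.space :=
    D.elim_mem_space.2 ⟨⟨0, 1, by simp⟩, dotProduct_zero _⟩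
  refine ⟨Sum.elim D.f 0, hf, elim_ne_zero_left (D.linearIndependent.ne_zero 1) 0, ?_⟩
  rw [J_elim, D.K_f, Matrix.mulVec_zero]
  ext x
  rw [← Sum.elim_comp_inl_inr x, Submodule.mem_inf, elim_mem_space, elim_mem_planeTwo,
    Submodule.mem_span_pair]
  constructor
  · rintro ⟨⟨⟨a, b, hab⟩, -⟩, hy⟩
    refine ⟨b, -a, ?_⟩
    rw [← hab, hy]
    ext (i | i)
    · simp; ring
    · simp
  · rintro ⟨a, b, hab⟩
    have hx : a • D.f + b • -D.e = x ∘ Sum.inl :=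
      (congrArg (· ∘ Sum.inl) hab).trans (Sum.elim_comp_inl _ _)
    have hy : x ∘ Sum.inr = 0 := by
      have := congrArg (· ∘ Sum.inr) hab
      ext i
      simpa using (congrFun this i).symm
    rw [hy]
    exact ⟨⟨⟨-b, a, by rw [← hx]; module⟩, dotProduct_zero _⟩, rfl⟩

theorem space_inf_planeOne_mem : D.space ⊓ planeOne F 3 ∈ D.lines := by
  obtain ⟨y, hy0, hy⟩ : ∃ y : Fin 3 → F, y ≠ 0 ∧ p ⬝ᵥ y = 0 := by
    let T : (Fin 3 → F) →ₗ[F] F := dotProductBilin F F p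
    have hT : LinearMap.ker T ≠ ⊥ := LinearMap.ker_ne_bot_of_finrank_lt (by simp)
    obtain ⟨y, hy, h0⟩ := Submodule.exists_mem_ne_zero_of_ne_bot hT
    exact ⟨y, h0, hy⟩
  have hyS : (Sum.elim 0 y : AmbientSpace F 3) ∈ D.space :=
    D.elim_mem_space.2 ⟨⟨0, 0, by simp⟩, hy⟩
  have hne : (Sum.elim 0 y : AmbientSpace F 3) ≠ 0 := fun h => hy0 (by
    simpa using congrArg (· ∘ Sum.inr) h)
  refine ⟨Sum.elim 0 y, hyS, hne, ?_⟩
  symm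
  refine Submodule.eq_of_le_of_finrank_le (le_inf (D.span_J_le_space hyS) ?_) ?_
  · rw [Submodule.span_le]
    rintro x (rfl | rfl)
    · exact elim_mem_planeOne.2 rfl
    · rw [J_elim, Matrix.mulVec_zero]
      exact elim_mem_planeOne.2 rfl
  · have h1 := Submodule.finrank_sup_add_finrank_inf_eq (D.space ⊓ planeOne F 3)
      (D.space ⊓ planeTwo F 3)
    have h2 : (D.space ⊓ planeOne F 3) ⊓ (D.space ⊓ planeTwo F 3) = ⊥ := by
      rw [eq_bot_iff]
      rintro x ⟨⟨-, hx1⟩, -, hx2⟩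
      exact (Submodule.disjoint_def.1 (disjoint_rowSpace_planeOne 0)) x hx2 hx1
    have h3 := Submodule.finrank_mono (sup_le inf_le_left inf_le_left :
      (D.space ⊓ planeOne F 3) ⊔ (D.space ⊓ planeTwo F 3) ≤ D.space)
    have h4 := (D.isLineSpread.1 _ D.space_inf_planeTwo_mem).2.1
    rw [D.finrank_space] at h3
    rw [h2, finrank_bot, h4] at h1
    rw [D.finrank_span_J hyS hne]
    lia

theorem isLocalChoice : IsLocalChoice (leftPoint p) D.space D.lines := by
  refine ⟨D.finrank_space, inf_le_right, D.leftPoint_not_le, ?_, D.isLineSpread,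
    D.space_inf_planeOne_mem, D.space_inf_planeTwo_mem⟩
  intro x hx
  rw [← Sum.elim_comp_inl_inr x] at hx ⊢
  obtain ⟨hx, hx1⟩ := Submodule.mem_inf.1 hx
  rw [elim_mem_planeOne] at hx1
  rw [elim_mem_space, hx1]
  exact ⟨⟨0, 0, by simp⟩, elim_mem_perp_leftPoint.1 hx⟩

/-- If `L(A)` meets `space` in a line of the spread, then `AK` is symmetric on `⟨e, f⟩`, which is a
linear condition on `A`. -/
theorem linear_relation_of_mem_lines {A : Matrix (Fin 3) (Fin 3) F} (hA : A.IsSymm)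
    (hpe : p ⬝ᵥ A *ᵥ D.e = 0) (h : D.space ⊓ rowSpace A ∈ D.lines) :
    D.e ⬝ᵥ A *ᵥ D.e + D.v * (D.e ⬝ᵥ A *ᵥ D.f) + D.w * (D.f ⬝ᵥ A *ᵥ D.f) = 0 := by
  have h1 : (Sum.elim D.e (A *ᵥ D.e) : AmbientSpace F 3) ∈ D.space ⊓ rowSpace A :=
    ⟨D.elim_mem_space.2 ⟨⟨1, 0, by simp⟩, hpe⟩, (elim_mem_rowSpace hA).2 rfl⟩
  have h2 := (Submodule.mem_inf.1 (D.J_mem_of_mem_lines h h1)).2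
  rw [J_elim, elim_mem_rowSpace hA, D.K_e] at h2
  have h3 := congrArg (D.f ⬝ᵥ ·) h2
  simp only [dotProduct_transpose_mulVec, D.K_f, neg_dotProduct, Matrix.mulVec_add,
    Matrix.mulVec_smul, dotProduct_add, dotProduct_smul, smul_eq_mul,
    hA.dotProduct_mulVec_comm D.f D.e] at h3
  linear_combination -h3

end FieldFrame

/-! ### Irreducible quadratic polynomials avoiding lines -/

section Counting

variable (F : Type*) [Field F] [Fintype F] [DecidableEq F]

/-- The pairs `(v, w)` for which `t² - vt + w` has no root. -/
def irreduciblePairs : Finset (F × F) :=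
  Finset.univ.filter fun x => ∀ t : F, t ^ 2 ≠ x.1 * t + -x.2

variable {F}

theorem mem_irreduciblePairs {x : F × F} :
    x ∈ irreduciblePairs F ↔ ∀ t : F, t ^ 2 ≠ x.1 * t + -x.2 := by
  simp [irreduciblePairs]

/-- The reducible polynomials are indexed by unordered pairs of roots. -/
theorem le_card_irreduciblePairs :
    Fintype.card F * (Fintype.card F - 1) ≤ 2 * (irreduciblePairs F).card := by
  set q := Fintype.card F with hq
  have hq1 : 1 < q := Fintype.one_lt_card
  let g : Sym2 F → F × F := Sym2.lift ⟨fun a b => (a + b, a * b), fun a b =>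
    Prod.ext (add_comm a b) (mul_comm a b)⟩
  have h1 : (irreduciblePairs F)ᶜ ⊆ Finset.univ.image g := by
    intro x hx
    rw [Finset.mem_compl, mem_irreduciblePairs] at hx
    push Not at hx
    obtain ⟨t, ht⟩ := hx
    refine Finset.mem_image.2 ⟨s(t, x.1 - t), Finset.mem_univ _, ?_⟩
    ext
    · simp [g]
    · simp only [g, Sym2.lift_mk]
      linear_combination -ht
  have h2 := (Finset.card_le_card h1).trans Finset.card_image_le
  rw [Finset.card_compl, Fintype.card_prod, Finset.card_univ, Sym2.card, ← hq,
    Nat.choose_two_right, Nat.add_sub_cancel] at h2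
  have h3 : 2 * ((q + 1) * q / 2) = (q + 1) * q :=
    Nat.mul_div_cancel' (by rw [mul_comm]; exact (Nat.even_mul_succ_self q).two_dvd)
  zify [hq1.le] at h2 h3 ⊢
  have h4 : (irreduciblePairs F).card ≤ q * q := by
    have := Finset.card_le_univ (irreduciblePairs F)
    rwa [Fintype.card_prod] at this
  rw [Nat.cast_sub h4] at h2
  push_cast at h2
  linarith

/-- The polynomials `t² - vt + w` on a line of the `(v, w)`-plane: almost every `t` is a root of one
of them, and none has more than two roots. -/
theorem card_irreduciblePairs_filter_le {α β γ : F} (h : α ≠ 0 ∨ β ≠ 0 ∨ γ ≠ 0) :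
    2 * ((irreduciblePairs F).filter fun x => α + x.1 * β + x.2 * γ = 0).card ≤
      Fintype.card F + 1 := by
  set q := Fintype.card F with hq
  have hq1 : 1 < q := Fintype.one_lt_card
  by_cases hβγ : β = 0 ∧ γ = 0
  · have hα : α ≠ 0 := by
      rcases h with h | h | h
      exacts [h, absurd hβγ.1 h, absurd hβγ.2 h]
    simp [hβγ.1, hβγ.2, hα]
  have hβγ' : β ≠ 0 ∨ γ ≠ 0 := not_and_or.1 hβγ
  let L : Finset (F × F) := Finset.univ.filter fun x => α + x.1 * β + x.2 * γ = 0
  have hL : L.card = q := by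
    rw [hq, ← card_filter_line hβγ' (-α)]
    congr 1
    refine Finset.filter_congr fun x _ => ⟨fun h => ?_, fun h => ?_⟩ <;> linear_combination h
  let T : Finset F := Finset.univ.filter fun t => β + t * γ ≠ 0
  have hT : q - 1 ≤ T.card := by
    have h1 : (Finset.univ.filter fun t : F => β + t * γ = 0).card ≤ 1 := by
      refine Finset.card_le_one.2 fun a ha b hb => ?_
      simp only [Finset.mem_filter, Finset.mem_univ, true_and] at ha hb
      have hγ : γ ≠ 0 := by
        rintro rfl
        rw [mul_zero, add_zero] at ha
        exact hβγ ⟨ha, rfl⟩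
      exact mul_right_cancel₀ hγ (by linear_combination ha - hb)
    have h2 := Finset.card_filter_add_card_filter_not (s := (Finset.univ : Finset F))
      (fun t : F => β + t * γ = 0)
    rw [Finset.card_univ] at h2
    have h3 : T.card = (Finset.univ.filter fun t : F => ¬ (β + t * γ = 0)).card := rfl
    lia
  -- `ν t` is the pair on the line for which `t` is a root.
  let ν : F → F × F := fun t =>
    ((γ * t ^ 2 - α) / (β + t * γ), (γ * t ^ 2 - α) / (β + t * γ) * t - t ^ 2)
  have hmaps : ∀ t ∈ T, ν t ∈ L \ irreduciblePairs F := by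
    intro t ht
    simp only [T, Finset.mem_filter, Finset.mem_univ, true_and] at ht
    rw [Finset.mem_sdiff, mem_irreduciblePairs]
    push Not
    refine ⟨Finset.mem_filter.2 ⟨Finset.mem_univ _, ?_⟩, t, ?_⟩
    · have h1 := div_mul_cancel₀ (γ * t ^ 2 - α) ht
      simp only [ν]
      linear_combination h1
    · simp only [ν]
      ring
  have hfib : ∀ x ∈ L \ irreduciblePairs F, (T.filter fun t => ν t = x).card ≤ 2 := by
    intro x _
    have hroot : ∀ t, ν t = x → t ^ 2 = x.1 * t - x.2 := by
      rintro t rfl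
      simp only [ν]
      ring
    by_cases hne : (T.filter fun t => ν t = x) = ∅
    · simp [hne]
    obtain ⟨t₀, ht₀⟩ := Finset.nonempty_iff_ne_empty.2 hne
    refine (Finset.card_le_card (t := {t₀, x.1 - t₀}) fun t ht => ?_).trans Finset.card_le_two
    have h1 := hroot t (Finset.mem_filter.1 ht).2
    have h2 := hroot t₀ (Finset.mem_filter.1 ht₀).2
    have h3 : (t - t₀) * (t - (x.1 - t₀)) = 0 := by linear_combination h1 - h2
    rw [Finset.mem_insert, Finset.mem_singleton]
    exact (mul_eq_zero.1 h3).imp sub_eq_zero.1 sub_eq_zero.1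
  have h1 := Finset.card_le_mul_card_image_of_maps_to hmaps 2 hfib
  have h2 : L.filter (· ∈ irreduciblePairs F) =
      (irreduciblePairs F).filter fun x => α + x.1 * β + x.2 * γ = 0 := by
    ext x
    simp [L, and_comm]
  have h3 := Finset.card_filter_add_card_filter_not (s := L) (· ∈ irreduciblePairs F)
  rw [h2, hL, Finset.filter_notMem_eq_sdiff] at h3
  lia

theorem exists_irreducible_pair (hq : 2 < Fintype.card F) {α β γ : F}
    (h : α ≠ 0 ∨ β ≠ 0 ∨ γ ≠ 0) :
    ∃ v w : F, (∀ t : F, t ^ 2 ≠ v * t + -w) ∧ α + v * β + w * γ ≠ 0 := by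
  by_contra! hcon
  have h1 : ((irreduciblePairs F).filter fun x => α + x.1 * β + x.2 * γ = 0) =
      irreduciblePairs F :=
    Finset.filter_true_of_mem fun x hx => hcon x.1 x.2 (mem_irreduciblePairs.1 hx)
  have h2 := card_irreduciblePairs_filter_le h
  rw [h1] at h2
  have h3 := le_card_irreduciblePairs (F := F)
  obtain ⟨n, hn⟩ : ∃ n, Fintype.card F = n + 3 := ⟨Fintype.card F - 3, by lia⟩
  rw [hn] at h2 h3
  simp only [Nat.add_succ_sub_one] at h3
  nlinarith

theorem exists_irreducible_pair_two (hq : 3 < Fintype.card F) {α β γ α' β' γ' : F}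
    (h : α ≠ 0 ∨ β ≠ 0 ∨ γ ≠ 0) (h' : α' ≠ 0 ∨ β' ≠ 0 ∨ γ' ≠ 0) :
    ∃ v w : F, (∀ t : F, t ^ 2 ≠ v * t + -w) ∧ α + v * β + w * γ ≠ 0 ∧
      α' + v * β' + w * γ' ≠ 0 := by
  by_contra! hcon
  have h1 : irreduciblePairs F ⊆
      ((irreduciblePairs F).filter fun x => α + x.1 * β + x.2 * γ = 0) ∪
      ((irreduciblePairs F).filter fun x => α' + x.1 * β' + x.2 * γ' = 0) := by
    intro x hx
    rw [Finset.mem_union, Finset.mem_filter, Finset.mem_filter]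
    by_cases h0 : α + x.1 * β + x.2 * γ = 0
    · exact Or.inl ⟨hx, h0⟩
    · exact Or.inr ⟨hx, hcon x.1 x.2 (mem_irreduciblePairs.1 hx) h0⟩
  have h2 := card_irreduciblePairs_filter_le h
  have h2' := card_irreduciblePairs_filter_le h'
  have h4 := (Finset.card_le_card h1).trans (Finset.card_union_le _ _)
  have h3 := le_card_irreduciblePairs (F := F)
  obtain ⟨n, hn⟩ : ∃ n, Fintype.card F = n + 4 := ⟨Fintype.card F - 4, by lia⟩
  rw [hn] at h2 h2' h3
  simp only [Nat.add_succ_sub_one] at h3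
  nlinarith

end Counting

/-! ### Existence of admissible choices -/

section Existence

variable {F : Type*} [Field F]

/-- The linear condition `α + vβ + wγ ≠ 0` on the restriction of `b·B - (Bp)(Bp)ᵀ`, `b = pᵀBp`, to
`⟨e, f⟩`; it says that the spread of the frame contains no line of a plane `L(cB)`, seen from
`⟨(p, 0)⟩`. -/
def Avoids (B : Matrix (Fin 3) (Fin 3) F) (p e f : Fin 3 → F) (v w : F) : Prop :=
  ((p ⬝ᵥ B *ᵥ p) * (e ⬝ᵥ B *ᵥ e) - (e ⬝ᵥ B *ᵥ p) * (p ⬝ᵥ B *ᵥ e)) +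
    v * ((p ⬝ᵥ B *ᵥ p) * (e ⬝ᵥ B *ᵥ f) - (e ⬝ᵥ B *ᵥ p) * (p ⬝ᵥ B *ᵥ f)) +
    w * ((p ⬝ᵥ B *ᵥ p) * (f ⬝ᵥ B *ᵥ f) - (f ⬝ᵥ B *ᵥ p) * (p ⬝ᵥ B *ᵥ f)) ≠ 0

theorem restriction_ne_zero {B : Matrix (Fin 3) (Fin 3) F} (hB : B.IsSymm)
    (hinj : ∀ x, B *ᵥ x = 0 → x = 0) {p e f : Fin 3 → F} (h : LinearIndependent F ![e, f, p])
    (hb : p ⬝ᵥ B *ᵥ p ≠ 0) :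
    (p ⬝ᵥ B *ᵥ p) * (e ⬝ᵥ B *ᵥ e) - (e ⬝ᵥ B *ᵥ p) * (p ⬝ᵥ B *ᵥ e) ≠ 0 ∨
    (p ⬝ᵥ B *ᵥ p) * (e ⬝ᵥ B *ᵥ f) - (e ⬝ᵥ B *ᵥ p) * (p ⬝ᵥ B *ᵥ f) ≠ 0 ∨
    (p ⬝ᵥ B *ᵥ p) * (f ⬝ᵥ B *ᵥ f) - (f ⬝ᵥ B *ᵥ p) * (p ⬝ᵥ B *ᵥ f) ≠ 0 := by
  by_contra! hcon
  obtain ⟨h1, h2, -⟩ := hcon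
  -- The component of `e` orthogonal to `p` would be in the radical.
  have h3 : (p ⬝ᵥ B *ᵥ p) • e - (e ⬝ᵥ B *ᵥ p) • p = 0 := by
    apply hinj
    refine eq_zero_of_frame h ?_ ?_ ?_
    · simp only [Matrix.mulVec_sub, Matrix.mulVec_smul, dotProduct_sub, dotProduct_smul,
        smul_eq_mul]
      rw [hB.dotProduct_mulVec_comm p e] at h1
      exact h1
    · simp only [Matrix.mulVec_sub, Matrix.mulVec_smul, dotProduct_sub, dotProduct_smul,
        smul_eq_mul, hB.dotProduct_mulVec_comm f]
      exact h2
    · simp only [Matrix.mulVec_sub, Matrix.mulVec_smul, dotProduct_sub, dotProduct_smul,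
        smul_eq_mul, hB.dotProduct_mulVec_comm p e]
      ring
  have h4 := (linearIndependent_triple_iff.1 h) (p ⬝ᵥ B *ᵥ p) 0 (-(e ⬝ᵥ B *ᵥ p))
    (by rw [← h3]; module)
  exact hb h4.1

/-- A frame whose first two vectors are orthogonal to the nonabsolute point `p`. -/
theorem exists_orthogonal_frame {A₀ : Matrix (Fin 3) (Fin 3) F} {p : Fin 3 → F}
    (ha : p ⬝ᵥ A₀ *ᵥ p ≠ 0) :
    ∃ e f : Fin 3 → F, LinearIndependent F ![e, f, p] ∧ e ⬝ᵥ A₀ *ᵥ p = 0 ∧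
      f ⬝ᵥ A₀ *ᵥ p = 0 := by
  have hp : p ≠ 0 := by
    rintro rfl
    simp at ha
  obtain ⟨e, f, h⟩ := exists_frame hp
  have h' := linearIndependent_triple_iff.1 h
  refine ⟨e - ((e ⬝ᵥ A₀ *ᵥ p) / (p ⬝ᵥ A₀ *ᵥ p)) • p, f - ((f ⬝ᵥ A₀ *ᵥ p) / (p ⬝ᵥ A₀ *ᵥ p)) • p,
    linearIndependent_triple_iff.2 fun a b c habc => ?_, ?_, ?_⟩
  · obtain ⟨h1, h2, h3⟩ := h' a b (c - a * ((e ⬝ᵥ A₀ *ᵥ p) / (p ⬝ᵥ A₀ *ᵥ p)) -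
      b * ((f ⬝ᵥ A₀ *ᵥ p) / (p ⬝ᵥ A₀ *ᵥ p))) (by rw [← habc]; module)
    refine ⟨h1, h2, ?_⟩
    rw [h1, h2] at h3
    simpa using h3
  · rw [sub_dotProduct, smul_dotProduct, smul_eq_mul]
    field_simp
    ring
  · rw [sub_dotProduct, smul_dotProduct, smul_eq_mul]
    field_simp
    ring

variable [Fintype F]

/-- The requirements on the frame at a point `p`: nothing if the point is exceptional, and otherwise
that the frame is orthogonal and that its spread avoids the regulus. -/
def IsSuitable (A₀ : Matrix (Fin 3) (Fin 3) F) {p : Fin 3 → F} (D : FieldFrame F p) : Prop :=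
  leftPoint p ∉ exceptionalPoints (rowSpace A₀) →
    D.e ⬝ᵥ A₀ *ᵥ p = 0 ∧ D.f ⬝ᵥ A₀ *ᵥ p = 0 ∧ Avoids A₀ p D.e D.f D.v D.w

variable {A₀ : Matrix (Fin 3) (Fin 3) F} (hA : A₀.IsSymm)
include hA

theorem dotProduct_ne_zero_of_notMem {p : Fin 3 → F} (hp : p ≠ 0)
    (h : leftPoint p ∉ exceptionalPoints (rowSpace A₀)) : p ⬝ᵥ A₀ *ᵥ p ≠ 0 :=
  fun h0 => h (Or.inl ((leftPoint_mem_absolutePoints hA hp).2 h0))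

theorem FieldFrame.admissible_of_isSuitable {p : Fin 3 → F} (D : FieldFrame F p)
    (hD : IsSuitable A₀ D) (hex : leftPoint p ∉ exceptionalPoints (rowSpace A₀)) :
    D.space = (perp (leftPoint p) ⊓ planeOne F 3) ⊔ polarLine (rowSpace A₀) (leftPoint p) ∧
      IsDesarguesian D.space D.lines ∧
      D.lines ∩ {l | ∃ U ∈ regulus A₀, l = D.space ⊓ U} =
        {D.space ⊓ planeOne F 3, D.space ⊓ planeTwo F 3} := by
  obtain ⟨he, hf, hav⟩ := hD hex
  have ha := dotProduct_ne_zero_of_notMem hA D.point_ne_zero hex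
  refine ⟨?_, D.isDesarguesian, ?_⟩
  · ext x
    rw [← Sum.elim_comp_inl_inr x, mem_localSpace hA, D.elim_mem_space, and_congr_left_iff]
    intro _
    constructor
    · rintro ⟨a, b, hab⟩
      rw [← hab]
      simp [he, hf]
    · intro hx
      obtain ⟨a, b, c, habc⟩ := exists_coords_of_frame D.linearIndependent (x ∘ Sum.inl)
      rw [habc] at hx
      simp only [add_dotProduct, smul_dotProduct, he, hf, smul_eq_mul, mul_zero, add_zero,
        zero_add] at hx
      exact ⟨a, b, by rw [habc, (mul_eq_zero.1 hx).resolve_right ha]; simp⟩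
  · ext l
    constructor
    · rintro ⟨hl, U, rfl | ⟨c, rfl⟩, rfl⟩
      · exact Or.inl rfl
      · by_cases hc : c = 0
        · subst hc
          right
          simp [planeTwo]
        · exfalso
          have hpe : p ⬝ᵥ A₀ *ᵥ D.e = 0 := by rw [hA.dotProduct_mulVec_comm, he]
          have h1 := D.linear_relation_of_mem_lines (hA.smul c) (by
            rw [Matrix.smul_mulVec, dotProduct_smul, hpe, smul_zero]) hl
          simp only [Matrix.smul_mulVec, dotProduct_smul, smul_eq_mul] at h1
          apply hav
          rw [he, hf]
          apply mul_left_cancel₀ hc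
          linear_combination (p ⬝ᵥ A₀ *ᵥ p) * h1
    · rintro (rfl | rfl)
      · exact ⟨D.space_inf_planeOne_mem, _, Or.inl rfl, rfl⟩
      · exact ⟨D.space_inf_planeTwo_mem, _, Or.inr ⟨0, rfl⟩, by simp [planeTwo]⟩

/-- Suitable frames at all points, with any additional property `R`, give admissible choices. -/
theorem exists_isAdmissible_of_frames (R : ∀ p : Fin 3 → F, FieldFrame F p → Prop)
    (h : ∀ p : Fin 3 → F, p ≠ 0 → ∃ D : FieldFrame F p, IsSuitable A₀ D ∧ R p D) :
    ∃ S 𝓕, IsAdmissible (rowSpace A₀) (regulus A₀) S 𝓕 ∧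
      ∀ P ∈ pointsOf (planeTwo F 3), ∃ (p : Fin 3 → F) (D : FieldFrame F p), P = leftPoint p ∧
        R p D ∧ S P = D.space ∧ 𝓕 P = D.lines := by
  have hex : ∀ P : Submodule F (AmbientSpace F 3), ∃ (S : Submodule F (AmbientSpace F 3))
      (𝓕 : Set (Submodule F (AmbientSpace F 3))), P ∈ pointsOf (planeTwo F 3) →
      ∃ (p : Fin 3 → F) (D : FieldFrame F p), P = leftPoint p ∧ IsSuitable A₀ D ∧ R p D ∧
        S = D.space ∧ 𝓕 = D.lines := by
    intro P
    by_cases hP : P ∈ pointsOf (planeTwo F 3)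
    · obtain ⟨p, hp, rfl⟩ := mem_pointsOf_planeTwo.1 hP
      obtain ⟨D, hD, hR⟩ := h p hp
      exact ⟨D.space, D.lines, fun _ => ⟨p, D, rfl, hD, hR, rfl, rfl⟩⟩
    · exact ⟨⊥, ∅, fun h => absurd h hP⟩
  choose S 𝓕 hS𝓕 using hex
  refine ⟨S, 𝓕, ⟨fun P hP => ?_, fun P hP hPex => ?_⟩, fun P hP => ?_⟩
  · obtain ⟨p, D, hPp, -, -, h1, h2⟩ := hS𝓕 P hP
    rw [h1, h2, hPp]
    exact D.isLocalChoice
  · obtain ⟨p, D, hPp, hD, -, h1, h2⟩ := hS𝓕 P hP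
    rw [h1, h2]
    rw [hPp] at hPex ⊢
    exact D.admissible_of_isSuitable hA hD hPex
  · obtain ⟨p, D, hPp, -, hR, h1, h2⟩ := hS𝓕 P hP
    exact ⟨p, D, hPp, hR, h1, h2⟩

theorem exists_isSuitable (hq : 2 < Fintype.card F) (hinj : ∀ x, A₀ *ᵥ x = 0 → x = 0)
    {p : Fin 3 → F} (hp : p ≠ 0) : ∃ D : FieldFrame F p, IsSuitable A₀ D := by
  classical
  by_cases hex : leftPoint p ∈ exceptionalPoints (rowSpace A₀)
  · obtain ⟨e, f, h⟩ := exists_frame hp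
    obtain ⟨v, w, hvw, -⟩ := exists_irreducible_pair hq (α := (1 : F)) (β := 0) (γ := 0)
      (Or.inl one_ne_zero)
    obtain ⟨D, -⟩ := exists_fieldFrame h hvw
    exact ⟨D, fun h => absurd hex h⟩
  · have ha := dotProduct_ne_zero_of_notMem hA hp hex
    obtain ⟨e, f, h, he, hf⟩ := exists_orthogonal_frame ha
    obtain ⟨v, w, hvw, hne⟩ := exists_irreducible_pair hq (restriction_ne_zero hA hinj h ha)
    obtain ⟨D, rfl, rfl, rfl, rfl⟩ := exists_fieldFrame h hvw
    exact ⟨D, fun _ => ⟨he, hf, hne⟩⟩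

/-- Frames that avoid a second matrix `B` as well; the hypothesis is about the points where both
matrices impose a condition. -/
theorem exists_isSuitable_avoids (hq : 2 < Fintype.card F) (hinj : ∀ x, A₀ *ᵥ x = 0 → x = 0)
    {B : Matrix (Fin 3) (Fin 3) F} (hB : B.IsSymm) (hBinj : ∀ x, B *ᵥ x = 0 → x = 0)
    (hboth : ∀ p : Fin 3 → F, p ⬝ᵥ A₀ *ᵥ p ≠ 0 → p ⬝ᵥ B *ᵥ p ≠ 0 → ∃ D : FieldFrame F p,
      D.e ⬝ᵥ A₀ *ᵥ p = 0 ∧ D.f ⬝ᵥ A₀ *ᵥ p = 0 ∧ Avoids A₀ p D.e D.f D.v D.w ∧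
        Avoids B p D.e D.f D.v D.w)
    {p : Fin 3 → F} (hp : p ≠ 0) :
    ∃ D : FieldFrame F p, IsSuitable A₀ D ∧
      (p ⬝ᵥ B *ᵥ p ≠ 0 → Avoids B p D.e D.f D.v D.w) := by
  classical
  by_cases hb : p ⬝ᵥ B *ᵥ p = 0
  · obtain ⟨D, hD⟩ := exists_isSuitable hA hq hinj hp
    exact ⟨D, hD, fun h => absurd hb h⟩
  by_cases hex : leftPoint p ∈ exceptionalPoints (rowSpace A₀)
  · obtain ⟨e, f, h⟩ := exists_frame hp
    obtain ⟨v, w, hvw, hne⟩ := exists_irreducible_pair hq (restriction_ne_zero hB hBinj h hb)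
    obtain ⟨D, rfl, rfl, rfl, rfl⟩ := exists_fieldFrame h hvw
    exact ⟨D, fun h => absurd hex h, fun _ => hne⟩
  · obtain ⟨D, he, hf, h1, h2⟩ := hboth p (dotProduct_ne_zero_of_notMem hA hp hex) hb
    exact ⟨D, fun _ => ⟨he, hf, h1⟩, fun _ => h2⟩

theorem exists_avoids_both (hq : 3 < Fintype.card F) (hinj : ∀ x, A₀ *ᵥ x = 0 → x = 0)
    {B : Matrix (Fin 3) (Fin 3) F} (hB : B.IsSymm) (hBinj : ∀ x, B *ᵥ x = 0 → x = 0)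
    {p : Fin 3 → F} (ha : p ⬝ᵥ A₀ *ᵥ p ≠ 0) (hb : p ⬝ᵥ B *ᵥ p ≠ 0) : ∃ D : FieldFrame F p,
      D.e ⬝ᵥ A₀ *ᵥ p = 0 ∧ D.f ⬝ᵥ A₀ *ᵥ p = 0 ∧ Avoids A₀ p D.e D.f D.v D.w ∧
        Avoids B p D.e D.f D.v D.w := by
  classical
  obtain ⟨e, f, h, he, hf⟩ := exists_orthogonal_frame ha
  obtain ⟨v, w, hvw, hne, hne'⟩ := exists_irreducible_pair_two hq
    (restriction_ne_zero hA hinj h ha) (restriction_ne_zero hB hBinj h hb)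
  obtain ⟨D, rfl, rfl, rfl, rfl⟩ := exists_fieldFrame h hvw
  exact ⟨D, he, hf, hne, hne'⟩

end Existence

/-! ### A plane code with `q⁴ + q³ + 1` elements -/

section LargeCode

variable {F : Type*} [Field F]

variable (F) in
/-- A symmetric matrix, nonsingular over every field, whose multiples are at rank distance at least
two from the scalar matrices. -/
def extraMatrix : Matrix (Fin 3) (Fin 3) F := !![0, 1, 0; 1, 1, 0; 0, 0, -1]

theorem extraMatrix_isSymm : (extraMatrix F).IsSymm := by
  ext i j
  fin_cases i <;> fin_cases j <;> rfl

theorem extraMatrix_injective (x : Fin 3 → F) (hx : extraMatrix F *ᵥ x = 0) : x = 0 := by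
  have h0 := congrFun hx 0
  have h1 := congrFun hx 1
  have h2 := congrFun hx 2
  simp [extraMatrix, Matrix.mulVec, dotProduct, Fin.sum_univ_three] at h0 h1 h2
  rw [h0, add_zero] at h1
  ext i
  fin_cases i <;> assumption

theorem not_rank_sub_extraMatrix_le_one (d : F) {c : F} (hc : c ≠ 0) :
    ¬ (d • (1 : Matrix (Fin 3) (Fin 3) F) - c • extraMatrix F).rank ≤ 1 := by
  intro hr
  have h := fun i j k l : Fin 3 => Matrix.dotProduct_mulVec_exchange hr
    (Pi.single i 1) (Pi.single j 1) (Pi.single k 1) (Pi.single l 1)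
  have h1 := h 0 1 2 2
  have h2 := h 0 0 1 1
  simp [extraMatrix] at h1 h2
  have h3 : d = -c := by
    have := h1.resolve_left hc
    linear_combination this
  rw [h3] at h2
  have : c * c = 0 := by linear_combination h2
  exact hc (mul_self_eq_zero.1 this)

theorem Avoids.smul {B : Matrix (Fin 3) (Fin 3) F} {p e f : Fin 3 → F} {v w s : F}
    (h : Avoids B p e f v w) (hs : s ≠ 0) : Avoids B (s • p) e f v w := by
  unfold Avoids at h ⊢
  simp only [Matrix.mulVec_smul, dotProduct_smul, smul_dotProduct, smul_eq_mul]
  intro h0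
  refine h (mul_left_cancel₀ (mul_ne_zero hs hs) ?_)
  linear_combination h0

variable [Fintype F]

/-- The field with three elements: up to sign, five points are nonabsolute for both matrices, and
the polynomial `t² + 1` serves for all of them. -/
theorem exists_avoids_both_of_card_eq_three (hq : Fintype.card F = 3) {p : Fin 3 → F}
    (ha : p ⬝ᵥ (1 : Matrix (Fin 3) (Fin 3) F) *ᵥ p ≠ 0) (hb : p ⬝ᵥ extraMatrix F *ᵥ p ≠ 0) :
    ∃ D : FieldFrame F p, D.e ⬝ᵥ (1 : Matrix (Fin 3) (Fin 3) F) *ᵥ p = 0 ∧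
      D.f ⬝ᵥ (1 : Matrix (Fin 3) (Fin 3) F) *ᵥ p = 0 ∧
      Avoids (1 : Matrix (Fin 3) (Fin 3) F) p D.e D.f D.v D.w ∧
      Avoids (extraMatrix F) p D.e D.f D.v D.w := by
  have h3 : (3 : F) = 0 := by
    have := FiniteField.cast_card_eq_zero F
    rw [hq] at this
    exact_mod_cast this
  have h2 : (2 : F) ≠ 0 := fun h => one_ne_zero (α := F) (by linear_combination h3 - h)
  have h4 : (4 : F) ≠ 0 := fun h => one_ne_zero (α := F) (by linear_combination h - h3)
  have h8 : (8 : F) ≠ 0 := fun h => one_ne_zero (α := F) (by linear_combination 3 * h3 - h)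
  have hall : ∀ t : F, t = 0 ∨ t = 1 ∨ t = -1 := by
    intro t
    have h1 := FiniteField.pow_card t
    rw [hq] at h1
    have h2 : t * ((t - 1) * (t + 1)) = 0 := by linear_combination h1
    exact (mul_eq_zero.1 h2).imp id fun h => (mul_eq_zero.1 h).imp sub_eq_zero.1
      eq_neg_of_add_eq_zero_left
  have hirr : ∀ t : F, t ^ 2 ≠ 0 * t + -1 := by
    intro t ht
    rcases hall t with rfl | rfl | rfl
    · exact one_ne_zero (α := F) (by linear_combination ht)
    · exact h2 (by linear_combination ht)
    · exact h2 (by linear_combination ht)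
  have key : ∀ (s : F) (p₀ e f : Fin 3 → F), p = s • p₀ → (Matrix.of ![e, f, p₀]).det ≠ 0 →
      e ⬝ᵥ p₀ = 0 → f ⬝ᵥ p₀ = 0 → Avoids (1 : Matrix (Fin 3) (Fin 3) F) p₀ e f 0 1 →
      Avoids (extraMatrix F) p₀ e f 0 1 →
      ∃ D : FieldFrame F p, D.e ⬝ᵥ (1 : Matrix (Fin 3) (Fin 3) F) *ᵥ p = 0 ∧
        D.f ⬝ᵥ (1 : Matrix (Fin 3) (Fin 3) F) *ᵥ p = 0 ∧
        Avoids (1 : Matrix (Fin 3) (Fin 3) F) p D.e D.f D.v D.w ∧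
        Avoids (extraMatrix F) p D.e D.f D.v D.w := by
    rintro s p₀ e f rfl hdet he hf h1 h2
    have hs : s ≠ 0 := by
      rintro rfl
      simp at ha
    have hli : LinearIndependent F ![e, f, p₀] := Matrix.linearIndependent_rows_of_det_ne_zero hdet
    have hli' : LinearIndependent F ![e, f, s • p₀] := by
      rw [linearIndependent_triple_iff] at hli ⊢
      intro a b c habc
      obtain ⟨h1, h2, h3⟩ := hli a b (c * s) (by rw [← habc, mul_smul])
      exact ⟨h1, h2, (mul_eq_zero.1 h3).resolve_right hs⟩
    obtain ⟨D, rfl, rfl, hv, hw⟩ := exists_fieldFrame hli' hirr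
    rw [← hv, ← hw] at h1 h2
    refine ⟨D, ?_, ?_, h1.smul hs, h2.smul hs⟩ <;> simp [he, hf]
  have hp : p = ![p 0, p 1, p 2] := by ext i; fin_cases i <;> rfl
  have ha' : p 0 * p 0 + p 1 * p 1 + p 2 * p 2 ≠ 0 := by
    simpa [dotProduct, Fin.sum_univ_three] using ha
  have hb' : 2 * (p 0 * p 1) + p 1 * p 1 - p 2 * p 2 ≠ 0 := by
    intro h
    apply hb
    simp [extraMatrix, Matrix.mulVec, dotProduct, Fin.sum_univ_three]
    linear_combination h
  have hcase : ∃ s : F, p = s • ![0, 1, 0] ∨ p = s • ![0, 0, 1] ∨ p = s • ![1, -1, 0] ∨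
      p = s • ![1, 0, 1] ∨ p = s • ![1, 0, -1] := by
    rw [hp]
    generalize p 0 = x, p 1 = y, p 2 = z at ha' hb'
    rcases hall x with rfl | rfl | rfl <;> rcases hall y with rfl | rfl | rfl <;>
      rcases hall z with rfl | rfl | rfl <;>
      first
      | (exfalso; apply ha'; ring1)
      | (exfalso; apply ha'; linear_combination h3)
      | (exfalso; apply hb'; ring1)
      | (exfalso; apply hb'; linear_combination h3)
      | (refine ⟨1, ?_⟩; solve | simp)
      | (refine ⟨-1, ?_⟩; solve | simp)
  rcases hcase with ⟨s, h | h | h | h | h⟩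
  on_goal 1 => refine key s _ ![0, 0, 1] ![1, 0, 0] h ?_ ?_ ?_ ?_ ?_
  on_goal 6 => refine key s _ ![0, 1, 0] ![1, 0, 0] h ?_ ?_ ?_ ?_ ?_
  on_goal 11 => refine key s _ ![0, 0, 1] ![1, 1, 1] h ?_ ?_ ?_ ?_ ?_
  on_goal 16 => refine key s _ ![0, 1, 0] ![1, 1, -1] h ?_ ?_ ?_ ?_ ?_
  on_goal 21 => refine key s _ ![0, 1, 0] ![1, 1, 1] h ?_ ?_ ?_ ?_ ?_
  all_goals simp [Avoids, extraMatrix, Matrix.det_fin_three, Matrix.mulVec, dotProduct,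
    Fin.sum_univ_three]
  all_goals
    intro h
    first
    | (apply h2; linear_combination h)
    | (apply h2; linear_combination -h)
    | (apply h4; linear_combination h)
    | (apply h8; linear_combination h)
    | (apply h8; linear_combination -h)

omit [Fintype F] in
/-- A spread that avoids the nonsingular symmetric matrix `B` gives generators at rank distance at
least two from the multiples of `B`. -/
theorem FieldFrame.not_rank_sub_smul_le_one {p : Fin 3 → F} (D : FieldFrame F p)
    {A B : Matrix (Fin 3) (Fin 3) F} (hA : A.IsSymm) (hB : B.IsSymm)
    (hBinj : ∀ x, B *ᵥ x = 0 → x = 0)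
    (hD : p ⬝ᵥ B *ᵥ p ≠ 0 → Avoids B p D.e D.f D.v D.w)
    (hU : rowSpace A ∈ generatorsThrough (leftPoint p) D.space D.lines) {c : F} (hc : c ≠ 0) :
    ¬ (A - c • B).rank ≤ 1 := by
  intro hr
  have hAp : A *ᵥ p = 0 := (leftPoint_le_rowSpace_iff hA).1 hU.2.1
  have hb := dotProduct_self_ne_zero_of_rank_le_one hA hB hBinj D.point_ne_zero hAp hc hr
  have hrel := mul_dotProduct_of_rank_le_one hA hAp hc hr
  have h1 := D.linear_relation_of_mem_lines hA
    (by rw [hA.dotProduct_mulVec_comm, hAp, dotProduct_zero])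
    (inf_mem_of_mem_generatorsThrough hU).1
  apply hD hb
  apply mul_left_cancel₀ hc
  linear_combination (p ⬝ᵥ B *ᵥ p) * h1 - hrel D.e D.e - D.v * hrel D.e D.f - D.w * hrel D.f D.f

/-- The points of `Π₂` have spreads that are admissible for the regulus of the identity matrix and
avoid `extraMatrix`. -/
theorem exists_isAdmissible_one (hq : 2 < Fintype.card F) :
    ∃ S 𝓕, IsAdmissible (rowSpace (1 : Matrix (Fin 3) (Fin 3) F)) (regulus 1) S 𝓕 ∧
      ∀ P ∈ pointsOf (planeTwo F 3), ∃ (p : Fin 3 → F) (D : FieldFrame F p), P = leftPoint p ∧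
        (p ⬝ᵥ extraMatrix F *ᵥ p ≠ 0 → Avoids (extraMatrix F) p D.e D.f D.v D.w) ∧
        S P = D.space ∧ 𝓕 P = D.lines := by
  have hinj : ∀ x : Fin 3 → F, (1 : Matrix (Fin 3) (Fin 3) F) *ᵥ x = 0 → x = 0 := by simp
  refine exists_isAdmissible_of_frames Matrix.isSymm_one
    (fun p D => p ⬝ᵥ extraMatrix F *ᵥ p ≠ 0 → Avoids (extraMatrix F) p D.e D.f D.v D.w)
    fun p hp => ?_
  refine exists_isSuitable_avoids Matrix.isSymm_one hq hinj extraMatrix_isSymm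
    extraMatrix_injective (fun p ha hb => ?_) hp
  rcases Nat.lt_or_ge 3 (Fintype.card F) with h3 | h3
  · exact exists_avoids_both Matrix.isSymm_one h3 hinj extraMatrix_isSymm extraMatrix_injective
      ha hb
  · exact exists_avoids_both_of_card_eq_three (by lia) ha hb

/-- The set `barX` for the identity matrix can be chosen so that two multiples of `extraMatrix` can
be added to it. -/
theorem exists_isPlaneCode (hq : 2 < Fintype.card F) :
    ∃ 𝒳 : Set (Submodule F (AmbientSpace F 3)), IsPlaneCode 𝒳 ∧
      𝒳.ncard = Fintype.card F ^ 4 + Fintype.card F ^ 3 + 1 ∧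
      ∃ A : Matrix (Fin 3) (Fin 3) F, A.IsSymm ∧ A.rank = 2 ∧ planeTwo F 3 ∈ 𝒳 ∧
        rowSpace A ∈ 𝒳 := by
  classical
  have hinj : ∀ x : Fin 3 → F, (1 : Matrix (Fin 3) (Fin 3) F) *ᵥ x = 0 → x = 0 := by simp
  obtain ⟨S, 𝓕, hadm, hfr⟩ := exists_isAdmissible_one (F := F) hq
  have hcode := isPlaneCode_barX Matrix.isSymm_one hinj hadm
  have hcard := ncard_barX Matrix.isSymm_one hinj hadm
  obtain ⟨μ, hμ0, hμ1⟩ : ∃ μ : F, μ ≠ 0 ∧ μ ≠ 1 := by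
    obtain ⟨μ, -, hμ⟩ := Finset.exists_mem_notMem_of_card_lt_card
      (s := ({0, 1} : Finset F)) (t := Finset.univ)
      (Finset.card_le_two.trans_lt (by rwa [Finset.card_univ]))
    exact ⟨μ, by simpa [not_or] using hμ⟩
  have hBs : ∀ c : F, (c • extraMatrix F).IsSymm := fun c => extraMatrix_isSymm.smul c
  have hdist : ∀ U ∈ barX (regulus (1 : Matrix (Fin 3) (Fin 3) F)) S 𝓕, ∀ c : F, c ≠ 0 →
      finrank F ↥(U ⊓ rowSpace (c • extraMatrix F)) ≤ 1 := by
    intro U hU c hc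
    obtain ⟨A, hAs, rfl, ⟨p, hp, -, -, hg⟩ | ⟨d, rfl⟩⟩ :=
      exists_matrix_of_mem_barX Matrix.isSymm_one hadm hU
    · refine finrank_rowSpace_inf_le_one ?_
      obtain ⟨p', D, hpp, hD, hS, h𝓕⟩ := hfr _ (mem_pointsOf_planeTwo.2 ⟨p, hp, rfl⟩)
      rw [hS, h𝓕, hpp] at hg
      exact D.not_rank_sub_smul_le_one hAs extraMatrix_isSymm extraMatrix_injective hD hg hc
    · exact finrank_rowSpace_inf_le_one (not_rank_sub_extraMatrix_le_one d hc)
  have hpair : finrank F ↥(rowSpace ((1 : F) • extraMatrix F) ⊓ rowSpace (μ • extraMatrix F)) ≤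
      1 := by
    refine finrank_rowSpace_inf_le_one ?_
    rw [← sub_smul, rank_eq_three_of_injective]
    · lia
    · intro x hx
      rw [Matrix.smul_mulVec] at hx
      exact extraMatrix_injective x ((smul_eq_zero.1 hx).resolve_left (sub_ne_zero.2 hμ1.symm))
  have hnot : ∀ c : F, c ≠ 0 → rowSpace (c • extraMatrix F) ∉
      barX (regulus (1 : Matrix (Fin 3) (Fin 3) F)) S 𝓕 := by
    intro c hc hmem
    have h1 := hdist _ hmem c hc
    rw [inf_idem, finrank_rowSpace] at h1
    lia
  have hne : rowSpace ((1 : F) • extraMatrix F) ≠ rowSpace (μ • extraMatrix F) := by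
    intro h
    rw [h, inf_idem, finrank_rowSpace] at hpair
    lia
  have hplane : ∀ c : F, IsGenerator (rowSpace (c • extraMatrix F)) ∧
      finrank F (rowSpace (c • extraMatrix F)) = 3 ∧
      Disjoint (rowSpace (c • extraMatrix F)) (planeOne F 3) := fun c =>
    ⟨isGenerator_rowSpace (hBs c), finrank_rowSpace _, disjoint_rowSpace_planeOne _⟩
  refine ⟨barX (regulus 1) S 𝓕 ∪ {rowSpace ((1 : F) • extraMatrix F),
    rowSpace (μ • extraMatrix F)}, ⟨?_, ?_⟩, ?_, ?_⟩
  · rintro U (hU | rfl | rfl)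
    · exact hcode.1 U hU
    · exact hplane 1
    · exact hplane μ
  · rintro U (hU | rfl | rfl) U' (hU' | rfl | rfl) hUU'
    · exact hcode.2 U hU U' hU' hUU'
    · exact hdist U hU 1 one_ne_zero
    · exact hdist U hU μ hμ0
    · rw [inf_comm]
      exact hdist U' hU' 1 one_ne_zero
    · exact absurd rfl hUU'
    · exact hpair
    · rw [inf_comm]
      exact hdist U' hU' μ hμ0
    · rw [inf_comm]
      exact hpair
    · exact absurd rfl hUU'
  · rw [Set.ncard_union_eq, hcard, Set.ncard_pair hne]
    · have : 1 ≤ Fintype.card F ^ 4 := Nat.one_le_pow _ _ (by lia)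
      lia
    · rw [Set.disjoint_right]
      rintro U (rfl | rfl)
      · exact hnot 1 one_ne_zero
      · exact hnot μ hμ0
  · have hp : Pi.single 0 1 ≠ (0 : Fin 3 → F) := by simp
    have hP : leftPoint (Pi.single 0 1 : Fin 3 → F) ∈ pointsOf (planeTwo F 3) :=
      mem_pointsOf_planeTwo.2 ⟨_, hp, rfl⟩
    have hloc := hadm.1 _ hP
    obtain ⟨U, hU⟩ : (generatorsThrough (leftPoint (Pi.single 0 1 : Fin 3 → F)) (S (leftPoint
        (Pi.single 0 1))) (𝓕 (leftPoint (Pi.single 0 1)))).Nonempty := by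
      rw [← Set.ncard_pos, ncard_generatorsThrough hp hloc]
      have : 2 ^ 2 ≤ Fintype.card F ^ 2 := Nat.pow_le_pow_left hq.le 2
      lia
    obtain ⟨A, hAs, rfl, -⟩ := exists_matrix_of_mem_generatorsThrough hp hloc hU
    refine ⟨A, hAs, ?_, Or.inl (Or.inr ⟨Or.inr ⟨0, ?_⟩, ?_⟩), Or.inl (Or.inl ?_)⟩
    · have h1 := inf_planeTwo_of_mem_generatorsThrough hp hloc hU
      have h2 := finrank_rowSpace_inf_add_rank A 0
      change finrank F ↥(rowSpace A ⊓ planeTwo F 3) + _ = 3 at h2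
      rw [h1, finrank_leftPoint hp, sub_zero] at h2
      lia
    · simp [planeTwo]
    · intro h
      have h1 := disjoint_rowSpace_planeOne (0 : Matrix (Fin 3) (Fin 3) F)
      have h2 := finrank_rowSpace (0 : Matrix (Fin 3) (Fin 3) F)
      rw [show rowSpace (0 : Matrix (Fin 3) (Fin 3) F) = planeOne F 3 from h] at h1 h2
      rw [disjoint_self.1 h1, finrank_bot] at h2
      lia
    · exact Set.mem_biUnion hP hU

omit [Fintype F] in
/-- A plane code in which two planes meet in a point corresponds to a `2`-code. -/
theorem IsPlaneCode.isSymmCode {𝒳 : Set (Submodule F (AmbientSpace F 3))} (h : IsPlaneCode 𝒳)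
    {A : Matrix (Fin 3) (Fin 3) F} (hA : A.IsSymm) (hr : A.rank = 2) (h0 : planeTwo F 3 ∈ 𝒳)
    (hA' : rowSpace A ∈ 𝒳) :
    IsSymmCode 2 {A : Matrix (Fin 3) (Fin 3) F | A.IsSymm ∧ rowSpace A ∈ 𝒳} := by
  refine ⟨fun A hA => hA.1, ⟨A, ⟨hA, hA'⟩, 0, ⟨Matrix.isSymm_zero, h0⟩, ?_, by rw [sub_zero, hr]⟩,
    ?_⟩
  · rintro rfl
    simp at hr
  · rintro r ⟨B, ⟨-, hB⟩, C, ⟨-, hC⟩, hne, rfl⟩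
    have h1 := h.2 _ hB _ hC (rowSpace_injective.ne hne)
    have h2 := finrank_rowSpace_inf_add_rank B C
    lia

omit [Fintype F] in
theorem IsPlaneCode.ncard_preimage {𝒳 : Set (Submodule F (AmbientSpace F 3))}
    (h : IsPlaneCode 𝒳) :
    {A : Matrix (Fin 3) (Fin 3) F | A.IsSymm ∧ rowSpace A ∈ 𝒳}.ncard = 𝒳.ncard := by
  rw [← Set.ncard_image_of_injective _ rowSpace_injective]
  congr 1
  ext U
  constructor
  · rintro ⟨A, hA, rfl⟩
    exact hA.2
  · intro hU
    obtain ⟨hg, -, hd⟩ := h.1 U hU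
    obtain ⟨A, hA, rfl⟩ := exists_rowSpace_eq hg hd
    exact ⟨A, ⟨hA, hU⟩, rfl⟩

end LargeCode

/-! ### Zeros of ternary quadratic forms -/

section QuadraticForms

variable {F : Type*} [Field F] [Fintype F]

theorem exists_ne_zero_dotProduct_mulVec_eq_zero (C : Matrix (Fin 3) (Fin 3) F) :
    ∃ u : Fin 3 → F, u ≠ 0 ∧ u ⬝ᵥ C *ᵥ u = 0 := by
  classical
  let f : MvPolynomial (Fin 3) F :=
    ∑ i, ∑ j, MvPolynomial.C (C i j) * (MvPolynomial.X i * MvPolynomial.X j)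
  have hf : ∀ x, MvPolynomial.eval x f = x ⬝ᵥ C *ᵥ x := by
    intro x
    simp only [f, map_sum, map_mul, MvPolynomial.eval_C, MvPolynomial.eval_X, dotProduct,
      Matrix.mulVec, Finset.mul_sum]
    exact Finset.sum_congr rfl fun i _ => Finset.sum_congr rfl fun j _ => by ring
  have hdeg : f.totalDegree < Fintype.card (Fin 3) := by
    rw [Fintype.card_fin, Nat.lt_succ_iff]
    refine MvPolynomial.totalDegree_finsetSum_le fun i _ =>
      MvPolynomial.totalDegree_finsetSum_le fun j _ => ?_
    refine (MvPolynomial.totalDegree_mul _ _).trans ?_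
    rw [MvPolynomial.totalDegree_C, zero_add]
    refine (MvPolynomial.totalDegree_mul _ _).trans ?_
    rw [MvPolynomial.totalDegree_X, MvPolynomial.totalDegree_X]
  obtain ⟨p, hp⟩ := CharP.exists F
  have hprime : p.Prime := CharP.char_prime_of_ne_zero F (CharP.char_ne_zero_of_finite F p)
  have hdvd := char_dvd_card_solutions p hdeg
  have hpos : 0 < Fintype.card {x : Fin 3 → F // MvPolynomial.eval x f = 0} :=
    Fintype.card_pos_iff.2 ⟨⟨0, by rw [hf]; simp⟩⟩
  have hlt := hprime.one_lt.trans_le (Nat.le_of_dvd hpos hdvd)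
  obtain ⟨x, hx⟩ := Fintype.exists_ne_of_one_lt_card hlt ⟨0, by rw [hf]; simp⟩
  exact ⟨x.1, fun h => hx (Subtype.ext h), by rw [← hf, x.2]⟩

/-- The affine equation `a + z b = 0` has one solution if `b ≠ 0`, and none or `q` otherwise. -/
theorem dvd_card_affine_zeros [DecidableEq F] (a b : F) :
    (Fintype.card F : ℤ) ∣
      ((Finset.univ.filter fun z : F => a + z * b = 0).card : ℤ) - if b = 0 then 0 else 1 := by
  by_cases hb : b = 0
  · by_cases ha : a = 0 <;> simp [ha, hb]
  · have h1 : (Finset.univ.filter fun z : F => a + z * b = 0) = {-a / b} := by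
      ext z
      simp only [Finset.mem_filter, Finset.mem_univ, true_and, Finset.mem_singleton]
      rw [eq_div_iff hb]
      constructor <;> intro h <;> linear_combination h
    simp [h1, hb]

theorem dvd_card_ne_zero [DecidableEq F] (b c : F) :
    Fintype.card F ∣ (Finset.univ.filter fun x : F × F => ¬ x.1 * b + x.2 * c = 0).card := by
  let φ : F × F →ₗ[F] F :=
    (LinearMap.fst F F F).smulRight b + (LinearMap.snd F F F).smulRight c
  have hφ : ∀ x, φ x = x.1 * b + x.2 * c := fun x => by simp [φ]
  have h1 : Fintype.card F ∣ (Finset.univ.filter fun x : F × F => x.1 * b + x.2 * c = 0).card := by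
    have h2 : (Finset.univ.filter fun x : F × F => x.1 * b + x.2 * c = 0).card =
        Nat.card (LinearMap.ker φ) := by
      rw [← Fintype.card_subtype, ← Nat.card_eq_fintype_card]
      exact Nat.card_congr (Equiv.subtypeEquivRight fun x => by rw [LinearMap.mem_ker, hφ])
    rw [h2, Module.natCard_eq_pow_finrank (K := F), Nat.card_eq_fintype_card]
    refine dvd_pow_self _ ?_
    have h3 := LinearMap.finrank_range_add_finrank_ker φ
    have h4 := Submodule.finrank_le (LinearMap.range φ)
    rw [finrank_prod, finrank_self] at h3
    rw [finrank_self] at h4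
    lia
  have h2 := Finset.card_filter_add_card_filter_not (s := Finset.univ)
    (fun x : F × F => x.1 * b + x.2 * c = 0)
  refine (Nat.dvd_add_right h1).1 ?_
  rw [h2, Finset.card_univ, Fintype.card_prod]
  exact Dvd.intro _ rfl

/-- A sharpening of the Chevalley–Warning theorem for ternary quadratic forms: the form is affine on
the lines parallel to a nontrivial zero. -/
theorem dvd_card_quadratic_zeros [DecidableEq F] (C : Matrix (Fin 3) (Fin 3) F) :
    Fintype.card F ∣ (Finset.univ.filter fun v : Fin 3 → F => v ⬝ᵥ C *ᵥ v = 0).card := by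
  obtain ⟨u, hu, hCu⟩ := exists_ne_zero_dotProduct_mulVec_eq_zero C
  obtain ⟨e, f, h⟩ := exists_frame hu
  let φ : (F × F) × F → (Fin 3 → F) := fun x => x.1.1 • e + x.1.2 • f + x.2 • u
  have hφ : Function.Bijective φ := by
    constructor
    · rintro ⟨⟨a, b⟩, c⟩ ⟨⟨a', b'⟩, c'⟩ hab
      obtain ⟨h1, h2, h3⟩ := linearIndependent_triple_iff.1 h (a - a') (b - b') (c - c') (by
        have : a • e + b • f + c • u = a' • e + b' • f + c' • u := hab
        rw [← sub_eq_zero] at this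
        rw [← this]
        module)
      rw [sub_eq_zero.1 h1, sub_eq_zero.1 h2, sub_eq_zero.1 h3]
    · intro x
      obtain ⟨a, b, c, rfl⟩ := exists_coords_of_frame h x
      exact ⟨((a, b), c), rfl⟩
  set b₁ := e ⬝ᵥ C *ᵥ u + u ⬝ᵥ C *ᵥ e with hb₁
  set b₂ := f ⬝ᵥ C *ᵥ u + u ⬝ᵥ C *ᵥ f with hb₂
  have hval : ∀ x z, φ (x, z) ⬝ᵥ C *ᵥ φ (x, z) =
      φ (x, 0) ⬝ᵥ C *ᵥ φ (x, 0) + z * (x.1 * b₁ + x.2 * b₂) := by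
    intro x z
    simp only [φ, Matrix.mulVec_add, Matrix.mulVec_smul, add_dotProduct, dotProduct_add,
      smul_dotProduct, dotProduct_smul, smul_eq_mul, hCu, hb₁, hb₂]
    ring
  have hcard : (Finset.univ.filter fun v : Fin 3 → F => v ⬝ᵥ C *ᵥ v = 0).card =
      ∑ x : F × F, (Finset.univ.filter fun z : F =>
        φ (x, 0) ⬝ᵥ C *ᵥ φ (x, 0) + z * (x.1 * b₁ + x.2 * b₂) = 0).card := by
    simp_rw [Finset.card_filter, ← hval]
    rw [← hφ.sum_comp, Fintype.sum_prod_type]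
  have hne : ((Finset.univ.filter fun x : F × F => ¬ x.1 * b₁ + x.2 * b₂ = 0).card : ℤ) =
      ∑ x : F × F, if x.1 * b₁ + x.2 * b₂ = 0 then 0 else 1 := by
    rw [Finset.card_filter]
    push_cast
    exact Finset.sum_congr rfl fun x _ => ite_not _ _ _
  have h1 : (Fintype.card F : ℤ) ∣
      ((Finset.univ.filter fun v : Fin 3 → F => v ⬝ᵥ C *ᵥ v = 0).card : ℤ) -
        ((Finset.univ.filter fun x : F × F => ¬ x.1 * b₁ + x.2 * b₂ = 0).card : ℤ) := by
    rw [hcard, hne, Nat.cast_sum, ← Finset.sum_sub_distrib]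
    exact Finset.dvd_sum fun x _ => dvd_card_affine_zeros _ _
  have h2 : (Fintype.card F : ℤ) ∣
      ((Finset.univ.filter fun x : F × F => ¬ x.1 * b₁ + x.2 * b₂ = 0).card : ℤ) :=
    Int.natCast_dvd_natCast.2 (dvd_card_ne_zero b₁ b₂)
  exact Int.natCast_dvd_natCast.1 ((dvd_sub_left h2).1 h1)

end QuadraticForms

/-! ### Additive codes -/

section AdditiveCodes

variable {F : Type*} [Field F]

/-- The indices of the entries of a symmetric matrix on and above the diagonal. -/
abbrev UpperIndex : Type := {k : Fin 3 × Fin 3 // k.1 ≤ k.2}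

/-- The upper triangular part of a matrix, as a vector. -/
def upperPart : Matrix (Fin 3) (Fin 3) F →ₗ[F] (UpperIndex → F) where
  toFun A k := A k.1.1 k.1.2
  map_add' _ _ := rfl
  map_smul' _ _ := rfl

theorem eq_of_upperPart_eq {A B : Matrix (Fin 3) (Fin 3) F} (hA : A.IsSymm) (hB : B.IsSymm)
    (h : upperPart A = upperPart B) : A = B := by
  ext i j
  rcases le_total i j with hij | hij
  · exact congrFun h ⟨(i, j), hij⟩
  · rw [← hA.apply i j, ← hB.apply i j]
    exact congrFun h ⟨(j, i), hij⟩

/-- The products `v i * v j`, `i ≤ j`: the upper triangular part of the matrix `vvᵀ`. -/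
def veronese (v : Fin 3 → F) : UpperIndex → F := upperPart (Matrix.vecMulVec v v)

theorem veronese_ne_zero {v : Fin 3 → F} (hv : v ≠ 0) : veronese v ≠ 0 := by
  obtain ⟨i, hi⟩ := Function.ne_iff.1 hv
  exact fun h => mul_ne_zero hi hi (congrFun h ⟨(i, i), le_rfl⟩)

/-- The linear forms in the products `v i * v j` are the quadratic forms in `v`. -/
theorem exists_dotProduct_veronese (c : UpperIndex → F) :
    ∃ C : Matrix (Fin 3) (Fin 3) F, ∀ v, c ⬝ᵥ veronese v = v ⬝ᵥ C *ᵥ v := by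
  let c' : Fin 3 × Fin 3 → F := fun k => if h : k.1 ≤ k.2 then c ⟨k, h⟩ else 0
  refine ⟨Matrix.of fun i j => c' (i, j), fun v => ?_⟩
  have h1 : c ⬝ᵥ veronese v = ∑ k : UpperIndex, c' k.1 * (v k.1.1 * v k.1.2) :=
    Finset.sum_congr rfl fun k _ => by
      rw [show c' k.1 = c k from dif_pos k.2]
      rfl
  rw [h1, ← Finset.sum_subtype (Finset.univ.filter fun k : Fin 3 × Fin 3 => k.1 ≤ k.2) (by simp)
    fun k => c' k * (v k.1 * v k.2), Finset.sum_filter_of_ne, Fintype.sum_prod_type]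
  · simp only [dotProduct, Matrix.mulVec, Matrix.of_apply, Finset.mul_sum]
    exact Finset.sum_congr rfl fun i _ => Finset.sum_congr rfl fun j _ => by ring
  · intro k _ hk
    by_contra h
    exact hk (by rw [show c' k = 0 from dif_neg h, zero_mul])

variable (K : Type*) [Field K] [Algebra K F]

/-- The bilinear form `(c, d) ↦ Tr (∑ cₖdₖ)` over a subfield. -/
noncomputable def traceDot : LinearMap.BilinForm K (UpperIndex → F) :=
  LinearMap.mk₂ K (fun c d => Algebra.trace K F (c ⬝ᵥ d))
    (fun _ _ _ => by rw [add_dotProduct, map_add])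
    (fun _ _ _ => by rw [smul_dotProduct, map_smul])
    (fun _ _ _ => by rw [dotProduct_add, map_add])
    (fun _ _ _ => by rw [dotProduct_smul, map_smul])

theorem traceDot_apply (c d : UpperIndex → F) :
    traceDot K c d = Algebra.trace K F (c ⬝ᵥ d) := rfl

theorem traceDot_isSymm : (traceDot K (F := F)).IsSymm :=
  ⟨fun c d => by rw [traceDot_apply, traceDot_apply, dotProduct_comm]⟩

variable [Finite F]

theorem traceDot_nondegenerate : (traceDot K (F := F)).Nondegenerate := by
  classical
  refine (LinearMap.IsRefl.nondegenerate_iff_separatingLeft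
    (B := traceDot K (F := F)) (traceDot_isSymm K).isRefl).2 fun c hc => ?_
  ext k
  refine (traceForm_nondegenerate K F).2 _ fun t => ?_
  have h1 := hc (Pi.single k t)
  rw [traceDot_apply, dotProduct_single, mul_comm] at h1
  exact h1

omit [Finite F] in
theorem finrank_restrictScalars_span {x : UpperIndex → F} (hx : x ≠ 0) :
    finrank K ((F ∙ x).restrictScalars K) = finrank K F :=
  LinearEquiv.finrank_eq
    ((LinearEquiv.toSpanNonzeroSingleton F (UpperIndex → F) x hx).restrictScalars K).symm

/-- The forms in the dual code that vanish at `v` make up the fraction `1 / q` of the dual code. -/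
theorem card_filter_orthogonal {D : Submodule K (UpperIndex → F)} {v : Fin 3 → F} (hv : v ≠ 0)
    (hD : ∀ t : F, t • veronese v ∈ D → t = 0) :
    Nat.card {c // c ∈ (traceDot K).orthogonal D ∧ c ⬝ᵥ veronese v = 0} =
      Nat.card K ^ (5 * finrank K F - finrank K D) ∧ finrank K D ≤ 5 * finrank K F := by
  set L := (F ∙ veronese v).restrictScalars K
  have hL : finrank K L = finrank K F := finrank_restrictScalars_span K (veronese_ne_zero hv)
  have hdisj : D ⊓ L = ⊥ := by
    rw [eq_bot_iff]
    rintro x ⟨h1, h2⟩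
    obtain ⟨t, rfl⟩ := Submodule.mem_span_singleton.1 h2
    rw [hD t h1, zero_smul]
    exact Submodule.zero_mem _
  have hsup := Submodule.finrank_sup_add_finrank_inf_eq D L
  rw [hdisj, finrank_bot, add_zero, hL] at hsup
  have hW : finrank K (UpperIndex → F) = 6 * finrank K F := by
    rw [Module.finrank_pi_fintype, Finset.sum_const, Finset.card_univ]
    rfl
  have hle := Submodule.finrank_le (D ⊔ L)
  have horth := LinearMap.BilinForm.finrank_orthogonal (traceDot_nondegenerate K) (D ⊔ L)
  have h1 : Nat.card {c // c ∈ (traceDot K).orthogonal D ∧ c ⬝ᵥ veronese v = 0} =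
      Nat.card ((traceDot K).orthogonal (D ⊔ L)) := by
    refine Nat.card_congr (Equiv.subtypeEquivRight fun c => ?_)
    simp only [LinearMap.BilinForm.mem_orthogonal_iff]
    constructor
    · rintro ⟨h1, h2⟩ x hx
      obtain ⟨y, hy, z, hz, rfl⟩ := Submodule.mem_sup.1 hx
      obtain ⟨t, rfl⟩ := Submodule.mem_span_singleton.1 hz
      have h3 : traceDot K (t • veronese v) c = 0 := by
        rw [traceDot_apply, smul_dotProduct, dotProduct_comm, h2, smul_zero, map_zero]
      have h4 : traceDot K y c = 0 := h1 y hy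
      change traceDot K (y + t • veronese v) c = 0
      rw [map_add, LinearMap.add_apply, h3, h4, add_zero]
    · refine fun h => ⟨fun x hx => h x (Submodule.mem_sup_left hx), ?_⟩
      refine (traceForm_nondegenerate K F).2 _ fun t => ?_
      have h1 : traceDot K (t • veronese v) c = 0 :=
        h _ (Submodule.mem_sup_right (Submodule.mem_span_singleton.2 ⟨t, rfl⟩))
      rw [traceDot_apply, smul_dotProduct, dotProduct_comm] at h1
      exact h1
  rw [h1, Module.natCard_eq_pow_finrank (K := K), horth]
  refine ⟨by congr 1; lia, by lia⟩

/-- An additive code without elements of rank one has at most `q⁴` elements. The zeros of each form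
in the dual code are divisible in number by `q`, while a nonzero vector is a zero of the fraction
`1 / q` of these forms; counting the pairs shows that `q²` divides the size of the dual code. -/
theorem natCard_le_of_forall_smul_veronese {D : Submodule K (UpperIndex → F)}
    (hD : ∀ v : Fin 3 → F, v ≠ 0 → ∀ t : F, t • veronese v ∈ D → t = 0) :
    Nat.card D ≤ Nat.card F ^ 4 := by
  classical
  have := Fintype.ofFinite F
  have hK : Finite K := Finite.of_injective _ (algebraMap K F).injective
  set m := finrank K F with hm
  set d := finrank K D with hd
  set k := Nat.card K with hk
  have hk1 : 1 < k := Finite.one_lt_card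
  have hq : Nat.card F = k ^ m := Module.natCard_eq_pow_finrank
  set G : Finset (UpperIndex → F) :=
    Finset.univ.filter fun c => c ∈ (traceDot K).orthogonal D with hG
  have hcount : ∀ v : Fin 3 → F, v ≠ 0 →
      (G.filter fun c => c ⬝ᵥ veronese v = 0).card = k ^ (5 * m - d) := by
    intro v hv
    rw [← (card_filter_orthogonal K hv (hD v hv)).1, hG, Finset.filter_filter,
      Nat.card_eq_fintype_card, Fintype.card_subtype]
  have hd5 : d ≤ 5 * m := (card_filter_orthogonal K (one_ne_zero (α := Fin 3 → F))
    (hD 1 one_ne_zero)).2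
  have hGcard : G.card = k ^ m * k ^ (5 * m - d) := by
    have hW : finrank K (UpperIndex → F) = 6 * finrank K F := by
      rw [Module.finrank_pi_fintype, Finset.sum_const, Finset.card_univ]
      rfl
    rw [hG, ← Fintype.card_subtype, ← Nat.card_eq_fintype_card]
    change Nat.card ((traceDot K).orthogonal D) = _
    rw [Module.natCard_eq_pow_finrank (K := K),
      LinearMap.BilinForm.finrank_orthogonal (traceDot_nondegenerate K), hW, ← pow_add]
    congr 1
    lia
  have hdouble := Finset.sum_card_bipartiteAbove_eq_sum_card_bipartiteBelow (s := G)
    (t := (Finset.univ : Finset (Fin 3 → F))) fun c v => c ⬝ᵥ veronese v = 0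
  have hleft : k ^ m ∣ ∑ c ∈ G, (Finset.bipartiteAbove (fun c v => c ⬝ᵥ veronese v = 0)
      (Finset.univ : Finset (Fin 3 → F)) c).card := by
    refine Finset.dvd_sum fun c _ => ?_
    obtain ⟨C, hC⟩ := exists_dotProduct_veronese c
    rw [Finset.bipartiteAbove, ← hq, Nat.card_eq_fintype_card]
    simp only [hC]
    exact dvd_card_quadratic_zeros C
  have hzero : (G.filter fun c => c ⬝ᵥ veronese (0 : Fin 3 → F) = 0) = G := by
    refine Finset.filter_true_of_mem fun c _ => ?_
    rw [show veronese (0 : Fin 3 → F) = 0 by simp [veronese], dotProduct_zero]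
  have hright : ∑ v : Fin 3 → F, (Finset.bipartiteBelow (fun c v => c ⬝ᵥ veronese v = 0) G v).card
      + k ^ (5 * m - d) = k ^ m * k ^ (5 * m - d) + (k ^ m) ^ 3 * k ^ (5 * m - d) := by
    rw [← Finset.add_sum_erase _ _ (Finset.mem_univ 0), add_assoc]
    simp only [Finset.bipartiteBelow]
    rw [hzero, hGcard, Finset.sum_congr rfl fun v hv => hcount v (Finset.ne_of_mem_erase hv),
      Finset.sum_const, Finset.card_erase_of_mem (Finset.mem_univ 0), Finset.card_univ, smul_eq_mul,
      Fintype.card_fun, Fintype.card_fin, ← Nat.card_eq_fintype_card, hq, ← Nat.succ_mul,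
      Nat.succ_eq_add_one, Nat.sub_add_cancel (Nat.one_le_pow _ _ (by positivity))]
  have hdvd : k ^ m ∣ k ^ (5 * m - d) := by
    rw [hdouble] at hleft
    rw [← Nat.dvd_add_right hleft, hright]
    exact dvd_add (Dvd.intro _ rfl) (((dvd_pow_self _ (by simp))).mul_right _)
  have hexp : m ≤ 5 * m - d := (Nat.pow_dvd_pow_iff_le_right hk1).1 hdvd
  rw [Module.natCard_eq_pow_finrank (K := K), hq, ← pow_mul]
  exact Nat.pow_le_pow_right hk1.le (by lia)

end AdditiveCodes

theorem ncard_le_of_isSymmCode {F : Type*} [Field F] [Finite F]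
    (D : AddSubgroup (Matrix (Fin 3) (Fin 3) F))
    (hD : IsSymmCode 2 (D : Set (Matrix (Fin 3) (Fin 3) F))) :
    (D : Set (Matrix (Fin 3) (Fin 3) F)).ncard ≤ Nat.card F ^ 4 := by
  obtain ⟨p, hp⟩ := CharP.exists F
  have : Fact p.Prime := ⟨CharP.char_prime_of_ne_zero F (CharP.char_ne_zero_of_finite F p)⟩
  let : Algebra (ZMod p) F := ZMod.algebra F p
  have h1 : (D : Set (Matrix (Fin 3) (Fin 3) F)).ncard =
      Nat.card (AddSubgroup.toZModSubmodule p (D.map (upperPart (F := F)).toAddMonoidHom)) := by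
    rw [← Set.InjOn.ncard_image (f := upperPart (F := F)) fun A hA B hB h =>
      eq_of_upperPart_eq (hD.1 A hA) (hD.1 B hB) h]
    rfl
  rw [h1]
  refine natCard_le_of_forall_smul_veronese (ZMod p) fun v hv t ht => ?_
  obtain ⟨A, hA, hAv⟩ := ht
  by_contra ht0
  have hAv : A = t • Matrix.vecMulVec v v := by
    refine eq_of_upperPart_eq (hD.1 A hA) ?_ ?_
    · exact Matrix.IsSymm.smul (Matrix.transpose_vecMulVec v v) t
    · rw [map_smul]
      exact hAv
  have hA0 : A ≠ 0 := by
    rintro rfl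
    refine smul_ne_zero ht0 (veronese_ne_zero hv) ?_
    rw [veronese, ← map_smul, ← hAv, map_zero]
  have h2 := hD.2.2 ⟨A, hA, 0, D.zero_mem, hA0, rfl⟩
  have h3 := Matrix.rank_vecMulVec_le (t • v) v
  rw [Matrix.smul_vecMulVec, ← hAv] at h3
  rw [sub_zero] at h2
  lia

/-! ### Generators, codes and regulus -/

theorem mainTheorem1 (F : Type*) [Field F] [Fintype F] (hq : 2 < Fintype.card F) :
    Set.BijOn (rowSpace : Matrix (Fin 3) (Fin 3) F → Submodule F (AmbientSpace F 3))
      {A | A.IsSymm} {U | IsGenerator U ∧ Disjoint U (planeOne F 3)} ∧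
    (∃ 𝒳 : Set (Submodule F (AmbientSpace F 3)),
      IsPlaneCode 𝒳 ∧
      𝒳.ncard = Fintype.card F ^ 4 + Fintype.card F ^ 3 + 1 ∧
      IsSymmCode 2 {A : Matrix (Fin 3) (Fin 3) F | A.IsSymm ∧ rowSpace A ∈ 𝒳} ∧
      {A : Matrix (Fin 3) (Fin 3) F | A.IsSymm ∧ rowSpace A ∈ 𝒳}.ncard =
        Fintype.card F ^ 4 + Fintype.card F ^ 3 + 1) ∧
    (∀ D : AddSubgroup (Matrix (Fin 3) (Fin 3) F),
      IsSymmCode 2 (D : Set (Matrix (Fin 3) (Fin 3) F)) →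
      (D : Set (Matrix (Fin 3) (Fin 3) F)).ncard <
        Fintype.card F ^ 4 + Fintype.card F ^ 3 + 1) ∧
    (∀ C : Set (Matrix (Fin 3) (Fin 3) F), IsMaximumSymmCode 2 C →
      Fintype.card F ^ 4 + Fintype.card F ^ 3 + 1 ≤ C.ncard) ∧
    (∀ E : Submodule F (AmbientSpace F 3), IsGenerator E →
      Disjoint E (planeOne F 3) → Disjoint E (planeTwo F 3) →
      (∃! 𝓡 : Set (Submodule F (AmbientSpace F 3)),
        IsSegrePlanes 𝓡 ∧ planeOne F 3 ∈ 𝓡 ∧ planeTwo F 3 ∈ 𝓡 ∧ E ∈ 𝓡) ∧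
      ∀ 𝓡 : Set (Submodule F (AmbientSpace F 3)),
        IsSegrePlanes 𝓡 → planeOne F 3 ∈ 𝓡 → planeTwo F 3 ∈ 𝓡 → E ∈ 𝓡 →
        (∃ S 𝓕, IsAdmissible E 𝓡 S 𝓕) ∧
        ∀ S 𝓕, IsAdmissible E 𝓡 S 𝓕 →
          IsPlaneCode (barX 𝓡 S 𝓕) ∧
          (barX 𝓡 S 𝓕).ncard = Fintype.card F ^ 4 + Fintype.card F ^ 3 - 1) := by
  refine ⟨bijOn_rowSpace, ?_, ?_, ?_, ?_⟩
  · obtain ⟨𝒳, hX, hcard, A, hA, hr, h0, hA'⟩ := exists_isPlaneCode hq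
    exact ⟨𝒳, hX, hcard, hX.isSymmCode hA hr h0 hA', hX.ncard_preimage.trans hcard⟩
  · intro D hD
    have h1 := ncard_le_of_isSymmCode D hD
    rw [Nat.card_eq_fintype_card] at h1
    lia
  · intro C hC
    obtain ⟨𝒳, hX, hcard, A, hA, hr, h0, hA'⟩ := exists_isPlaneCode hq
    rw [← hcard, ← hX.ncard_preimage]
    exact hC.2 _ (hX.isSymmCode hA hr h0 hA')
  · intro E hE hE1 hE2
    obtain ⟨A₀, hA, rfl⟩ := exists_rowSpace_eq hE hE1
    have hinj : ∀ x, A₀ *ᵥ x = 0 → x = 0 := fun x =>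
      mulVec_eq_zero_of_disjoint hA hE2
    have hmem : planeOne F 3 ∈ regulus A₀ ∧ planeTwo F 3 ∈ regulus A₀ ∧
        rowSpace A₀ ∈ regulus A₀ :=
      ⟨Or.inl rfl, Or.inr ⟨0, by simp [planeTwo]⟩, Or.inr ⟨1, by simp⟩⟩
    refine ⟨⟨regulus A₀, ⟨isSegrePlanes_regulus hA hinj, hmem⟩, fun 𝓡 h =>
      eq_regulus_of_isSegrePlanes hA hinj h.1 h.2.1 h.2.2.1 h.2.2.2⟩, fun 𝓡 h h1 h2 h3 => ?_⟩
    obtain rfl := eq_regulus_of_isSegrePlanes hA hinj h h1 h2 h3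
    refine ⟨?_, fun S 𝓕 hadm => ⟨isPlaneCode_barX hA hinj hadm, ncard_barX hA hinj hadm⟩⟩
    obtain ⟨S, 𝓕, hadm, -⟩ := exists_isAdmissible_of_frames hA (fun _ _ => True) fun p hp =>
      (exists_isSuitable hA hq hinj hp).imp fun D hD => ⟨hD, trivial⟩
    exact ⟨S, 𝓕, hadm⟩
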